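/- Let $k$ be a field; all spaces are $\mathbb Z$-graded $k$-vector spaces. For a finite connected graph $\Gamma$ with vertices $v$ of genus $g(v)$ and sets of flags $F_v$, put $\mathfrak K(\Gamma)=\mathrm{Det}(\mathrm{Edge}(\Gamma))=\Lambda^{top}(k^{\mathrm{Edge}(\Gamma)})$, placed in degree $\varepsilon|\mathrm{Edge}(\Gamma)|$ with a fixed $\varepsilon\in\{1,-1\}$. A *$\mathfrak K$-modular operad* $\mathcal O$ is an algebra over the $\mathfrak K$-twisted triple of connected genus-labelled graphs: graded spaces $\mathcal O(g,S)$ ($g\ge 0$, $S$ a finite set), functorial in bijections of $S$, with degree $0$ compositions $\mathfrak K(\Gamma)\otimes\bigotimes_v\mathcal O(g(v),F_v)\to\mathcal O(g,S)$ for every such graph $\Gamma$ with tails labelled by $S$ and total genus $g=\sum_v g(v)+\dim H^1(\Gamma)$, which are equivariant under relabellings and isomorphisms, unital, and compatible with the insertion of graphs into vertices (Koszul signs; $\mathfrak K(\Gamma_0)\otimes\bigotimes_v\mathfrak K(\Gamma_v)\to\mathfrak K(\Gamma_1)$ is the exterior product). For distinct $s,s'\in S$ let $\bullet_{ss'}:\mathcal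 O(g,S)\to\mathcal O(g+1,S\setminus\{s,s'\})$ be the composition along the graph with one vertex and the single loop $\{s,s'\}$, for the generator of $\mathfrak K$ given by this edge. *$\mathfrak K$-twisted wheeled properads* (resp. *PROPs*) $\mathcal O(S,T)$, with inputs $S$ and outputs $T$, are defined in the same way with connected (resp. arbitrary) non-empty directed graphs, wheels allowed, without genus; $\bullet_{st}:\mathcal O(S,T)\to\mathcal O(S\setminus\{s\},T\setminus\{t\})$ is the composition along the one-vertex graph with one edge joining the output $t$ to the input $s$. An *extended modular operad* (EMO) consists of topological spaces $X(S)$, functorial in bijections of the finite set $S$, with a continuous action $\rho$ of $(S^1)^S$, $S^1=\mathbb R/\mathbb Z$, compatible with the bijections, continuous self-gluings $\circ_{ss'}=\circ_{s's}:X(S)\to X(S\setminus\{s,s'\})$ and continuous, associative and commutative horizontal compositions $X(S)\times X(T)\to X(S\amalg T)$; all these are equivariant for bijections, gluings along disjoint pairs commute, gluings and horizontal compositions are compatible with each other and with the rotations of the remaining flags, and gluings are balanced: $\circ_{ss'}\rho_s(\theta)=\circ_{ss'}\rho_{s'}(\theta)$. Its chain-level version is $\mathcal O(S)=S_*(X(S);k)$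 (singular chains) with $\bullet_{ss'}(\alpha)=(\circ_{ss'})_*(\rho_s)_*([S^1]\times\alpha)$, where $\times$ is the Eilenberg–Zilber product. **Theorem.** Let $\mathcal O$ be a $\mathfrak K$-modular operad or the chain-level version of an EMO. 1. For a four-element subset $\{s,s',t,t'\}\subset S$ and $a\in\mathcal O(S)$ (of any genus), $\bullet_{ss'}\bullet_{tt'}(a)=-\bullet_{tt'}\bullet_{ss'}(a)$ in $\mathcal O(S\setminus\{s,s',t,t'\})$. 2. The operator $\Delta(a)=\sum_{\{s,s'\}\subset S,\,s\ne s'}\bullet_{ss'}(a)\in\bigoplus_{\{s,s'\}}\mathcal O(S\setminus\{s,s'\})$ satisfies $\Delta^2=0$. 3. Biased setting: write $\mathcal O((n))=\mathcal O(\{0,\dots,n-1\})$ (for each genus) and renumber $\{0,\dots,n-1\}\setminus\{i,j\}$ by the order-preserving bijection. Then $\Delta=\sum_{i<j}\bullet_{ij}$ on $\bigoplus\mathcal O((n))$ satisfies $\Delta^2=0$. 4. There is a linear operator $D$ on $\mathcal O^\oplus_{\mathbb S}=\bigoplus\mathcal O((n))_{\mathbb S_n}$ (sum over $n$, and over the genus)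 with $D^2=0$ which is induced by the biased $\Delta$ of 3 and, for every $S$, by the $\Delta$ of 2, an element $a\in\mathcal O(S)$ being sent to its class for any bijection $S\cong\{0,\dots,|S|-1\}$. 5. $D$ lifts to a differential (operator of square zero), also induced by the biased $\Delta$, on the cyclic coinvariants $\bigoplus\mathcal O((n))_{C_n}$, where $C_n\subset\mathbb S_n$ is the cyclic group of rotations. If $\mathrm{char}\,k=0$, the natural map $\bigoplus\mathcal O((n))^{C_n}\to\bigoplus\mathcal O((n))_{C_n}$ is bijective, and there is a differential on the cyclic invariants corresponding to the latter under it. The same holds for $\mathfrak K$-twisted wheeled properads and PROPs: $\bullet_{st}\bullet_{s't'}=-\bullet_{s't'}\bullet_{st}$ for $s\neq s'$, $t\neq t'$; $\Delta(a)=\sum_{s\in S,t\in T}\bullet_{st}(a)$ satisfies $\Delta^2=0$, both for finite sets and in the biased setting $\mathcal O(n,m)$; it induces a differential on $\bigoplus\mathcal O(n,m)_{\mathbb S_n\times\mathbb S_m}$, which lifts to the $C_n\times C_m$-coinvariants and, in characteristic $0$, to the $C_n\times C_m$-invariants. -/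

import Mathlib

open scoped DirectSum ExteriorAlgebra

universe u w

noncomputable section

/-! ## Graphs -/

/-- A finite graph given by vertices and flags: `Fl v` is the set of flags at the vertex `v`, and
the involution `inv` on the set of all flags has the tails as fixed points and the edges as
two-element orbits.  The vertex set carries a total order; it is used only to write the
tensor product over the vertices of graded spaces as an ordered one (with Koszul signs when the
order is changed), and isomorphisms of graphs need not respect it. -/
structure FGraph where
  V : Type
  finV : Fintype V
  ordV : LinearOrder V
  Fl : V → Type
  finFl : ∀ v, Finite (Fl v)
  inv : (Σ v, Fl v) → (Σ v, Fl v)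
  inv_inv : ∀ f, inv (inv f) = f

attribute [instance] FGraph.finV FGraph.ordV FGraph.finFl

namespace FGraph

/-- All flags. -/
abbrev Flag (Γ : FGraph) : Type := Σ v, Γ.Fl v

/-- The tails are the flags fixed by the involution. -/
abbrev Tail (Γ : FGraph) : Type := {f : Γ.Flag // Γ.inv f = f}

/-- The edges are the two-element orbits `{f, inv f}`. -/
def Edge (Γ : FGraph) : Type := {e : Sym2 Γ.Flag // ∃ f, Γ.inv f ≠ f ∧ e = s(f, Γ.inv f)}

instance (Γ : FGraph) : Finite Γ.Edge := inferInstanceAs (Finite {_e : Sym2 Γ.Flag // _})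

/-- A connected (in particular non-empty) graph. -/
def Connected (Γ : FGraph) : Prop :=
  Nonempty Γ.V ∧ ∀ v w : Γ.V, Relation.EqvGen (fun v w => ∃ f : Γ.Flag, f.1 = v ∧ (Γ.inv f).1 = w) v w

/-- `g` is the total genus `∑ᵥ gen v + dim H¹(Γ)` of a connected graph `Γ` with vertex genera `gen`,
where `dim H¹(Γ) = |E| - |V| + 1`. -/
def HasGenus (Γ : FGraph) (gen : Γ.V → ℕ) (g : ℕ) : Prop :=
  ∑ v, gen v + Nat.card Γ.Edge + 1 = g + Fintype.card Γ.V

/-- The one-dimensional space `Det(Edge(Γ))`: the top exterior power of the vector space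
with basis the edges.  (Its degree is taken into account where it is used.) -/
abbrev Det (k : Type*) [Field k] (Γ : FGraph) : Submodule k (ExteriorAlgebra k (Γ.Edge →₀ k)) :=
  ⋀[k]^(Nat.card Γ.Edge) (Γ.Edge →₀ k)

/-- Isomorphisms of graphs. -/
structure Iso (Γ Γ' : FGraph) where
  v : Γ.V ≃ Γ'.V
  fl : ∀ w, Γ.Fl w ≃ Γ'.Fl (v w)
  comm : ∀ f : Γ.Flag, (⟨v (Γ.inv f).1, fl _ (Γ.inv f).2⟩ : Γ'.Flag) = Γ'.inv ⟨v f.1, fl _ f.2⟩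

namespace Iso

variable {Γ Γ' : FGraph}

/-- The map on flags. -/
def flag (φ : Iso Γ Γ') (f : Γ.Flag) : Γ'.Flag := ⟨φ.v f.1, φ.fl _ f.2⟩

theorem flag_injective (φ : Iso Γ Γ') : Function.Injective φ.flag := by
  rintro ⟨v, f⟩ ⟨w, g⟩ h
  simp only [flag, Sigma.mk.injEq, EmbeddingLike.apply_eq_iff_eq] at h
  obtain ⟨rfl, h⟩ := h
  simpa using h

/-- The map on edges. -/
def edge (φ : Iso Γ Γ') (e : Γ.Edge) : Γ'.Edge :=
  ⟨e.1.map φ.flag, by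
    obtain ⟨f, hf, he⟩ := e.2
    have hc : φ.flag (Γ.inv f) = Γ'.inv (φ.flag f) := φ.comm f
    refine ⟨φ.flag f, ?_, by rw [he, Sym2.map_mk, hc]⟩
    rw [← hc]
    exact fun h => hf (φ.flag_injective h)⟩

/-- The exponent of the Koszul sign of the permutation of the tensor factors (of degrees `d`). -/
def koszul (φ : Iso Γ Γ') (d : Γ.V → ℤ) : ℤ :=
  ∑ v, ∑ w, if v < w ∧ φ.v w < φ.v v then d v * d w else 0

end Iso

/-! ### Insertion of graphs into the vertices of a graph -/

section Subst

variable (Γ₀ : FGraph) (Γ : Γ₀.V → FGraph) (lab : ∀ v, (Γ v).Tail ≃ Γ₀.Fl v)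

/-- A flag of the inserted graph `Γ v`, as a flag of the big graph. -/
def innerFlag (v : Γ₀.V) (f : (Γ v).Flag) : Σ p : (Σ v, (Γ v).V), (Γ p.1).Fl p.2 :=
  ⟨⟨v, f.1⟩, f.2⟩

/-- A flag of `Γ₀` at `v` is identified with the tail of `Γ v` which it labels. -/
def outerFlag (f : Γ₀.Flag) : Σ p : (Σ v, (Γ v).V), (Γ p.1).Fl p.2 :=
  innerFlag Γ₀ Γ f.1 ((lab f.1).symm f.2).1

open Classical in
/-- The involution of the big graph: inside `Γ v` it is the one of `Γ v`; tails
of the `Γ v` are joined as prescribed by `Γ₀`. -/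
def substInv (f : Σ p : (Σ v, (Γ v).V), (Γ p.1).Fl p.2) : Σ p : (Σ v, (Γ v).V), (Γ p.1).Fl p.2 :=
  if h : (Γ f.1.1).inv ⟨f.1.2, f.2⟩ = ⟨f.1.2, f.2⟩ then
    outerFlag Γ₀ Γ lab (Γ₀.inv ⟨f.1.1, lab f.1.1 ⟨⟨f.1.2, f.2⟩, h⟩⟩)
  else innerFlag Γ₀ Γ f.1.1 ((Γ f.1.1).inv ⟨f.1.2, f.2⟩)

theorem innerFlag_injective (v : Γ₀.V) : Function.Injective (innerFlag Γ₀ Γ v) := by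
  rintro ⟨w, f⟩ ⟨w', f'⟩ h
  simp only [innerFlag, Sigma.mk.injEq] at h
  obtain ⟨h1, h2⟩ := h
  obtain rfl : w = w' := by simpa using h1
  simpa using h2

theorem outerFlag_injective : Function.Injective (outerFlag Γ₀ Γ lab) := by
  rintro ⟨v, f⟩ ⟨w, g⟩ h
  have h1 : v = w := congrArg (fun x => x.1.1) h
  subst h1
  have h2 := innerFlag_injective Γ₀ Γ v h
  have h3 : f = g := (lab v).symm.injective (Subtype.ext h2)
  rw [h3]

theorem substInv_outer (f : Γ₀.Flag) :
    substInv Γ₀ Γ lab (outerFlag Γ₀ Γ lab f) = outerFlag Γ₀ Γ lab (Γ₀.inv f) := by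
  have h := ((lab f.1).symm f.2).2
  unfold substInv
  rw [dif_pos (show (Γ (outerFlag Γ₀ Γ lab f).1.1).inv ⟨(outerFlag Γ₀ Γ lab f).1.2,
    (outerFlag Γ₀ Γ lab f).2⟩ = ⟨(outerFlag Γ₀ Γ lab f).1.2, (outerFlag Γ₀ Γ lab f).2⟩ from h)]
  congr 2
  change (⟨f.1, lab f.1 ((lab f.1).symm f.2)⟩ : Γ₀.Flag) = f
  rw [Equiv.apply_symm_apply]

theorem substInv_inner (v : Γ₀.V) (f : (Γ v).Flag) (hf : (Γ v).inv f ≠ f) :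
    substInv Γ₀ Γ lab (innerFlag Γ₀ Γ v f) = innerFlag Γ₀ Γ v ((Γ v).inv f) := by
  unfold substInv
  exact dif_neg hf

theorem flag_cases (f : Σ p : (Σ v, (Γ v).V), (Γ p.1).Fl p.2) :
    (∃ f₀, f = outerFlag Γ₀ Γ lab f₀) ∨
      ∃ v, ∃ f' : (Γ v).Flag, (Γ v).inv f' ≠ f' ∧ f = innerFlag Γ₀ Γ v f' := by
  obtain ⟨⟨v, w⟩, f⟩ := f
  by_cases h : (Γ v).inv ⟨w, f⟩ = ⟨w, f⟩
  · refine Or.inl ⟨⟨v, lab v ⟨⟨w, f⟩, h⟩⟩, ?_⟩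
    simp only [outerFlag]
    rw [Equiv.symm_apply_apply]
    rfl
  · exact Or.inr ⟨v, ⟨w, f⟩, h, rfl⟩

/-- The graph obtained by inserting `Γ v` into the vertex `v` of `Γ₀`, for all `v`; the tails of
`Γ v` are identified with the flags of `Γ₀` at `v` by `lab v`.  Its vertices are
ordered lexicographically. -/
abbrev subst : FGraph where
  V := Σ v, (Γ v).V
  finV := inferInstance
  ordV := Sigma.Lex.linearOrder (ι := Γ₀.V) (α := fun v => (Γ v).V)
  Fl p := (Γ p.1).Fl p.2
  finFl _ := inferInstance
  inv := substInv Γ₀ Γ lab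
  inv_inv f := by
    rcases flag_cases Γ₀ Γ lab f with ⟨f₀, rfl⟩ | ⟨v, f', h, rfl⟩
    · rw [substInv_outer, substInv_outer, Γ₀.inv_inv]
    · rw [substInv_inner _ _ _ _ _ h, substInv_inner, (Γ v).inv_inv]
      rw [(Γ v).inv_inv]; exact h.symm

/-- An edge of `Γ v` as an edge of the big graph. -/
def innerEdge (v : Γ₀.V) (e : (Γ v).Edge) : (subst Γ₀ Γ lab).Edge :=
  ⟨e.1.map (innerFlag Γ₀ Γ v), by
    obtain ⟨f, hf, he⟩ := e.2
    have hs := substInv_inner Γ₀ Γ lab v f hf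
    refine ⟨innerFlag Γ₀ Γ v f, ?_, ?_⟩
    · change substInv _ _ _ _ ≠ _
      rw [hs]; exact fun h => hf (innerFlag_injective _ _ _ h)
    · change _ = s(_, substInv _ _ _ _)
      rw [he, Sym2.map_mk, hs]⟩

/-- An edge of `Γ₀` as an edge of the big graph. -/
def outerEdge (e : Γ₀.Edge) : (subst Γ₀ Γ lab).Edge :=
  ⟨e.1.map (outerFlag Γ₀ Γ lab), by
    obtain ⟨f, hf, he⟩ := e.2
    have hs := substInv_outer Γ₀ Γ lab f
    refine ⟨outerFlag Γ₀ Γ lab f, ?_, ?_⟩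
    · change substInv _ _ _ _ ≠ _
      rw [hs]; exact fun h => hf (outerFlag_injective _ _ _ h)
    · change _ = s(_, substInv _ _ _ _)
      rw [he, Sym2.map_mk, hs]⟩

/-- The map `Det(Edge Γ₀) ⊗ ⨂ᵥ Det(Edge (Γ v)) → Det(Edge (subst Γ₀ Γ))`, as the exterior product
`ω₀ ∧ ⋀ᵥ ω v`, the factors `ω v` being taken in the order of the vertices of `Γ₀`. -/
def wedge (k : Type*) [Field k] (ω₀ : Det k Γ₀) (ω : ∀ v, Det k (Γ v)) :
    ExteriorAlgebra k ((subst Γ₀ Γ lab).Edge →₀ k) :=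
  ExteriorAlgebra.map (Finsupp.lmapDomain k k (outerEdge Γ₀ Γ lab)) ω₀.1 *
    (((Finset.univ : Finset Γ₀.V).sort (· ≤ ·)).map fun v =>
      ExteriorAlgebra.map (Finsupp.lmapDomain k k (innerEdge Γ₀ Γ lab v)) (ω v).1).prod

/-- The exponent of the Koszul sign for `⨂ᵥ (ω v ⊗ x v) ↦ (⨂ᵥ ω v) ⊗ (⨂ᵥ x v)`, where `ω v` has
the parity of the number of edges of `Γ v` and `x v = ⨂ x v w` has degree `∑ d (v, w)`. -/
def substKoszul (d : (subst Γ₀ Γ lab).V → ℤ) : ℤ :=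
  ∑ v, ∑ v', if v < v' then (∑ w, d ⟨v, w⟩) * (Nat.card (Γ v').Edge : ℤ) else 0

end Subst

/-! ### One-vertex graphs -/

/-- The one-vertex graph with flags `S` and without edges. -/
abbrev corolla (S : Type) [Finite S] : FGraph where
  V := Unit
  finV := inferInstance
  ordV := inferInstance
  Fl _ := S
  finFl _ := inferInstance
  inv f := f
  inv_inv _ := rfl

/-- The tails of the corolla. -/
def corollaTail (S : Type) [Finite S] : (corolla S).Tail ≃ S where
  toFun f := f.1.2
  invFun s := ⟨⟨(), s⟩, rfl⟩
  left_inv _ := rfl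
  right_inv _ := rfl

theorem card_edge_corolla (S : Type) [Finite S] : Nat.card (corolla S).Edge = 0 := by
  have : IsEmpty (corolla S).Edge := ⟨fun e => by obtain ⟨_, f, hf, _⟩ := e; exact hf rfl⟩
  exact Nat.card_of_isEmpty

/-- The generator `1` of `Det(∅)`. -/
def corollaDet (k : Type*) [Field k] (S : Type) [Finite S] : Det k (corolla S) :=
  ⟨1, by rw [Det, card_edge_corolla, ExteriorAlgebra.exteriorPower, pow_zero]; exact Submodule.one_le.mp le_rfl⟩

theorem corolla_connected (S : Type) [Finite S] : (corolla S).Connected :=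
  ⟨⟨()⟩, fun _ _ => .refl _⟩

theorem corolla_hasGenus (S : Type) [Finite S] (g : ℕ) : (corolla S).HasGenus (fun _ => g) g := by
  have h1 : ∑ _v : (corolla S).V, g = g := by change ∑ _v : Unit, g = g; simp
  have h2 : Fintype.card (corolla S).V = 1 := Fintype.card_unit
  rw [HasGenus, card_edge_corolla, h1, h2]

open Classical in
/-- The involution of `S` which exchanges the two elements of `e`. -/
def flip {S : Type} (e : Sym2 S) (x : S) : S := if h : x ∈ e then Sym2.Mem.other h else x

theorem flip_mk {S : Type} (x y : S) : flip s(x, y) x = y := by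
  rw [flip, dif_pos (Sym2.mem_mk_left x y)]
  exact Sym2.congr_right.mp (Sym2.other_spec (Sym2.mem_mk_left x y))

theorem flip_of_not_mem {S : Type} {e : Sym2 S} {x : S} (h : x ∉ e) : flip e x = x := by
  rw [flip, dif_neg h]

theorem flip_flip {S : Type} (e : Sym2 S) (x : S) : flip e (flip e x) = x := by
  by_cases h : x ∈ e
  · obtain ⟨y, rfl⟩ := h
    rw [flip_mk, Sym2.eq_swap, flip_mk]
  · rw [flip_of_not_mem h, flip_of_not_mem h]

theorem flip_eq_iff {S : Type} {e : Sym2 S} (he : ¬ e.IsDiag) (x : S) : flip e x = x ↔ x ∉ e := by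
  refine ⟨fun h hx => ?_, flip_of_not_mem⟩
  obtain ⟨y, rfl⟩ := hx
  rw [flip_mk] at h
  exact he (by simp [h])

/-- The one-vertex graph with flags `S` and one loop, joining the two elements of `e`. -/
abbrev loop {S : Type} [Finite S] (e : Sym2 S) : FGraph where
  V := Unit
  finV := inferInstance
  ordV := inferInstance
  Fl _ := S
  finFl _ := inferInstance
  inv f := ⟨(), flip e f.2⟩
  inv_inv f := by rw [flip_flip]

/-- The tails of the loop graph. -/
def loopTail {S : Type} [Finite S] (e : Sym2 S) (he : ¬ e.IsDiag) : (loop e).Tail ≃ {x : S // x ∉ e} where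
  toFun f := ⟨f.1.2, by
    rw [← flip_eq_iff he]
    have h := f.2
    simpa [loop, Sigma.ext_iff] using h⟩
  invFun s := ⟨⟨(), s.1⟩, by simp [loop, flip_of_not_mem s.2]⟩
  left_inv _ := rfl
  right_inv _ := rfl

theorem loop_edge_aux {S : Type} [Finite S] (e : Sym2 S) (he : ¬ e.IsDiag) :
    ∃ f : (loop e).Flag, (loop e).inv f ≠ f ∧ e.map (Sigma.mk ()) = s(f, (loop e).inv f) := by
  induction e with | _ x y => ?_
  refine ⟨⟨(), x⟩, fun h => ?_, ?_⟩
  · refine he ?_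
    have h' : flip s(x, y) x = x := by simpa [loop, Sigma.ext_iff] using h
    rw [flip_mk] at h'
    simp [h']
  · simp [loop, flip_mk]

/-- The unique edge of the loop graph. -/
def loopEdge {S : Type} [Finite S] (e : Sym2 S) (he : ¬ e.IsDiag) : (loop e).Edge := ⟨e.map (Sigma.mk ()), loop_edge_aux e he⟩

theorem loop_edge_unique {S : Type} [Finite S] (e : Sym2 S) (he : ¬ e.IsDiag) (e' : (loop e).Edge) : e' = loopEdge e he := by
  obtain ⟨e', f, hf, h⟩ := e'
  apply Subtype.ext
  obtain ⟨⟨⟩, x⟩ := f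
  subst h
  have hx : x ∈ e := by
    by_contra hx
    exact hf (by simp [loop, flip_of_not_mem hx])
  obtain ⟨y, hy⟩ := hx
  have hxy : flip e x = y := by rw [hy, flip_mk]
  change s((⟨(), x⟩ : (loop e).Flag), ⟨(), flip e x⟩) = e.map (Sigma.mk ())
  rw [hxy, hy, Sym2.map_mk]

theorem card_edge_loop {S : Type} [Finite S] (e : Sym2 S) (he : ¬ e.IsDiag) : Nat.card (loop e).Edge = 1 :=
  Nat.card_eq_one_iff_unique.mpr
    ⟨⟨fun a b => by rw [loop_edge_unique e he a, loop_edge_unique e he b]⟩, ⟨loopEdge e he⟩⟩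

/-- The generator of `Det(Edge)` of the loop graph given by its edge. -/
def loopDet {S : Type} [Finite S] (e : Sym2 S) (he : ¬ e.IsDiag) (k : Type*) [Field k] : Det k (loop e) :=
  ⟨ExteriorAlgebra.ι k (Finsupp.single (loopEdge e he) 1), by
    rw [Det, card_edge_loop e he, ExteriorAlgebra.exteriorPower, pow_one]; exact LinearMap.mem_range_self _ _⟩

theorem loop_connected {S : Type} [Finite S] (e : Sym2 S) : (loop e).Connected := ⟨⟨()⟩, fun _ _ => .refl _⟩

theorem loop_hasGenus {S : Type} [Finite S] (e : Sym2 S) (he : ¬ e.IsDiag) (g : ℕ) : (loop e).HasGenus (fun _ => g) (g + 1) := by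
  have h1 : ∑ _v : (loop e).V, g = g := by change ∑ _v : Unit, g = g; simp
  have h2 : Fintype.card (loop e).V = 1 := Fintype.card_unit
  rw [HasGenus, card_edge_loop e he, h1, h2]

end FGraph

/-! ## Families of representations, their coinvariants and invariants -/

/-- A family of `k`-linear representations. -/
structure RepFamily (k : Type u) [Field k] where
  P : Type
  M : P → ModuleCat.{w} k
  G : P → Type
  grp : ∀ p, Group (G p)
  ρ : ∀ p, Representation k (G p) (M p)

attribute [instance] RepFamily.grp

namespace RepFamily

variable {k : Type u} [Field k] (R : RepFamily.{u, w} k) (H : ∀ p, Subgroup (R.G p))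

/-- The restriction of the representations to subgroups. -/
abbrev res (p : R.P) : Representation k (H p) (R.M p) := (R.ρ p).comp (H p).subtype

/-- The direct sum of the representations. -/
abbrev Tot : Type _ := ⨁ p, R.M p

/-- The direct sum of the spaces of coinvariants with respect to the subgroups `H p`. -/
abbrev Coinv : Type _ := ⨁ p, (R.res H p).Coinvariants

/-- The projection to the coinvariants. -/
def proj : R.Tot →ₗ[k] R.Coinv H := DirectSum.lmap fun p => Representation.Coinvariants.mk (R.res H p)

/-- The projection from the coinvariants of the `H p` to those of the whole groups. -/
def coinvToTop : R.Coinv H →ₗ[k] R.Coinv (fun _ => ⊤) :=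
  DirectSum.lmap fun p => Representation.Coinvariants.lift (R.res H p)
    (Representation.Coinvariants.mk (R.res (fun _ => ⊤) p)) fun h => by
      ext x
      exact Representation.Coinvariants.mk_self_apply (R.res (fun _ => ⊤) p) ⟨h.1, trivial⟩ x

/-- The direct sum of the spaces of invariants of the subgroups `H p`. -/
abbrev Inv : Type _ := ⨁ p, (R.res H p).invariants

/-- The map from invariants to coinvariants (inclusion followed by projection). -/
def invToCoinv : R.Inv H →ₗ[k] R.Coinv H :=
  DirectSum.lmap fun p => Representation.Coinvariants.mk (R.res H p) ∘ₗ (R.res H p).invariants.subtype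

end RepFamily

/-! ## Self-gluings and the operator `Δ` -/

/-- The data of a family of spaces `obj c S`, functorial in the finite set `S` with respect to
bijections, with self-gluings `obj c S → obj (next c) (S \ {s, s'})` for all two-element subsets
`{s, s'}` of `S`.  The index `c` records the degree, and the genus if there is one. -/
structure SelfGluing (k : Type u) [Field k] where
  Idx : Type
  next : Idx → Idx
  obj : Idx → (S : Type) → [Finite S] → ModuleCat.{w} k
  map : ∀ {c : Idx} {S T : Type} [Finite S] [Finite T], (S ≃ T) → (obj c S →ₗ[k] obj c T)
  map_refl : ∀ {c : Idx} {S : Type} [Finite S] (a : obj c S), map (Equiv.refl S) a = a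
  map_trans : ∀ {c : Idx} {S T U : Type} [Finite S] [Finite T] [Finite U] (φ : S ≃ T) (ψ : T ≃ U)
    (a : obj c S), map (φ.trans ψ) a = map ψ (map φ a)
  glue : ∀ {c : Idx} {S : Type} [Finite S] (e : Sym2 S), ¬ e.IsDiag →
    (obj c S →ₗ[k] obj (next c) {x : S // x ∉ e})

/-- `e = {s, s'}` is a two-element subset of `A`, and `B = A \ {s, s'}`. -/
structure PairOff {U : Type} (A : Finset U) (e : Sym2 U) (B : Finset U) : Prop where
  ne : ¬ e.IsDiag
  sub : ∀ x ∈ e, x ∈ A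
  compl : ∀ x, x ∈ B ↔ x ∈ A ∧ x ∉ e

namespace PairOff

variable {U : Type} {A B : Finset U} {e : Sym2 U}

/-- `e` as a two-element subset of the type `A`. -/
def pair (h : PairOff A e B) : Sym2 A := e.attachWith h.sub

theorem pair_map (h : PairOff A e B) : h.pair.map Subtype.val = e := Sym2.attachWith_map_subtypeVal _

theorem pair_ne (h : PairOff A e B) : ¬ h.pair.IsDiag := fun hd => h.ne (by
  rw [← h.pair_map]
  generalize h.pair = e' at hd
  induction e' with | _ x y => ?_
  rw [Sym2.mk_isDiag_iff] at hd
  rw [Sym2.map_mk, Sym2.mk_isDiag_iff, hd])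

theorem mem_pair (h : PairOff A e B) (x : A) : x ∈ h.pair ↔ x.1 ∈ e := by
  conv_rhs => rw [← h.pair_map]
  rw [Sym2.mem_map]
  exact ⟨fun hx => ⟨x, hx, rfl⟩, fun ⟨y, hy, hyx⟩ => Subtype.ext hyx ▸ hy⟩

/-- The complement of `e` in `A` is `B`. -/
def complEquiv (h : PairOff A e B) : {x : A // x ∉ h.pair} ≃ B where
  toFun x := ⟨x.1.1, (h.compl _).2 ⟨x.1.2, fun hx => x.2 ((h.mem_pair _).2 hx)⟩⟩
  invFun x := ⟨⟨x.1, ((h.compl _).1 x.2).1⟩, fun hx => ((h.compl _).1 x.2).2 ((h.mem_pair _).1 hx)⟩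
  left_inv _ := rfl
  right_inv _ := rfl

end PairOff

/-- The order-preserving bijection between the complement of a two-element subset of
`{0, …, n + 1}` and `{0, …, n - 1}`. -/
def complFin {n : ℕ} (e : Sym2 (Fin (n + 2))) (he : ¬ e.IsDiag) : {x // x ∉ e} ≃ Fin n :=
  (Equiv.subtypeEquivRight (q := fun x => x ∈ Finset.univ \ e.toFinset) fun x => by
    rw [Finset.mem_sdiff, Sym2.mem_toFinset]
    exact ⟨fun h => ⟨Finset.mem_univ _, h⟩, And.right⟩).trans
    ((Finset.univ \ e.toFinset).orderIsoOfFin (k := n) (by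
      rw [Finset.card_sdiff_of_subset (Finset.subset_univ _), Sym2.card_toFinset_of_not_isDiag e he]
      simp)).symm.toEquiv

namespace SelfGluing

variable {k : Type u} [Field k] (O : SelfGluing.{u, w} k)

/-- The self-gluing `obj c A → obj (next c) (A \ {s, s'})` for finite subsets `A` of a fixed set. -/
def bullet {U : Type} {A B : Finset U} {e : Sym2 U} (h : PairOff A e B) {c : O.Idx} :
    O.obj c A →ₗ[k] O.obj (O.next c) B :=
  O.map h.complEquiv ∘ₗ O.glue h.pair h.pair_ne

/-- The direct sum of all `obj c A`, `A` running through the finite subsets of a set `U`. -/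
abbrev TotIn (U : Type) : Type _ := ⨁ p : O.Idx × Finset U, O.obj p.1 p.2

open Classical in
theorem pairOff_filter {U : Type} {A : Finset U} {e : Sym2 U}
    (he : e ∈ A.sym2.filter fun e => ¬ e.IsDiag) : PairOff A e (A.filter fun x => x ∉ e) where
  ne := (Finset.mem_filter.1 he).2
  sub := Finset.mem_sym2_iff.1 (Finset.mem_filter.1 he).1
  compl x := by simp

open Classical in
/-- The operator `Δ(a) = ∑_{{s, s'} ⊆ A} ∙_{ss'}(a)`, for `a ∈ obj c A`, where `A` is a finite subset
of `U`; the summand of `{s, s'}` lies in `obj (next c) (A \ {s, s'})`. -/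
def delta (U : Type) : O.TotIn U →ₗ[k] O.TotIn U :=
  DirectSum.toModule k _ _ fun p =>
    ∑ e ∈ (p.2.sym2.filter fun e => ¬ e.IsDiag).attach,
      DirectSum.lof k _ (fun p : O.Idx × Finset U => O.obj p.1 p.2)
        (O.next p.1, p.2.filter fun x => x ∉ e.1) ∘ₗ O.bullet (pairOff_filter e.2)

/-- The biased version: the spaces `obj c {0, …, n - 1}` with the action of the symmetric group. -/
abbrev biased : RepFamily.{u, w} k where
  P := O.Idx × ℕ
  M p := O.obj p.1 (Fin p.2)
  G p := Equiv.Perm (Fin p.2)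
  grp _ := inferInstance
  ρ _ :=
    { toFun := fun σ => O.map σ
      map_one' := LinearMap.ext fun a => O.map_refl a
      map_mul' := fun σ τ => LinearMap.ext fun a => O.map_trans τ σ a }

open Classical in
/-- The summands of the biased operator `Δ`. -/
def deltaBiasedAux (c : O.Idx) : ∀ n : ℕ, O.obj c (Fin n) →ₗ[k] O.biased.Tot
  | 0 => 0
  | 1 => 0
  | n + 2 => ∑ e : {e : Sym2 (Fin (n + 2)) // ¬ e.IsDiag},
      DirectSum.lof k _ (fun p => O.biased.M p) (O.next c, n) ∘ₗ O.map (complFin e.1 e.2) ∘ₗ O.glue e.1 e.2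

open Classical in
/-- The biased operator `Δ = ∑_{i < j} ∙_{ij}`, where the complement of `{i, j}` is renumbered by the
order-preserving bijection. -/
def deltaBiased : O.biased.Tot →ₗ[k] O.biased.Tot :=
  DirectSum.toModule k _ _ fun p => O.deltaBiasedAux p.1 p.2

open Classical in
/-- The class of `a ∈ obj c A` in the coinvariants of the symmetric groups; it does not depend on
the bijection of `A` with `{0, …, |A| - 1}` used to define it. -/
def toCoinv (U : Type) : O.TotIn U →ₗ[k] O.biased.Coinv (fun _ => ⊤) :=
  DirectSum.toModule k _ _ fun p =>
    O.biased.proj (fun _ => ⊤) ∘ₗ DirectSum.lof k _ (fun p => O.biased.M p) (p.1, p.2.card) ∘ₗ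
      O.map p.2.equivFin

/-- The cyclic groups of rotations of `{0, …, n - 1}`. -/
def cyc (p : O.biased.P) : Subgroup (O.biased.G p) :=
  (Subgroup.zpowers (finRotate p.2) : Subgroup (Equiv.Perm (Fin p.2)))

end SelfGluing

/-! ## `𝔎`-modular operads -/

/-- A `𝔎`-modular operad in graded `k`-vector spaces, where `𝔎(Γ) = Det(Edge(Γ))`, as an algebra over
the `𝔎`-twisted triple of connected genus-labelled graphs.  `obj g i S` is the component of
degree `i` of `O(g, S)`.  For each `S`-labelled connected graph `Γ` of total
genus `g` there is a composition `𝔎(Γ) ⊗ ⨂ᵥ O(gen v, Fl v) → O(g, S)` of degree zero.  The sign `ε` is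
the degree of an edge: `ε = -1` if `Det(Edge)` is put into degree `-|Edge|`, and `ε = 1` if the
elementary gluings have degree one.

No stability condition is imposed; operads indexed only by the pairs with `2g - 2 + |S| > 0` are the
ones whose other components vanish. -/
structure KModularOperad (k : Type u) [Field k] (ε : ℤˣ) where
  obj : ℕ → ℤ → (S : Type) → [Finite S] → ModuleCat.{w} k
  map : ∀ {g : ℕ} {i : ℤ} {S T : Type} [Finite S] [Finite T], (S ≃ T) → (obj g i S →ₗ[k] obj g i T)
  map_refl : ∀ {g : ℕ} {i : ℤ} {S : Type} [Finite S] (a : obj g i S), map (Equiv.refl S) a = a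
  map_trans : ∀ {g : ℕ} {i : ℤ} {S T U : Type} [Finite S] [Finite T] [Finite U]
    (φ : S ≃ T) (ψ : T ≃ U) (a : obj g i S), map (φ.trans ψ) a = map ψ (map φ a)
  /-- The composition along a labelled graph, for an element of `𝔎(Γ)`. -/
  comp : ∀ (Γ : FGraph) (_ : Γ.Connected) (gen : Γ.V → ℕ) (deg : Γ.V → ℤ) {S : Type} [Finite S]
    (_ : Γ.Tail ≃ S) {g : ℕ} (_ : Γ.HasGenus gen g)
    {i : ℤ} (_ : ∑ v, deg v + (ε : ℤ) * Nat.card Γ.Edge = i),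
    Γ.Det k →ₗ[k] MultilinearMap k (fun v => obj (gen v) (deg v) (Γ.Fl v)) (obj g i S)
  /-- Equivariance with respect to bijections of the labels. -/
  comp_map : ∀ (Γ : FGraph) (hΓ : Γ.Connected) (gen : Γ.V → ℕ) (deg : Γ.V → ℤ) {S T : Type}
    [Finite S] [Finite T] (lab : Γ.Tail ≃ S) (φ : S ≃ T) {g : ℕ} (hg : Γ.HasGenus gen g)
    {i : ℤ} (hi : ∑ v, deg v + (ε : ℤ) * Nat.card Γ.Edge = i) (ω : Γ.Det k)
    (x : ∀ v, obj (gen v) (deg v) (Γ.Fl v)),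
    comp Γ hΓ gen deg (lab.trans φ) hg hi ω x = map φ (comp Γ hΓ gen deg lab hg hi ω x)
  /-- Equivariance with respect to isomorphisms of labelled graphs. -/
  comp_iso : ∀ {Γ Γ' : FGraph} (φ : FGraph.Iso Γ Γ') (hΓ : Γ.Connected) (hΓ' : Γ'.Connected)
    (gen : Γ'.V → ℕ) (deg : Γ'.V → ℤ) {S : Type} [Finite S] (lab : Γ.Tail ≃ S) (lab' : Γ'.Tail ≃ S)
    (_ : ∀ t t', t'.1 = φ.flag t.1 → lab' t' = lab t)
    {g : ℕ} (hg : Γ.HasGenus (fun v => gen (φ.v v)) g) (hg' : Γ'.HasGenus gen g)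
    {i : ℤ} (hi : ∑ v, deg (φ.v v) + (ε : ℤ) * Nat.card Γ.Edge = i)
    (hi' : ∑ v, deg v + (ε : ℤ) * Nat.card Γ'.Edge = i)
    (ω : Γ.Det k) (ω' : Γ'.Det k)
    (_ : ω'.1 = ExteriorAlgebra.map (Finsupp.lmapDomain k k φ.edge) ω.1)
    (x : ∀ v, obj (gen (φ.v v)) (deg (φ.v v)) (Γ.Fl v)) (x' : ∀ v, obj (gen v) (deg v) (Γ'.Fl v))
    (_ : ∀ v, x' (φ.v v) = map (φ.fl v) (x v)),
    comp Γ' hΓ' gen deg lab' hg' hi' ω' x' = (φ.koszul fun v => deg (φ.v v)).negOnePow •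
      comp Γ hΓ (fun v => gen (φ.v v)) (fun v => deg (φ.v v)) lab hg hi ω x
  /-- The unit of the triple acts as the identity. -/
  comp_corolla : ∀ {g : ℕ} {i : ℤ} (S : Type) [Finite S]
    (hi : ∑ _v : (FGraph.corolla S).V, i + (ε : ℤ) * Nat.card (FGraph.corolla S).Edge = i)
    (a : obj g i S),
    comp (FGraph.corolla S) (FGraph.corolla_connected S) (fun _ => g) (fun _ => i)
      (FGraph.corollaTail S) (FGraph.corolla_hasGenus S g) hi (FGraph.corollaDet k S) (fun _ => a) = a
  /-- Compatibility with the insertion of graphs into the vertices of a graph. -/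
  comp_subst : ∀ (Γ₀ : FGraph) (Γ : Γ₀.V → FGraph) (lab : ∀ v, (Γ v).Tail ≃ Γ₀.Fl v)
    (h₀ : Γ₀.Connected) (h : ∀ v, (Γ v).Connected) (h₁ : (FGraph.subst Γ₀ Γ lab).Connected)
    (gen : (FGraph.subst Γ₀ Γ lab).V → ℕ) (deg : (FGraph.subst Γ₀ Γ lab).V → ℤ)
    (gen₀ : Γ₀.V → ℕ) (deg₀ : Γ₀.V → ℤ)
    (hgen : ∀ v, (Γ v).HasGenus (fun w => gen ⟨v, w⟩) (gen₀ v))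
    (hdeg : ∀ v, ∑ w, deg ⟨v, w⟩ + (ε : ℤ) * Nat.card (Γ v).Edge = deg₀ v)
    {S : Type} [Finite S] (lab₀ : Γ₀.Tail ≃ S) (lab₁ : (FGraph.subst Γ₀ Γ lab).Tail ≃ S)
    (_ : ∀ t₀ t₁, t₁.1 = FGraph.outerFlag Γ₀ Γ lab t₀.1 → lab₁ t₁ = lab₀ t₀)
    {g : ℕ} (hg₀ : Γ₀.HasGenus gen₀ g) (hg₁ : (FGraph.subst Γ₀ Γ lab).HasGenus gen g)
    {i : ℤ} (hi₀ : ∑ v, deg₀ v + (ε : ℤ) * Nat.card Γ₀.Edge = i)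
    (hi₁ : ∑ p, deg p + (ε : ℤ) * Nat.card (FGraph.subst Γ₀ Γ lab).Edge = i)
    (ω₀ : Γ₀.Det k) (ω : ∀ v, (Γ v).Det k) (ω₁ : (FGraph.subst Γ₀ Γ lab).Det k)
    (_ : ω₁.1 = FGraph.wedge Γ₀ Γ lab k ω₀ ω)
    (x : ∀ p, obj (gen p) (deg p) ((FGraph.subst Γ₀ Γ lab).Fl p)),
    comp Γ₀ h₀ gen₀ deg₀ lab₀ hg₀ hi₀ ω₀ (fun v =>
        comp (Γ v) (h v) (fun w => gen ⟨v, w⟩) (fun w => deg ⟨v, w⟩) (lab v) (hgen v) (hdeg v) (ω v)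
          (fun w => x ⟨v, w⟩)) =
      (FGraph.substKoszul Γ₀ Γ lab deg).negOnePow •
        comp (FGraph.subst Γ₀ Γ lab) h₁ gen deg lab₁ hg₁ hi₁ ω₁ x

namespace KModularOperad

variable {k : Type u} [Field k] {ε : ℤˣ} (O : KModularOperad.{u, w} k ε)

theorem loop_degree {S : Type} [Finite S] (e : Sym2 S) (he : ¬ e.IsDiag) (i : ℤ) (ε : ℤˣ) :
    ∑ _v : (FGraph.loop e).V, i + (ε : ℤ) * Nat.card (FGraph.loop e).Edge = i + ε := by
  rw [FGraph.card_edge_loop e he]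
  simp

/-- The odd self-gluings `∙_{ss'} : O(g, S) → O(g + 1, S \ {s, s'})`: the compositions along the
one-vertex graphs with one loop, for the generator of `𝔎(Γ)` given by the edge. -/
def selfGluing : SelfGluing.{u, w} k where
  Idx := ℕ × ℤ
  next c := (c.1 + 1, c.2 + ε)
  obj c S := O.obj c.1 c.2 S
  map := O.map
  map_refl := O.map_refl
  map_trans := O.map_trans
  glue {c _ _} e he := (MultilinearMap.ofSubsingleton k _ _ ()).symm
    (O.comp (FGraph.loop e) (FGraph.loop_connected e) (fun _ => c.1) (fun _ => c.2)
      (FGraph.loopTail e he) (FGraph.loop_hasGenus e he c.1) (loop_degree e he c.2 ε)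
      (FGraph.loopDet e he k))

end KModularOperad

/-! ## `𝔎`-twisted wheeled PROPs and properads -/

/-- A finite directed graph: the flags at a vertex are divided into incoming ones `In v` and outgoing
ones `Out v`, and an edge joins an outgoing flag to an incoming one.  Wheels (directed cycles) are
allowed. -/
structure DGraph where
  V : Type
  finV : Fintype V
  ordV : LinearOrder V
  In : V → Type
  Out : V → Type
  finIn : ∀ v, Finite (In v)
  finOut : ∀ v, Finite (Out v)
  inv : (Σ v, In v ⊕ Out v) → (Σ v, In v ⊕ Out v)
  inv_inv : ∀ f, inv (inv f) = f
  directed : ∀ f, inv f ≠ f → (inv f).2.isLeft ≠ f.2.isLeft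

attribute [instance] DGraph.finV DGraph.ordV DGraph.finIn DGraph.finOut

namespace DGraph

/-- The underlying graph. -/
abbrev toFGraph (Γ : DGraph) : FGraph where
  V := Γ.V
  finV := Γ.finV
  ordV := Γ.ordV
  Fl v := Γ.In v ⊕ Γ.Out v
  finFl _ := inferInstance
  inv := Γ.inv
  inv_inv := Γ.inv_inv

/-- The incoming tails. -/
abbrev TailIn (Γ : DGraph) : Type :=
  {p : Σ v, Γ.In v // Γ.inv ⟨p.1, Sum.inl p.2⟩ = ⟨p.1, Sum.inl p.2⟩}

/-- The outgoing tails. -/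
abbrev TailOut (Γ : DGraph) : Type :=
  {p : Σ v, Γ.Out v // Γ.inv ⟨p.1, Sum.inr p.2⟩ = ⟨p.1, Sum.inr p.2⟩}

/-- A tail is either incoming or outgoing. -/
def tailSplit (Γ : DGraph) : Γ.toFGraph.Tail ≃ Γ.TailIn ⊕ Γ.TailOut where
  toFun
    | ⟨⟨v, Sum.inl x⟩, h⟩ => Sum.inl ⟨⟨v, x⟩, h⟩
    | ⟨⟨v, Sum.inr x⟩, h⟩ => Sum.inr ⟨⟨v, x⟩, h⟩
  invFun
    | Sum.inl t => ⟨⟨t.1.1, Sum.inl t.1.2⟩, t.2⟩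
    | Sum.inr t => ⟨⟨t.1.1, Sum.inr t.1.2⟩, t.2⟩
  left_inv := by rintro ⟨⟨v, x | x⟩, h⟩ <;> rfl
  right_inv := by rintro (⟨⟨v, x⟩, h⟩ | ⟨⟨v, x⟩, h⟩) <;> rfl

/-- Isomorphisms of directed graphs. -/
structure Iso (Γ Γ' : DGraph) where
  v : Γ.V ≃ Γ'.V
  flIn : ∀ w, Γ.In w ≃ Γ'.In (v w)
  flOut : ∀ w, Γ.Out w ≃ Γ'.Out (v w)
  comm : ∀ f : Γ.toFGraph.Flag,
    (⟨v (Γ.inv f).1, (flIn _).sumCongr (flOut _) (Γ.inv f).2⟩ : Γ'.toFGraph.Flag) =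
      Γ'.inv ⟨v f.1, (flIn _).sumCongr (flOut _) f.2⟩

/-- The underlying isomorphism of graphs. -/
def Iso.toFGraph {Γ Γ' : DGraph} (φ : Iso Γ Γ') : FGraph.Iso Γ.toFGraph Γ'.toFGraph where
  v := φ.v
  fl w := (φ.flIn w).sumCongr (φ.flOut w)
  comm := φ.comm

section Subst

variable (Γ₀ : DGraph) (Γ : Γ₀.V → DGraph) (labIn : ∀ v, (Γ v).TailIn ≃ Γ₀.In v)
  (labOut : ∀ v, (Γ v).TailOut ≃ Γ₀.Out v)

/-- The labelling of all tails of `Γ v` by the flags of `Γ₀` at `v`. -/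
def substLab (v : Γ₀.V) : (Γ v).toFGraph.Tail ≃ Γ₀.toFGraph.Fl v :=
  (Γ v).tailSplit.trans ((labIn v).sumCongr (labOut v))

theorem isLeft_outerFlag (f : Γ₀.toFGraph.Flag) :
    (FGraph.outerFlag Γ₀.toFGraph (fun v => (Γ v).toFGraph) (substLab Γ₀ Γ labIn labOut) f).2.isLeft =
      f.2.isLeft := by
  obtain ⟨v, x | x⟩ := f <;> rfl

/-- The directed graph obtained by inserting `Γ v` into the vertex `v` of `Γ₀`, for all `v`. -/
abbrev subst : DGraph where
  V := Σ v, (Γ v).V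
  finV := inferInstance
  ordV := Sigma.Lex.linearOrder (ι := Γ₀.V) (α := fun v => (Γ v).V)
  In p := (Γ p.1).In p.2
  Out p := (Γ p.1).Out p.2
  finIn _ := inferInstance
  finOut _ := inferInstance
  inv := FGraph.substInv Γ₀.toFGraph (fun v => (Γ v).toFGraph) (substLab Γ₀ Γ labIn labOut)
  inv_inv := (FGraph.subst Γ₀.toFGraph (fun v => (Γ v).toFGraph) (substLab Γ₀ Γ labIn labOut)).inv_inv
  directed f := by
    rcases FGraph.flag_cases Γ₀.toFGraph (fun v => (Γ v).toFGraph) (substLab Γ₀ Γ labIn labOut) f with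
      ⟨f₀, rfl⟩ | ⟨v, f', h, rfl⟩
    · rw [FGraph.substInv_outer]
      intro hne
      have := Γ₀.directed f₀ fun h => hne (congrArg _ h)
      rwa [isLeft_outerFlag, isLeft_outerFlag]
    · rw [FGraph.substInv_inner _ _ _ _ _ h]
      intro _
      exact (Γ v).directed f' h

end Subst

/-- The one-vertex directed graph with incoming flags `S`, outgoing flags `T`, and no edges. -/
abbrev corolla (S T : Type) [Finite S] [Finite T] : DGraph where
  V := Unit
  finV := inferInstance
  ordV := inferInstance
  In _ := S
  Out _ := T
  finIn _ := inferInstance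
  finOut _ := inferInstance
  inv f := f
  inv_inv _ := rfl
  directed _ h := absurd rfl h

/-- The incoming tails of the corolla. -/
def corollaTailIn (S T : Type) [Finite S] [Finite T] : (corolla S T).TailIn ≃ S where
  toFun f := f.1.2
  invFun s := ⟨⟨(), s⟩, rfl⟩
  left_inv _ := rfl
  right_inv _ := rfl

/-- The outgoing tails of the corolla. -/
def corollaTailOut (S T : Type) [Finite S] [Finite T] : (corolla S T).TailOut ≃ T where
  toFun f := f.1.2
  invFun s := ⟨⟨(), s⟩, rfl⟩
  left_inv _ := rfl
  right_inv _ := rfl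

open Classical in
/-- The one-vertex directed graph with incoming flags `S`, outgoing flags `T`, and one edge, which
joins `t ∈ T` to `s ∈ S`. -/
abbrev loop {S T : Type} [Finite S] [Finite T] (s : S) (t : T) : DGraph where
  V := Unit
  finV := inferInstance
  ordV := inferInstance
  In _ := S
  Out _ := T
  finIn _ := inferInstance
  finOut _ := inferInstance
  inv := (FGraph.loop (s(Sum.inl s, Sum.inr t) : Sym2 (S ⊕ T))).inv
  inv_inv := (FGraph.loop (s(Sum.inl s, Sum.inr t) : Sym2 (S ⊕ T))).inv_inv
  directed f hf := by
    obtain ⟨⟨⟩, x⟩ := f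
    have hx : x ∈ s(Sum.inl s, Sum.inr t) := by
      by_contra hx
      exact hf (by simp [FGraph.flip_of_not_mem hx])
    rw [Sym2.mem_iff] at hx
    rcases hx with rfl | rfl
    · simp [FGraph.flip_mk]
    · rw [Sym2.eq_swap]
      simp [FGraph.flip_mk]

theorem loop_pair_ne {S T : Type} (s : S) (t : T) :
    ¬ (s(Sum.inl s, Sum.inr t) : Sym2 (S ⊕ T)).IsDiag := by simp

/-- The incoming tails of the loop graph. -/
def loopTailIn {S T : Type} [Finite S] [Finite T] (s : S) (t : T) :
    (loop s t).TailIn ≃ {x : S // x ≠ s} where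
  toFun f := ⟨f.1.2, fun h => by
    have h1 := (FGraph.loopTail _ (loop_pair_ne s t) ⟨⟨(), Sum.inl f.1.2⟩, f.2⟩).2
    exact h1 (by simp [FGraph.loopTail, h])⟩
  invFun x := ⟨⟨(), x.1⟩, by
    have h : Sum.inl x.1 ∉ (s(Sum.inl s, Sum.inr t) : Sym2 (S ⊕ T)) := by simp [x.2]
    simp [FGraph.flip_of_not_mem h]⟩
  left_inv _ := rfl
  right_inv _ := rfl

/-- The outgoing tails of the loop graph. -/
def loopTailOut {S T : Type} [Finite S] [Finite T] (s : S) (t : T) :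
    (loop s t).TailOut ≃ {y : T // y ≠ t} where
  toFun f := ⟨f.1.2, fun h => by
    have h1 := (FGraph.loopTail _ (loop_pair_ne s t) ⟨⟨(), Sum.inr f.1.2⟩, f.2⟩).2
    exact h1 (by simp [FGraph.loopTail, h])⟩
  invFun x := ⟨⟨(), x.1⟩, by
    have h : Sum.inr x.1 ∉ (s(Sum.inl s, Sum.inr t) : Sym2 (S ⊕ T)) := by simp [x.2]
    simp [FGraph.flip_of_not_mem h]⟩
  left_inv _ := rfl
  right_inv _ := rfl

end DGraph

/-- The two kinds of wheeled structures: properads (connected graphs) and PROPs (graphs which need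
not be connected). -/
inductive WheeledKind
  | properad
  | prop

/-- The graphs along which one composes.  (The empty graph is not used: no unit for the horizontal
composition is required.) -/
def WheeledKind.Allows : WheeledKind → DGraph → Prop
  | .properad, Γ => Γ.toFGraph.Connected
  | .prop, Γ => Nonempty Γ.V

theorem WheeledKind.allows_of_connected (κ : WheeledKind) {Γ : DGraph} (h : Γ.toFGraph.Connected) :
    κ.Allows Γ := by
  cases κ
  · exact h
  · exact h.1

/-- A `𝔎`-twisted wheeled properad or PROP in graded `k`-vector spaces, as an algebra over the
`𝔎`-twisted triple of (connected, or all) directed graphs with wheels.  `obj i S T` is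
the component of degree `i` of `O(S, T)`, with inputs `S` and outputs `T`; `ε` is the degree of an
edge. -/
structure KWheeled (k : Type u) [Field k] (ε : ℤˣ) (κ : WheeledKind) where
  obj : ℤ → (S T : Type) → [Finite S] → [Finite T] → ModuleCat.{w} k
  map : ∀ {i : ℤ} {S T S' T' : Type} [Finite S] [Finite T] [Finite S'] [Finite T'],
    (S ≃ S') → (T ≃ T') → (obj i S T →ₗ[k] obj i S' T')
  map_refl : ∀ {i : ℤ} {S T : Type} [Finite S] [Finite T] (a : obj i S T),
    map (Equiv.refl S) (Equiv.refl T) a = a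
  map_trans : ∀ {i : ℤ} {S T S' T' S'' T'' : Type} [Finite S] [Finite T] [Finite S'] [Finite T']
    [Finite S''] [Finite T''] (φ : S ≃ S') (χ : T ≃ T') (φ' : S' ≃ S'') (χ' : T' ≃ T'')
    (a : obj i S T), map (φ.trans φ') (χ.trans χ') a = map φ' χ' (map φ χ a)
  /-- The composition along a labelled graph, for an element of `𝔎(Γ)`. -/
  comp : ∀ (Γ : DGraph) (_ : κ.Allows Γ) (deg : Γ.V → ℤ) {S T : Type} [Finite S] [Finite T]
    (_ : Γ.TailIn ≃ S) (_ : Γ.TailOut ≃ T)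
    {i : ℤ} (_ : ∑ v, deg v + (ε : ℤ) * Nat.card Γ.toFGraph.Edge = i),
    Γ.toFGraph.Det k →ₗ[k] MultilinearMap k (fun v => obj (deg v) (Γ.In v) (Γ.Out v)) (obj i S T)
  /-- Equivariance with respect to bijections of the labels. -/
  comp_map : ∀ (Γ : DGraph) (hΓ : κ.Allows Γ) (deg : Γ.V → ℤ) {S T S' T' : Type}
    [Finite S] [Finite T] [Finite S'] [Finite T'] (labIn : Γ.TailIn ≃ S) (labOut : Γ.TailOut ≃ T)
    (φ : S ≃ S') (χ : T ≃ T') {i : ℤ} (hi : ∑ v, deg v + (ε : ℤ) * Nat.card Γ.toFGraph.Edge = i)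
    (ω : Γ.toFGraph.Det k) (x : ∀ v, obj (deg v) (Γ.In v) (Γ.Out v)),
    comp Γ hΓ deg (labIn.trans φ) (labOut.trans χ) hi ω x =
      map φ χ (comp Γ hΓ deg labIn labOut hi ω x)
  /-- Equivariance with respect to isomorphisms of labelled graphs. -/
  comp_iso : ∀ {Γ Γ' : DGraph} (φ : DGraph.Iso Γ Γ') (hΓ : κ.Allows Γ) (hΓ' : κ.Allows Γ')
    (deg : Γ'.V → ℤ) {S T : Type} [Finite S] [Finite T] (labIn : Γ.TailIn ≃ S)
    (labOut : Γ.TailOut ≃ T) (labIn' : Γ'.TailIn ≃ S) (labOut' : Γ'.TailOut ≃ T)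
    (_ : ∀ t t', t'.1 = ⟨φ.v t.1.1, φ.flIn _ t.1.2⟩ → labIn' t' = labIn t)
    (_ : ∀ t t', t'.1 = ⟨φ.v t.1.1, φ.flOut _ t.1.2⟩ → labOut' t' = labOut t)
    {i : ℤ} (hi : ∑ v, deg (φ.v v) + (ε : ℤ) * Nat.card Γ.toFGraph.Edge = i)
    (hi' : ∑ v, deg v + (ε : ℤ) * Nat.card Γ'.toFGraph.Edge = i)
    (ω : Γ.toFGraph.Det k) (ω' : Γ'.toFGraph.Det k)
    (_ : ω'.1 = ExteriorAlgebra.map (Finsupp.lmapDomain k k φ.toFGraph.edge) ω.1)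
    (x : ∀ v, obj (deg (φ.v v)) (Γ.In v) (Γ.Out v)) (x' : ∀ v, obj (deg v) (Γ'.In v) (Γ'.Out v))
    (_ : ∀ v, x' (φ.v v) = map (φ.flIn v) (φ.flOut v) (x v)),
    comp Γ' hΓ' deg labIn' labOut' hi' ω' x' = (φ.toFGraph.koszul fun v => deg (φ.v v)).negOnePow •
      comp Γ hΓ (fun v => deg (φ.v v)) labIn labOut hi ω x
  /-- The unit of the triple acts as the identity. -/
  comp_corolla : ∀ {i : ℤ} (S T : Type) [Finite S] [Finite T] (h : κ.Allows (DGraph.corolla S T))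
    (hi : ∑ _v : (DGraph.corolla S T).V, i +
      (ε : ℤ) * Nat.card (DGraph.corolla S T).toFGraph.Edge = i)
    (ω : (DGraph.corolla S T).toFGraph.Det k) (_ : ω.1 = 1) (a : obj i S T),
    comp (DGraph.corolla S T) h (fun _ => i) (DGraph.corollaTailIn S T) (DGraph.corollaTailOut S T)
      hi ω (fun _ => a) = a
  /-- Compatibility with the insertion of graphs into the vertices of a graph. -/
  comp_subst : ∀ (Γ₀ : DGraph) (Γ : Γ₀.V → DGraph) (labIn : ∀ v, (Γ v).TailIn ≃ Γ₀.In v)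
    (labOut : ∀ v, (Γ v).TailOut ≃ Γ₀.Out v) (h₀ : κ.Allows Γ₀) (h : ∀ v, κ.Allows (Γ v))
    (h₁ : κ.Allows (DGraph.subst Γ₀ Γ labIn labOut))
    (deg : (DGraph.subst Γ₀ Γ labIn labOut).V → ℤ) (deg₀ : Γ₀.V → ℤ)
    (hdeg : ∀ v, ∑ w, deg ⟨v, w⟩ + (ε : ℤ) * Nat.card (Γ v).toFGraph.Edge = deg₀ v)
    {S T : Type} [Finite S] [Finite T] (labIn₀ : Γ₀.TailIn ≃ S) (labOut₀ : Γ₀.TailOut ≃ T)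
    (labIn₁ : (DGraph.subst Γ₀ Γ labIn labOut).TailIn ≃ S)
    (labOut₁ : (DGraph.subst Γ₀ Γ labIn labOut).TailOut ≃ T)
    (_ : ∀ t₀ t₁, (⟨t₁.1.1, Sum.inl t₁.1.2⟩ : (DGraph.subst Γ₀ Γ labIn labOut).toFGraph.Flag) =
      FGraph.outerFlag Γ₀.toFGraph (fun v => (Γ v).toFGraph) (DGraph.substLab Γ₀ Γ labIn labOut)
        ⟨t₀.1.1, Sum.inl t₀.1.2⟩ → labIn₁ t₁ = labIn₀ t₀)
    (_ : ∀ t₀ t₁, (⟨t₁.1.1, Sum.inr t₁.1.2⟩ : (DGraph.subst Γ₀ Γ labIn labOut).toFGraph.Flag) =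
      FGraph.outerFlag Γ₀.toFGraph (fun v => (Γ v).toFGraph) (DGraph.substLab Γ₀ Γ labIn labOut)
        ⟨t₀.1.1, Sum.inr t₀.1.2⟩ → labOut₁ t₁ = labOut₀ t₀)
    {i : ℤ} (hi₀ : ∑ v, deg₀ v + (ε : ℤ) * Nat.card Γ₀.toFGraph.Edge = i)
    (hi₁ : ∑ p, deg p + (ε : ℤ) * Nat.card (DGraph.subst Γ₀ Γ labIn labOut).toFGraph.Edge = i)
    (ω₀ : Γ₀.toFGraph.Det k) (ω : ∀ v, (Γ v).toFGraph.Det k)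
    (ω₁ : (DGraph.subst Γ₀ Γ labIn labOut).toFGraph.Det k)
    (_ : ω₁.1 = FGraph.wedge Γ₀.toFGraph (fun v => (Γ v).toFGraph)
      (DGraph.substLab Γ₀ Γ labIn labOut) k ω₀ ω)
    (x : ∀ p, obj (deg p) ((DGraph.subst Γ₀ Γ labIn labOut).In p)
      ((DGraph.subst Γ₀ Γ labIn labOut).Out p)),
    comp Γ₀ h₀ deg₀ labIn₀ labOut₀ hi₀ ω₀ (fun v =>
        comp (Γ v) (h v) (fun w => deg ⟨v, w⟩) (labIn v) (labOut v) (hdeg v) (ω v)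
          (fun w => x ⟨v, w⟩)) =
      (FGraph.substKoszul Γ₀.toFGraph (fun v => (Γ v).toFGraph)
        (DGraph.substLab Γ₀ Γ labIn labOut) deg).negOnePow •
        comp (DGraph.subst Γ₀ Γ labIn labOut) h₁ deg labIn₁ labOut₁ hi₁ ω₁ x

/-- `s ∈ A` and `B = A \ {s}`. -/
structure PointOff {U : Type} (A : Finset U) (s : U) (B : Finset U) : Prop where
  mem : s ∈ A
  compl : ∀ x, x ∈ B ↔ x ∈ A ∧ x ≠ s

/-- The complement of `s` in `A` is `B`. -/
def PointOff.complEquiv {U : Type} {A B : Finset U} {s : U} (h : PointOff A s B) :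
    {x : A // x ≠ ⟨s, h.mem⟩} ≃ B where
  toFun x := ⟨x.1.1, (h.compl _).2 ⟨x.1.2, fun hx => x.2 (Subtype.ext hx)⟩⟩
  invFun x := ⟨⟨x.1, ((h.compl _).1 x.2).1⟩, fun hx => ((h.compl _).1 x.2).2 (congrArg Subtype.val hx)⟩
  left_inv _ := rfl
  right_inv _ := rfl

open Classical in
theorem pointOff_erase {U : Type} {A : Finset U} {s : U} (h : s ∈ A) : PointOff A s (A.erase s) where
  mem := h
  compl x := by simp [and_comm]

namespace KWheeled

variable {k : Type u} [Field k] {ε : ℤˣ} {κ : WheeledKind} (O : KWheeled.{u, w} k ε κ)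

theorem loop_degree {S T : Type} [Finite S] [Finite T] (s : S) (t : T) (i : ℤ) (ε : ℤˣ) :
    ∑ _v : (DGraph.loop s t).V, i + (ε : ℤ) * Nat.card (DGraph.loop s t).toFGraph.Edge = i + ε :=
  KModularOperad.loop_degree _ (DGraph.loop_pair_ne s t) i ε

/-- The odd self-gluings `∙_{st} : O(S, T) → O(S \ {s}, T \ {t})`: the compositions along the
one-vertex graphs with one edge, for the generator of `𝔎(Γ)` given by the edge. -/
def glue {i : ℤ} {S T : Type} [Finite S] [Finite T] (s : S) (t : T) :
    O.obj i S T →ₗ[k] O.obj (i + ε) {x : S // x ≠ s} {y : T // y ≠ t} :=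
  (MultilinearMap.ofSubsingleton k _ _ ()).symm
    (O.comp (DGraph.loop s t) (κ.allows_of_connected
        (FGraph.loop_connected (s(Sum.inl s, Sum.inr t) : Sym2 (S ⊕ T)))) (fun _ => i)
      (DGraph.loopTailIn s t) (DGraph.loopTailOut s t) (loop_degree s t i ε)
      (FGraph.loopDet _ (DGraph.loop_pair_ne s t) k))

/-- The self-gluing `O(A, B) → O(A \ {s}, B \ {t})` for finite subsets of fixed sets. -/
def bullet {U W : Type} {A A' : Finset U} {B B' : Finset W} {s : U} {t : W} (h : PointOff A s A')
    (h' : PointOff B t B') {i : ℤ} : O.obj i A B →ₗ[k] O.obj (i + ε) A' B' :=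
  O.map h.complEquiv h'.complEquiv ∘ₗ O.glue (⟨s, h.mem⟩ : A) (⟨t, h'.mem⟩ : B)

/-- The direct sum of all `O(A, B)` for finite subsets `A` of `U` and `B` of `W`. -/
abbrev TotIn (U W : Type) : Type _ := ⨁ p : ℤ × Finset U × Finset W, O.obj p.1 p.2.1 p.2.2

open Classical in
/-- The operator `Δ(a) = ∑_{s ∈ A, t ∈ B} ∙_{st}(a)` for `a ∈ O(A, B)`. -/
def delta (U W : Type) : O.TotIn U W →ₗ[k] O.TotIn U W :=
  DirectSum.toModule k _ _ fun p =>
    ∑ s ∈ p.2.1.attach, ∑ t ∈ p.2.2.attach,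
      DirectSum.lof k _ (fun p : ℤ × Finset U × Finset W => O.obj p.1 p.2.1 p.2.2)
        (p.1 + ε, p.2.1.erase s.1, p.2.2.erase t.1) ∘ₗ
          O.bullet (pointOff_erase s.2) (pointOff_erase t.2)

/-- The biased version: the spaces `O(n, m)` with the action of the product of the
symmetric groups. -/
abbrev biased : RepFamily.{u, w} k where
  P := ℤ × ℕ × ℕ
  M p := O.obj p.1 (Fin p.2.1) (Fin p.2.2)
  G p := Equiv.Perm (Fin p.2.1) × Equiv.Perm (Fin p.2.2)
  grp _ := inferInstance
  ρ _ :=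
    { toFun := fun σ => O.map σ.1 σ.2
      map_one' := LinearMap.ext fun a => O.map_refl a
      map_mul' := fun σ τ => LinearMap.ext fun a => O.map_trans τ.1 τ.2 σ.1 σ.2 a }

/-- The summands of the biased operator `Δ`. -/
def deltaBiasedAux (i : ℤ) : ∀ n m : ℕ, O.obj i (Fin n) (Fin m) →ₗ[k] O.biased.Tot
  | 0, _ => 0
  | _ + 1, 0 => 0
  | n + 1, m + 1 => ∑ s : Fin (n + 1), ∑ t : Fin (m + 1),
      DirectSum.lof k (ℤ × ℕ × ℕ) (fun p => O.biased.M p) (i + ε, n, m) ∘ₗ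
        O.map (finSuccAboveEquiv s).symm (finSuccAboveEquiv t).symm ∘ₗ O.glue s t

/-- The biased operator `Δ = ∑_{i, j} ∙_{ij}`, where the complements of `i` and `j` are renumbered by
the order-preserving bijections. -/
def deltaBiased : O.biased.Tot →ₗ[k] O.biased.Tot :=
  DirectSum.toModule k (ℤ × ℕ × ℕ) _ fun p => O.deltaBiasedAux p.1 p.2.1 p.2.2

open Classical in
/-- The class of `a ∈ O(A, B)` in the coinvariants of the symmetric groups. -/
def toCoinv (U W : Type) : O.TotIn U W →ₗ[k] O.biased.Coinv (fun _ => ⊤) :=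
  DirectSum.toModule k _ _ fun p =>
    O.biased.proj (fun _ => ⊤) ∘ₗ
      DirectSum.lof k (ℤ × ℕ × ℕ) (fun p => O.biased.M p) (p.1, p.2.1.card, p.2.2.card) ∘ₗ
      O.map p.2.1.equivFin p.2.2.equivFin

/-- The products of the cyclic groups of rotations of the inputs and of the outputs. -/
def cyc (p : O.biased.P) : Subgroup (O.biased.G p) :=
  ((Subgroup.zpowers (finRotate p.2.1)).prod (Subgroup.zpowers (finRotate p.2.2)) :
    Subgroup (Equiv.Perm (Fin p.2.1) × Equiv.Perm (Fin p.2.2)))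

end KWheeled

/-! ## Extended modular operads in the sense of Schwarz and their singular chains -/

open Classical in
/-- A (topological) extended modular operad: spaces `X S`, functorial in the finite set `S` with
respect to bijections, with a compatible action of the torus `(ℝ/ℤ)^S` (so that the symmetric group
`𝕊ₙ` together with the torus acts through the wreath product `𝕊ₙ ≀ S¹`), with
self-gluings and horizontal compositions.  The self-gluings are balanced: rotating one of the two
glued flags has the same effect as rotating the other one. -/
structure EMO where
  X : (S : Type) → [Finite S] → TopCat.{w}
  map : ∀ {S T : Type} [Finite S] [Finite T], (S ≃ T) → C(X S, X T)
  map_refl : ∀ {S : Type} [Finite S] (x : X S), map (Equiv.refl S) x = x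
  map_trans : ∀ {S T U : Type} [Finite S] [Finite T] [Finite U] (φ : S ≃ T) (ψ : T ≃ U) (x : X S),
    map (φ.trans ψ) x = map ψ (map φ x)
  /-- The action of the torus. -/
  act : ∀ {S : Type} [Finite S], (S → UnitAddCircle) → X S → X S
  continuous_act : ∀ {S : Type} [Finite S],
    Continuous fun p : (S → UnitAddCircle) × X S => act p.1 p.2
  act_zero : ∀ {S : Type} [Finite S] (x : X S), act 0 x = x
  act_add : ∀ {S : Type} [Finite S] (θ η : S → UnitAddCircle) (x : X S),
    act (θ + η) x = act θ (act η x)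
  map_act : ∀ {S T : Type} [Finite S] [Finite T] (φ : S ≃ T) (θ : S → UnitAddCircle) (x : X S),
    map φ (act θ x) = act (θ ∘ φ.symm) (map φ x)
  /-- The self-gluings `∘_{ss'}`, for `e = {s, s'}`. -/
  glue : ∀ {S : Type} [Finite S] (e : Sym2 S), ¬ e.IsDiag → C(X S, X {x : S // x ∉ e})
  map_glue : ∀ {S T : Type} [Finite S] [Finite T] (φ : S ≃ T) (e : Sym2 S) (he : ¬ e.IsDiag)
    (he' : ¬ (e.map φ).IsDiag) (χ : {x : S // x ∉ e} ≃ {y : T // y ∉ e.map φ})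
    (_ : ∀ y, (χ y).1 = φ y.1) (x : X S), glue (e.map φ) he' (map φ x) = map χ (glue e he x)
  glue_glue : ∀ {S : Type} [Finite S] (e f : Sym2 S) (he : ¬ e.IsDiag) (hf : ¬ f.IsDiag)
    (f' : Sym2 {x : S // x ∉ e}) (e' : Sym2 {x : S // x ∉ f}) (_ : f'.map Subtype.val = f)
    (_ : e'.map Subtype.val = e) (hf' : ¬ f'.IsDiag) (he' : ¬ e'.IsDiag)
    (χ : {y : {x : S // x ∉ e} // y ∉ f'} ≃ {y : {x : S // x ∉ f} // y ∉ e'})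
    (_ : ∀ y, (χ y).1.1 = y.1.1) (x : X S),
    map χ (glue f' hf' (glue e he x)) = glue e' he' (glue f hf x)
  glue_act : ∀ {S : Type} [Finite S] (e : Sym2 S) (he : ¬ e.IsDiag) (θ : S → UnitAddCircle)
    (_ : ∀ x ∈ e, θ x = 0) (x : X S), glue e he (act θ x) = act (fun y => θ y.1) (glue e he x)
  balanced : ∀ {S : Type} [Finite S] (s s' : S) (he : ¬ s(s, s').IsDiag) (θ : UnitAddCircle) (x : X S),
    glue s(s, s') he (act (Pi.single s θ) x) = glue s(s, s') he (act (Pi.single s' θ) x)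
  /-- The horizontal compositions. -/
  hor : ∀ {S T : Type} [Finite S] [Finite T], C(X S × X T, X (S ⊕ T))
  map_hor : ∀ {S T S' T' : Type} [Finite S] [Finite T] [Finite S'] [Finite T'] (φ : S ≃ S')
    (ψ : T ≃ T') (x : X S) (y : X T), hor (map φ x, map ψ y) = map (φ.sumCongr ψ) (hor (x, y))
  hor_comm : ∀ {S T : Type} [Finite S] [Finite T] (x : X S) (y : X T),
    map (Equiv.sumComm S T) (hor (x, y)) = hor (y, x)
  hor_assoc : ∀ {S T U : Type} [Finite S] [Finite T] [Finite U] (x : X S) (y : X T) (z : X U),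
    map (Equiv.sumAssoc S T U) (hor (hor (x, y), z)) = hor (x, hor (y, z))
  hor_act : ∀ {S T : Type} [Finite S] [Finite T] (θ : S → UnitAddCircle) (η : T → UnitAddCircle)
    (x : X S) (y : X T), hor (act θ x, act η y) = act (Sum.elim θ η) (hor (x, y))
  hor_glue : ∀ {S T : Type} [Finite S] [Finite T] (e : Sym2 S) (he : ¬ e.IsDiag)
    (he' : ¬ (e.map (Sum.inl : S → S ⊕ T)).IsDiag)
    (χ : {x : S // x ∉ e} ⊕ T ≃ {z : S ⊕ T // z ∉ e.map Sum.inl})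
    (_ : ∀ x, (χ (Sum.inl x)).1 = Sum.inl x.1) (_ : ∀ y, (χ (Sum.inr y)).1 = Sum.inr y)
    (x : X S) (y : X T), glue (e.map Sum.inl) he' (hor (x, y)) = map χ (hor (glue e he x, y))

/-- Singular chains of dimension `q` with coefficients in `k`. -/
abbrev SingChain (k : Type u) [Field k] (q : ℕ) (Y : Type w) [TopologicalSpace Y] : Type (max u w) :=
  C(stdSimplex ℝ (Fin (q + 1)), Y) →₀ k

namespace SingChain

variable (k : Type u) [Field k] {q : ℕ} {Y Z : Type w} [TopologicalSpace Y] [TopologicalSpace Z]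

/-- The push-forward of singular chains. -/
def push (f : C(Y, Z)) : SingChain k q Y →ₗ[k] SingChain k q Z :=
  Finsupp.lmapDomain k k fun σ => f.comp σ

/-- The `i`-th simplex of the triangulation of the prism `Δ¹ × Δ^q`, mapped to `S¹ × Y` by the
simplex `Δ¹ → ℝ/ℤ` of the fundamental class and by `σ`. In barycentric coordinates it is
`t ↦ ([t_{i+1} + ⋯ + t_{q+1}], σ(sᵢ t))`, with `sᵢ` the `i`-th degeneracy. -/
def prism (i : Fin (q + 1)) (σ : C(stdSimplex ℝ (Fin (q + 1)), Y)) :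
    C(stdSimplex ℝ (Fin (q + 2)), UnitAddCircle × Y) where
  toFun t := (((∑ j with i.castSucc < j, t j : ℝ) : UnitAddCircle), σ (stdSimplex.map i.predAbove t))
  continuous_toFun := by
    refine Continuous.prodMk ?_ (σ.continuous.comp (stdSimplex.continuous_map _))
    refine (AddCircle.continuous_mk' (1 : ℝ)).comp ?_
    exact continuous_finsetSum _ fun j _ => (continuous_apply j).comp continuous_subtype_val

/-- The cross product `α ↦ [S¹] × α` with the fundamental class of `S¹ = ℝ/ℤ`, through the
Eilenberg–Zilber shuffle map. -/
def crossCircle : SingChain k q Y →ₗ[k] SingChain k (q + 1) (UnitAddCircle × Y) :=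
  Finsupp.linearCombination k fun σ =>
    ∑ i : Fin (q + 1), (-1 : k) ^ (i : ℕ) • Finsupp.single (prism i σ) 1

end SingChain

namespace EMO

variable (E : EMO.{w})

open Classical in
/-- The family `(θ, x) ↦ ∘_{ss'}(ρ_s(θ) x)`. -/
def twist {S : Type} [Finite S] (e : Sym2 S) (he : ¬ e.IsDiag) (s : S) :
    C(UnitAddCircle × E.X S, E.X {x : S // x ∉ e}) where
  toFun p := E.glue e he (E.act (Pi.single s p.1) p.2)
  continuous_toFun := by
    refine (E.glue e he).continuous.comp (E.continuous_act.comp (Continuous.prodMk ?_ continuous_snd))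
    exact (continuous_single s).comp continuous_fst

theorem twist_eq {S : Type} [Finite S] (e : Sym2 S) (he : ¬ e.IsDiag) (s s' : S) (hs : s ∈ e)
    (hs' : s' ∈ e) : E.twist e he s = E.twist e he s' := by
  by_cases h : s = s'
  · rw [h]
  · obtain rfl : e = s(s, s') := (Sym2.mem_and_mem_iff h).1 ⟨hs, hs'⟩
    ext p
    exact E.balanced s s' he p.1 p.2

/-- The singular chains of an extended modular operad, with the odd self-gluings
`∙_{ss'}(α) = (∘_{ss'})_* (ρ_s)_* ([S¹] × α)`; one may take either of the two flags for `s`. -/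
def chains (k : Type u) [Field k] : SelfGluing.{u, max u w} k where
  Idx := ℕ
  next q := q + 1
  obj q S _ := ModuleCat.of k (SingChain k q (E.X S))
  map φ := SingChain.push k (E.map φ)
  map_refl {q S _} a := by
    have : (fun σ : C(stdSimplex ℝ (Fin (q + 1)), E.X S) => (E.map (Equiv.refl S)).comp σ) = id := by
      funext σ; ext t; exact E.map_refl _
    change Finsupp.mapDomain _ a = a
    rw [this, Finsupp.mapDomain_id]
  map_trans {q S T U _ _ _} φ ψ a := by
    change Finsupp.mapDomain _ a = Finsupp.mapDomain _ (Finsupp.mapDomain _ a)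
    rw [← Finsupp.mapDomain_comp]
    congr 1
    funext σ; ext t; exact E.map_trans _ _ _
  glue e he := SingChain.push k (E.twist e he (Quot.out e).1) ∘ₗ SingChain.crossCircle k

end EMO

/-! ## The conclusions -/

/-- The operator `Δ` on the direct sum of a family of representations induces a differential on the
coinvariants of the whole groups, and it lifts to the coinvariants and, in characteristic zero, to
the invariants of the subgroups `C p`. -/
def RepFamily.InducesDifferential {k : Type u} [Field k] (R : RepFamily.{u, w} k)
    (Δ : R.Tot →ₗ[k] R.Tot) (C : ∀ p, Subgroup (R.G p))
    (D : R.Coinv (fun _ => ⊤) →ₗ[k] R.Coinv (fun _ => ⊤)) : Prop :=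
  D ∘ₗ D = 0 ∧ D ∘ₗ R.proj (fun _ => ⊤) = R.proj (fun _ => ⊤) ∘ₗ Δ ∧
    ∃ D' : R.Coinv C →ₗ[k] R.Coinv C,
      D' ∘ₗ D' = 0 ∧ D' ∘ₗ R.proj C = R.proj C ∘ₗ Δ ∧ R.coinvToTop C ∘ₗ D' = D ∘ₗ R.coinvToTop C ∧
        (CharZero k → Function.Bijective (R.invToCoinv C) ∧
          ∃ D'' : R.Inv C →ₗ[k] R.Inv C,
            D'' ∘ₗ D'' = 0 ∧ R.invToCoinv C ∘ₗ D'' = D' ∘ₗ R.invToCoinv C)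

/-- The statement for self-gluings along unordered pairs. -/
structure SelfGluing.HasDifferential {k : Type u} [Field k] (O : SelfGluing.{u, w} k) : Prop where
  /-- `∙_{ss'} ∙_{tt'} = - ∙_{tt'} ∙_{ss'}` for four-element subsets `{s, s', t, t'}` of `A`; here
  `B = A \ {t, t'}`, `B' = A \ {s, s'}` and `C = A \ {s, s', t, t'}`. -/
  anticomm : ∀ {U : Type} {A B B' C : Finset U} {s s' t t' : U} (h₁ : PairOff A s(t, t') B)
    (h₂ : PairOff B s(s, s') C) (h₃ : PairOff A s(s, s') B') (h₄ : PairOff B' s(t, t') C)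
    {c : O.Idx} (a : O.obj c A),
    O.bullet h₂ (O.bullet h₁ a) = - O.bullet h₄ (O.bullet h₃ a)
  delta_sq : ∀ U : Type, O.delta U ∘ₗ O.delta U = 0
  biased_sq : O.deltaBiased ∘ₗ O.deltaBiased = 0
  coinv : ∃ D, O.biased.InducesDifferential O.deltaBiased O.cyc D ∧
    ∀ U : Type, D ∘ₗ O.toCoinv U = O.toCoinv U ∘ₗ O.delta U

/-- The statement for self-gluings of an input and an output. -/
structure KWheeled.HasDifferential {k : Type u} [Field k] {ε : ℤˣ} {κ : WheeledKind}
    (O : KWheeled.{u, w} k ε κ) : Prop where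
  /-- `∙_{st} ∙_{s't'} = - ∙_{s't'} ∙_{st}` for distinct `s, s' ∈ A` and distinct `t, t' ∈ B`. -/
  anticomm : ∀ {U W : Type} {A A₁ A₂ A₃ : Finset U} {B B₁ B₂ B₃ : Finset W} {s s' : U} {t t' : W}
    (h₁ : PointOff A s' A₁) (k₁ : PointOff B t' B₁) (h₂ : PointOff A₁ s A₃) (k₂ : PointOff B₁ t B₃)
    (h₃ : PointOff A s A₂) (k₃ : PointOff B t B₂) (h₄ : PointOff A₂ s' A₃) (k₄ : PointOff B₂ t' B₃)
    {i : ℤ} (a : O.obj i A B),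
    O.bullet h₂ k₂ (O.bullet h₁ k₁ a) = - O.bullet h₄ k₄ (O.bullet h₃ k₃ a)
  delta_sq : ∀ U W : Type, O.delta U W ∘ₗ O.delta U W = 0
  biased_sq : O.deltaBiased ∘ₗ O.deltaBiased = 0
  coinv : ∃ D, O.biased.InducesDifferential O.deltaBiased O.cyc D ∧
    ∀ U W : Type, D ∘ₗ O.toCoinv U W = O.toCoinv U W ∘ₗ O.delta U W

end

/-! Everything rests on two facts: self-gluings are equivariant under bijections of the flags, and
self-gluings along disjoint pairs anticommute (`SelfGluing.IsOdd`; for wheeled structures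
`KWheeled.glue_map` and `KWheeled.map_glue_glue`).

The sign has two sources. For an algebra over a twisted triple, compatibility with insertion turns
two successive self-gluings into one composition along the graph with one vertex and two loops,
taken with the exterior product of the two edges. This graph does not remember which loop was
inserted into which (`FGraph.twoLoopsIso`), but the exterior product does, and exchanging its
factors costs a sign (`FGraph.map_twoLoopsDet`). With a single vertex there are no Koszul signs. For
chains of an extended modular operad, both double gluings are push-forwards of [S¹] × [S¹] × α,
along maps that differ by the exchange of the two circles (`EMO.twist_twist`). The exchange acts by
-1 already on chains, because it permutes the simplices of the double prism and reverses their signs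
(`SingChain.push_swapCircles`).

The rest is formal. In Δ² the summands are indexed by ordered pairs of disjoint pairs, and
exchanging the two is a fixed-point-free involution under which they cancel; this works in every
characteristic. The biased Δ is reduced to this case by `compress`, the order-preserving renumbering
of finite subsets of an ordered set: it intertwines the two operators and is surjective when the
ordered set is ℕ.

For the descent to coinvariants, the summands of Δ(σa) and Δ(a) correspond to each other and differ
only in the renumbering of the complements, that is, by some permutation. If σ is a rotation, this
permutation is again a rotation (`exists_rotation`), which gives the lift to the cyclic
coinvariants. In characteristic zero averaging identifies invariants with coinvariants, and the
differential is transported. -/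

noncomputable section

/-! ## Differentials on coinvariants and invariants -/

namespace Representation

variable {k G V : Type*} [Field k] [CharZero k] [Group G] [Finite G] [AddCommGroup V] [Module k V]

/-- In characteristic zero, the invariants of a finite group are isomorphic to its coinvariants. -/
theorem bijective_invariants_to_coinvariants (ρ : Representation k G V) :
    Function.Bijective (Coinvariants.mk ρ ∘ₗ ρ.invariants.subtype) := by
  have := Fintype.ofFinite G
  have : Invertible (Fintype.card G : k) := invertibleOfNonzero (by simp)
  have avg : ∀ v, ρ.averageMap v = ⅟(Fintype.card G : k) • ∑ g : G, ρ g v := fun v => by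
    simp [averageMap, GroupAlgebra.average]
  refine ⟨(injective_iff_map_eq_zero _).2 fun x hx => ?_, fun y => ?_⟩
  -- The average is unchanged by the action, so it factors through the coinvariants; restricted to
  -- invariants it is the identity, which gives a left inverse.
  · have h : ∀ g : G, ρ.averageMap ∘ₗ ρ g = ρ.averageMap := fun g => LinearMap.ext fun v => by
      rw [LinearMap.comp_apply, avg, avg]
      congr 1
      exact Fintype.sum_equiv (Equiv.mulRight g) _ _ fun g' => by simp
    have h' := congrArg (Coinvariants.lift ρ ρ.averageMap h) hx
    rw [LinearMap.comp_apply, Coinvariants.lift_mk, map_zero] at h'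
    exact Subtype.ext ((averageMap_id ρ x.1 x.2).symm.trans h')
  -- The average of `v` is invariant and has the class of `v`, since all the `ρ g v` do.
  · obtain ⟨v, rfl⟩ := Coinvariants.mk_surjective ρ y
    refine ⟨⟨ρ.averageMap v, ρ.averageMap_invariant v⟩, ?_⟩
    change Coinvariants.mk ρ (ρ.averageMap v) = _
    rw [avg, map_smul, map_sum]
    simp [Coinvariants.mk_self_apply, ← Nat.cast_smul_eq_nsmul k]

end Representation

namespace RepFamily

variable {k : Type u} [Field k] (R : RepFamily.{u, w} k)

theorem proj_surjective (H : ∀ p, Subgroup (R.G p)) : Function.Surjective (R.proj H) :=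
  (DirectSum.lmap_surjective _).2 fun _ => Representation.Coinvariants.mk_surjective _

theorem coinvToTop_comp_proj (H : ∀ p, Subgroup (R.G p)) :
    R.coinvToTop H ∘ₗ R.proj H = R.proj (fun _ => ⊤) := by
  rw [coinvToTop, proj, ← DirectSum.lmap_comp]
  rfl

theorem bijective_invToCoinv [CharZero k] (H : ∀ p, Subgroup (R.G p)) [∀ p, Finite (H p)] :
    Function.Bijective (R.invToCoinv H) :=
  ⟨(DirectSum.lmap_injective _).2 fun _ =>
      (Representation.bijective_invariants_to_coinvariants _).1,
    (DirectSum.lmap_surjective _).2 fun _ =>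
      (Representation.bijective_invariants_to_coinvariants _).2⟩

variable [DecidableEq R.P]

theorem proj_lof (H : ∀ p, Subgroup (R.G p)) (p : R.P) (a : R.M p) :
    R.proj H (DirectSum.lof k R.P (fun p => R.M p) p a) =
      DirectSum.lof k R.P (fun p => (R.res H p).Coinvariants) p
        (Representation.Coinvariants.mk (R.res H p) a) :=
  DirectSum.lmap_lof _ _ _

theorem proj_lof_ρ (H : ∀ p, Subgroup (R.G p)) (p : R.P) (h : R.G p) (hh : h ∈ H p) (a : R.M p) :
    R.proj H (DirectSum.lof k R.P (fun p => R.M p) p (R.ρ p h a)) =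
      R.proj H (DirectSum.lof k R.P (fun p => R.M p) p a) := by
  rw [proj_lof, proj_lof]
  congr 1
  exact Representation.Coinvariants.mk_self_apply (R.res H p) ⟨h, hh⟩ a

/-- An operator on the direct sum which is invariant modulo the action descends to the
coinvariants. -/
theorem exists_descent (Δ : R.Tot →ₗ[k] R.Tot) (H : ∀ p, Subgroup (R.G p))
    (hH : ∀ p, ∀ h ∈ H p, ∀ a : R.M p,
      R.proj H (Δ (DirectSum.lof k R.P (fun p => R.M p) p (R.ρ p h a))) =
        R.proj H (Δ (DirectSum.lof k R.P (fun p => R.M p) p a))) :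
    ∃ D : R.Coinv H →ₗ[k] R.Coinv H, D ∘ₗ R.proj H = R.proj H ∘ₗ Δ := by
  refine ⟨DirectSum.toModule k R.P _ fun p => Representation.Coinvariants.lift (R.res H p)
    (R.proj H ∘ₗ Δ ∘ₗ DirectSum.lof k R.P (fun p => R.M p) p) fun h => LinearMap.ext fun a =>
      hH p h.1 h.2 a, DirectSum.linearMap_ext _ fun p => LinearMap.ext fun a => ?_⟩
  simp only [LinearMap.comp_apply]
  rw [proj_lof, DirectSum.toModule_lof, Representation.Coinvariants.lift_mk]
  rfl

/-- The projections to coinvariants are surjective, so every identity between descended operators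
(square zero, compatibility of `D'` with `D`) can be checked on the total space. The operator on
invariants is `D'` conjugated by the isomorphism of invariants with coinvariants. -/
theorem exists_inducesDifferential (Δ : R.Tot →ₗ[k] R.Tot) (hΔ : Δ ∘ₗ Δ = 0)
    (C : ∀ p, Subgroup (R.G p)) [∀ p, Finite (C p)]
    (hT : ∀ p (h : R.G p) (a : R.M p),
      R.proj (fun _ => ⊤) (Δ (DirectSum.lof k R.P (fun p => R.M p) p (R.ρ p h a))) =
        R.proj (fun _ => ⊤) (Δ (DirectSum.lof k R.P (fun p => R.M p) p a)))
    (hC : ∀ p, ∀ h ∈ C p, ∀ a : R.M p,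
      R.proj C (Δ (DirectSum.lof k R.P (fun p => R.M p) p (R.ρ p h a))) =
        R.proj C (Δ (DirectSum.lof k R.P (fun p => R.M p) p a))) :
    ∃ D, R.InducesDifferential Δ C D := by
  obtain ⟨D, hD⟩ := R.exists_descent Δ (fun _ => ⊤) fun p h _ a => hT p h a
  obtain ⟨D', hD'⟩ := R.exists_descent Δ C hC
  have sq : ∀ (H : ∀ p, Subgroup (R.G p)) (D : R.Coinv H →ₗ[k] R.Coinv H),
      D ∘ₗ R.proj H = R.proj H ∘ₗ Δ → D ∘ₗ D = 0 := fun H D hD => by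
    rw [← LinearMap.cancel_right (R.proj_surjective H), LinearMap.comp_assoc, hD,
      ← LinearMap.comp_assoc, hD, LinearMap.comp_assoc, hΔ, LinearMap.comp_zero,
      LinearMap.zero_comp]
  refine ⟨D, sq _ D hD, hD, D', sq _ D' hD', hD', ?_, fun _ => ⟨R.bijective_invToCoinv C, ?_⟩⟩
  · rw [← LinearMap.cancel_right (R.proj_surjective C), LinearMap.comp_assoc, hD',
      ← LinearMap.comp_assoc, coinvToTop_comp_proj, LinearMap.comp_assoc, coinvToTop_comp_proj, hD]
  · let ψ := LinearEquiv.ofBijective (R.invToCoinv C) (R.bijective_invToCoinv C)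
    have hψ : ∀ x, R.invToCoinv C (ψ.symm x) = x := ψ.apply_symm_apply
    refine ⟨ψ.symm.toLinearMap ∘ₗ D' ∘ₗ R.invToCoinv C, LinearMap.ext fun x => ?_,
      LinearMap.ext fun x => hψ _⟩
    simp only [LinearMap.comp_apply, LinearEquiv.coe_coe, hψ]
    rw [show D' (D' (R.invToCoinv C x)) = 0 from LinearMap.congr_fun (sq _ D' hD') _, map_zero]
    rfl

end RepFamily

/-! ## Order-preserving and cyclic renumberings -/

/-- The elements of a group whose action does not change the values of a linear map. -/
def Representation.invariance {k G V W : Type*} [Field k] [Group G] [AddCommGroup V] [Module k V]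
    [AddCommGroup W] [Module k W] (ρ : Representation k G V) (F : V →ₗ[k] W) : Subgroup G where
  carrier := {g | ∀ a, F (ρ g a) = F a}
  one_mem' a := by simp
  mul_mem' {g h} hg hh a := by
    rw [map_mul, Module.End.mul_apply]
    exact (hg _).trans (hh a)
  inv_mem' {g} hg a := by
    rw [← hg, ← Module.End.mul_apply, ← map_mul, mul_inv_cancel, map_one, Module.End.one_apply]

open Classical in
-- An arbitrary label set `U` carries no order, while the comparison with the biased operator needs
-- one; any choice will do.
theorem nonempty_linearOrder (U : Type) : Nonempty (LinearOrder U) :=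
  ⟨linearOrderOfSTO WellOrderingRel⟩

/-- There is at most one strictly monotone bijection with `Fin n`. -/
theorem Equiv.eq_of_strictMono {S : Type} [LinearOrder S] {n : ℕ} {φ φ' : S ≃ Fin n}
    (h : StrictMono φ) (h' : StrictMono φ') : φ = φ' := by
  -- Increasing maps out of `Fin n` are determined by their range, so the inverses are compared.
  have key : ∀ {α : Type} [LinearOrder α] {ψ ψ' : Fin n ≃ α}, StrictMono ψ → StrictMono ψ' →
      ψ = ψ' := by
    intro α _ ψ ψ' h h'
    have : Set.range ψ = Set.range ψ' := by rw [ψ.surjective.range_eq, ψ'.surjective.range_eq]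
    exact Equiv.coe_fn_injective (h.range_inj h' |>.1 this)
  have inv : ∀ {ψ : S ≃ Fin n}, StrictMono ψ → StrictMono ψ.symm := fun {ψ} hψ x y hxy => by
    rw [← hψ.lt_iff_lt]
    simpa using hxy
  have := key (inv h) (inv h')
  rw [← φ.symm_symm, this, φ'.symm_symm]

/-- The rotation adds one except at the last element, which it sends to zero; this is the only place
where it breaks the order. -/
theorem finRotate_lt_finRotate {N : ℕ} {x y : Fin (N + 1)} (hxy : x < y) (hy : y ≠ Fin.last N) :
    finRotate (N + 1) x < finRotate (N + 1) y := by
  have hx : x ≠ Fin.last N := (hxy.trans_le (Fin.le_last y)).ne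
  rw [Fin.lt_def, coe_finRotate_of_ne_last hx, coe_finRotate_of_ne_last hy]
  exact Nat.succ_lt_succ hxy

/-- A rotation of `{0, …, N - 1}` induces a rotation after the order-preserving renumbering of a
subset and of its image. -/
theorem exists_rotation {N n : ℕ} {p : Fin N → Prop} {φ φ' : {x // p x} ≃ Fin n}
    (hφ : StrictMono φ) (hφ' : ∀ x y, finRotate N x.1 < finRotate N y.1 → φ' x < φ' y) :
    ∃ j ∈ Subgroup.zpowers (finRotate n), φ' = φ.trans j := by
  rcases N with _ | N
  · exact ⟨1, one_mem _, Equiv.ext fun x => x.1.elim0⟩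
  -- If the last element belongs to the subset, one rotation of `Fin n` is needed; otherwise the
  -- rotation is increasing on the subset and none is.
  by_cases hl : p (Fin.last N)
  · obtain ⟨m, rfl⟩ : ∃ m, n = m + 1 := by
      rcases n with _ | m
      · exact (φ ⟨_, hl⟩).elim0
      · exact ⟨m, rfl⟩
    -- The last element is rotated to zero, below all others, so `φ'` numbers it first.
    have h0 : φ' ⟨_, hl⟩ = 0 := by
      by_contra hne
      obtain ⟨z, hz⟩ := φ'.surjective 0
      have hzl : z.1 ≠ Fin.last N := fun h => hne (by rw [← hz]; congr 1; exact Subtype.ext h.symm)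
      have := hφ' ⟨_, hl⟩ z (by
        rw [finRotate_last, Fin.lt_def, coe_finRotate_of_ne_last hzl]
        exact Nat.succ_pos _)
      rw [hz] at this
      exact absurd this (Fin.not_lt_zero _)
    have hne : ∀ z, z.1 ≠ Fin.last N → φ' z ≠ 0 := fun z hz h =>
      hz (congrArg Subtype.val (φ'.injective (h.trans h0.symm)))
    refine ⟨finRotate (m + 1), Subgroup.mem_zpowers _, ?_⟩
    -- Rotating back moves this element to the top and lowers the other numbers by one. The result
    -- is increasing, hence equal to `φ`.
    have hψ : StrictMono (φ'.trans (finRotate (m + 1)).symm) := by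
      intro x y hxy
      have hxy' : x.1 < y.1 := hxy
      have hx : x.1 ≠ Fin.last N := (hxy'.trans_le (Fin.le_last _)).ne
      have hx0 := hne x hx
      simp only [Equiv.trans_apply]
      rw [Fin.lt_def, coe_finRotate_symm_of_ne_zero hx0]
      have hx0' : 0 < (φ' x).1 := Nat.pos_of_ne_zero fun h => hx0 (Fin.ext h)
      by_cases hy : y.1 = Fin.last N
      · have : φ' y = 0 := by rw [← h0]; congr 1; exact Subtype.ext hy
        rw [this, (Equiv.symm_apply_eq _).2 finRotate_last.symm]
        have := (φ' x).2
        simp only [Fin.val_last]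
        omega
      · rw [coe_finRotate_symm_of_ne_zero (hne y hy)]
        have := hφ' x y (finRotate_lt_finRotate hxy' hy)
        rw [Fin.lt_def] at this
        omega
    rw [← Equiv.eq_of_strictMono hψ hφ]
    ext z
    simp
  · refine ⟨1, one_mem _, Equiv.eq_of_strictMono (fun x y hxy => ?_) hφ⟩
    exact hφ' x y (finRotate_lt_finRotate hxy fun h => hl (h ▸ y.2))

theorem complFin_strictMono {n : ℕ} (e : Sym2 (Fin (n + 2))) (he : ¬ e.IsDiag) :
    StrictMono (complFin e he) := by
  intro x y hxy
  exact (OrderIso.strictMono _) hxy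

/-! ## Odd self-gluings along unordered pairs -/

/-- The operators on direct sums are defined with classical decidability of the index set;
evaluating them on a summand must not depend on the instance in use. -/
theorem DirectSum.toModule_lof_of_decidableEq {k ι N : Type*} {M : ι → Type*} [Field k]
    [∀ i, AddCommGroup (M i)] [∀ i, Module k (M i)] [AddCommGroup N] [Module k N]
    (inst inst' : DecidableEq ι) (φ : ∀ i, M i →ₗ[k] N) (i : ι) (x : M i) :
    @DirectSum.toModule k _ ι M _ _ inst N _ _ φ (@DirectSum.lof k _ ι M _ _ inst' i x) = φ i x := by
  obtain rfl := Subsingleton.elim inst inst'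
  exact DirectSum.toModule_lof _ _ _

/-- The bijection between the complements of corresponding pairs. -/
def complCongr {S T : Type} (φ : S ≃ T) {e : Sym2 S} {e' : Sym2 T} (h : e.map φ = e') :
    {x // x ∉ e} ≃ {y // y ∉ e'} :=
  φ.subtypeEquiv fun x => by
    rw [← h, Sym2.mem_map, not_iff_not]
    exact ⟨fun hx => ⟨x, hx, rfl⟩, fun ⟨y, hy, hyx⟩ => φ.injective hyx ▸ hy⟩

namespace SelfGluing

variable {k : Type u} [Field k] (O : SelfGluing.{u, w} k)

/-- The self-gluings are equivariant and anticommute. -/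
structure IsOdd : Prop where
  map_glue : ∀ {c : O.Idx} {S T : Type} [Finite S] [Finite T] (φ : S ≃ T) (e : Sym2 S)
    (he : ¬ e.IsDiag) (he' : ¬ (e.map φ).IsDiag) (χ : {x : S // x ∉ e} ≃ {y : T // y ∉ e.map φ})
    (_ : ∀ y, (χ y).1 = φ y.1) (a : O.obj c S),
    O.glue (e.map φ) he' (O.map φ a) = O.map χ (O.glue e he a)
  glue_glue : ∀ {c : O.Idx} {S : Type} [Finite S] (e f : Sym2 S) (he : ¬ e.IsDiag)
    (hf : ¬ f.IsDiag) (f' : Sym2 {x : S // x ∉ e}) (e' : Sym2 {x : S // x ∉ f})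
    (_ : f'.map Subtype.val = f) (_ : e'.map Subtype.val = e) (hf' : ¬ f'.IsDiag)
    (he' : ¬ e'.IsDiag) (χ : {y : {x : S // x ∉ e} // y ∉ f'} ≃ {y : {x : S // x ∉ f} // y ∉ e'})
    (_ : ∀ y, (χ y).1.1 = y.1.1) (a : O.obj c S),
    O.map χ (O.glue f' hf' (O.glue e he a)) = - O.glue e' he' (O.glue f hf a)

variable {O}

theorem IsOdd.glue_map (hO : O.IsOdd) {c : O.Idx} {S T : Type} [Finite S] [Finite T] (φ : S ≃ T)
    {e : Sym2 S} {e' : Sym2 T} (h : e.map φ = e') (he : ¬ e.IsDiag) (he' : ¬ e'.IsDiag)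
    (a : O.obj c S) :
    O.glue e' he' (O.map φ a) = O.map (complCongr φ h) (O.glue e he a) := by
  subst h
  exact hO.map_glue φ e he he' _ (fun _ => rfl) a

/-- The two iterated complements are different types with the same underlying elements. Relabelling
both by a common set `R`, compatibly on underlying elements, puts the two sides into one space
without naming the bijection between them. -/
theorem IsOdd.map_glue_glue (hO : O.IsOdd) {c : O.Idx} {S R : Type} [Finite S] [Finite R]
    {e f : Sym2 S} (he : ¬ e.IsDiag) (hf : ¬ f.IsDiag) {f' : Sym2 {x : S // x ∉ e}}
    {e' : Sym2 {x : S // x ∉ f}} (hff : f'.map Subtype.val = f) (hee : e'.map Subtype.val = e)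
    (hf' : ¬ f'.IsDiag) (he' : ¬ e'.IsDiag) (χ : {y // y ∉ f'} ≃ R) (χ' : {y // y ∉ e'} ≃ R)
    (hχ : ∀ y y', y.1.1 = y'.1.1 → χ y = χ' y') (a : O.obj c S) :
    O.map χ (O.glue f' hf' (O.glue e he a)) = - O.map χ' (O.glue e' he' (O.glue f hf a)) := by
  -- Lying outside `e` and outside `f` does not depend on the order of removal, so `χ.trans χ'.symm`
  -- is the identity on underlying elements.
  have hmem : ∀ y : {y // y ∉ f'}, ∃ y' : {y // y ∉ e'}, y'.1.1 = y.1.1 := fun y => by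
    have h1 : y.1.1 ∉ f := fun h => by
      rw [← hff, Sym2.mem_map] at h
      obtain ⟨z, hz, hzy⟩ := h
      exact y.2 (Subtype.ext hzy ▸ hz)
    refine ⟨⟨⟨y.1.1, h1⟩, fun h => y.1.2 ?_⟩, rfl⟩
    have h2 : y.1.1 ∈ e'.map Subtype.val := Sym2.mem_map.2 ⟨_, h, rfl⟩
    rwa [hee] at h2
  have h := hO.glue_glue e f he hf f' e' hff hee hf' he' (χ.trans χ'.symm) (fun y => by
    obtain ⟨y', hy'⟩ := hmem y
    rw [Equiv.trans_apply, hχ y y' hy'.symm, Equiv.symm_apply_apply, hy']) a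
  rw [← map_neg, ← h, ← O.map_trans]
  congr 2
  ext y
  simp

/-- By equivariance the relabelling between the two gluings moves past the second one. What remains
is two bare gluings followed by one relabelling that preserves underlying elements, the form needed
by `map_glue_glue`. -/
theorem IsOdd.bullet_bullet (hO : O.IsOdd) {c : O.Idx} {U : Type} {A B C : Finset U}
    {e f : Sym2 U} (h₁ : PairOff A e B) (h₂ : PairOff B f C) (a : O.obj c A) :
    ∃ (f' : Sym2 {x : A // x ∉ h₁.pair}) (hf' : ¬ f'.IsDiag) (χ : {y // y ∉ f'} ≃ C),
      (f'.map Subtype.val).map Subtype.val = f ∧ (∀ y, (χ y).1 = y.1.1.1) ∧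
      O.bullet h₂ (O.bullet h₁ a) = O.map χ (O.glue f' hf' (O.glue h₁.pair h₁.pair_ne a)) := by
  have hf : (h₂.pair.map h₁.complEquiv.symm).map h₁.complEquiv = h₂.pair := by
    rw [Sym2.map_map]
    simp
  have hd : ¬ (h₂.pair.map h₁.complEquiv.symm).IsDiag := by
    rw [Sym2.isDiag_map h₁.complEquiv.symm.injective]
    exact h₂.pair_ne
  refine ⟨_, hd, (complCongr h₁.complEquiv hf).trans h₂.complEquiv, ?_, fun y => rfl, ?_⟩
  · rw [Sym2.map_map, Sym2.map_map]
    exact h₂.pair_map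
  · simp only [bullet, LinearMap.comp_apply]
    rw [hO.glue_map h₁.complEquiv hf hd, O.map_trans]

theorem IsOdd.bullet_anticomm (hO : O.IsOdd) {c : O.Idx} {U : Type} {A B B' C : Finset U}
    {e f : Sym2 U} (h₁ : PairOff A e B) (h₂ : PairOff B f C) (h₃ : PairOff A f B')
    (h₄ : PairOff B' e C) (a : O.obj c A) :
    O.bullet h₂ (O.bullet h₁ a) = - O.bullet h₄ (O.bullet h₃ a) := by
  obtain ⟨f', hf', χ, hff, hχ, h⟩ := hO.bullet_bullet h₁ h₂ a
  obtain ⟨e', he', χ', hee, hχ', h'⟩ := hO.bullet_bullet h₃ h₄ a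
  have inj := Sym2.map.injective (Subtype.val_injective (p := (· ∈ A)))
  rw [h, h']
  refine hO.map_glue_glue _ _ (inj ?_) (inj ?_) _ _ _ _ (fun y y' hy => Subtype.ext ?_) a
  · rw [hff, h₃.pair_map]
  · rw [hee, h₁.pair_map]
  · rw [hχ, hχ', hy]

/-! ### The operator Δ on finite subsets and its square -/

open Classical in
theorem delta_lof {U : Type} [DecidableEq (O.Idx × Finset U)] (c : O.Idx) (A : Finset U) (a : O.obj c A) :
    O.delta U (DirectSum.lof k _ (fun p : O.Idx × Finset U => O.obj p.1 p.2) (c, A) a) =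
      ∑ e ∈ (A.sym2.filter fun e => ¬ e.IsDiag).attach,
        DirectSum.lof k _ (fun p : O.Idx × Finset U => O.obj p.1 p.2)
          (O.next c, A.filter fun x => x ∉ e.1) (O.bullet (pairOff_filter e.2) a) := by
  unfold delta
  rw [DirectSum.toModule_lof_of_decidableEq, LinearMap.sum_apply]
  refine Finset.sum_congr rfl fun e _ => ?_
  rw [LinearMap.comp_apply]
  congr!

open Classical in
theorem deltaBiased_lof (c : O.Idx) (n : ℕ) (a : O.obj c (Fin n)) :
    O.deltaBiased (DirectSum.lof k _ (fun p => O.biased.M p) (c, n) a) =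
      O.deltaBiasedAux c n a :=
  DirectSum.toModule_lof _ _ _

open Classical in
theorem toCoinv_lof {U : Type} [DecidableEq (O.Idx × Finset U)] (c : O.Idx) (A : Finset U) (a : O.obj c A) :
    O.toCoinv U (DirectSum.lof k _ (fun p : O.Idx × Finset U => O.obj p.1 p.2) (c, A) a) =
      O.biased.proj (fun _ => ⊤)
        (DirectSum.lof k _ (fun p => O.biased.M p) (c, A.card) (O.map A.equivFin a)) := by
  unfold toCoinv
  rw [DirectSum.toModule_lof_of_decidableEq]
  rfl

open Classical in
-- The double sum runs over ordered pairs `(e, f)` of disjoint pairs. The involution `(e, f) ↦ (f,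
-- e)` has no fixed points, and by `bullet_anticomm` it matches each summand with its negative.
theorem IsOdd.delta_sq (hO : O.IsOdd) (U : Type) : O.delta U ∘ₗ O.delta U = 0 := by
  refine DirectSum.linearMap_ext _ fun p => LinearMap.ext fun a => ?_
  obtain ⟨c, A⟩ := p
  simp only [LinearMap.comp_apply, LinearMap.zero_apply]
  rw [delta_lof, map_sum, Finset.sum_congr rfl fun e _ => delta_lof _ _ _, Finset.sum_sigma']
  have hdis : ∀ {e f : Sym2 U}, f ∈ (A.filter fun x => x ∉ e).sym2.filter (fun e => ¬ e.IsDiag) →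
      f ≠ e := by
    rintro e f hf rfl
    have := Finset.mem_sym2_iff.1 (Finset.mem_filter.1 hf).1
    induction f with | _ x y => ?_
    exact (Finset.mem_filter.1 (this x (by simp))).2 (by simp)
  have hsub : ∀ {e f : Sym2 U}, f ∈ (A.filter fun x => x ∉ e).sym2.filter (fun e => ¬ e.IsDiag) →
      f ∈ A.sym2.filter fun e => ¬ e.IsDiag := fun hf => by
    rw [Finset.mem_filter, Finset.mem_sym2_iff] at hf ⊢
    exact ⟨fun x hx => (Finset.mem_filter.1 (hf.1 x hx)).1, hf.2⟩
  have hswap : ∀ {e f : Sym2 U}, e ∈ A.sym2.filter (fun e => ¬ e.IsDiag) →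
      f ∈ (A.filter fun x => x ∉ e).sym2.filter (fun e => ¬ e.IsDiag) →
      e ∈ (A.filter fun x => x ∉ f).sym2.filter (fun e => ¬ e.IsDiag) := fun he hf => by
    rw [Finset.mem_filter, Finset.mem_sym2_iff] at he hf ⊢
    exact ⟨fun x hx => Finset.mem_filter.2 ⟨he.1 x hx, fun hx' =>
      (Finset.mem_filter.1 (hf.1 x hx')).2 hx⟩, he.2⟩
  refine Finset.sum_involution (fun q _ => ⟨⟨q.2.1, hsub q.2.2⟩, ⟨q.1.1, hswap q.1.2 q.2.2⟩⟩)
    (fun q _ => ?_) (fun q _ _ h => ?_) (fun q _ => by simp) (fun q _ => rfl)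
  · obtain ⟨⟨e, he⟩, ⟨f, hf⟩⟩ := q
    -- Removing `e` then `f` and removing `f` then `e` give equal but differently written subsets,
    -- so the cancellation is stated for variable `C = C'`.
    have key : ∀ {C C' : Finset U} (_ : C = C')
        (h₂ : PairOff (A.filter fun x => x ∉ e) f C)
        (h₄ : PairOff (A.filter fun x => x ∉ f) e C'),
        DirectSum.lof k _ (fun p : O.Idx × Finset U => O.obj p.1 p.2) (O.next (O.next c), C)
            (O.bullet h₂ (O.bullet (pairOff_filter he) a)) +
          DirectSum.lof k _ (fun p : O.Idx × Finset U => O.obj p.1 p.2) (O.next (O.next c), C')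
            (O.bullet h₄ (O.bullet (pairOff_filter (hsub hf)) a)) = 0 := by
      intro C C' hC h₂ h₄
      subst hC
      rw [hO.bullet_anticomm _ h₂ (pairOff_filter (hsub hf)) h₄, map_neg, neg_add_cancel]
    refine key ?_ (pairOff_filter hf) (pairOff_filter (hswap he hf))
    ext x
    simp only [Finset.mem_filter]
    tauto
  · exact hdis q.2.2 (congrArg (fun q => q.1.1) h)

/-! ### The biased operator and order-preserving renumbering -/

open Classical in
/-- The sum `Δ(φ(a))` over the pairs of `Fin (n + 2)`, as a sum over the pairs of `S`. -/
theorem IsOdd.deltaBiasedAux_map (hO : O.IsOdd) {c : O.Idx} {S : Type} [Finite S] {n : ℕ}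
    (φ : S ≃ Fin (n + 2)) (a : O.obj c S) [Fintype {e : Sym2 S // ¬ e.IsDiag}] :
    O.deltaBiasedAux c (n + 2) (O.map φ a) = ∑ e : {e : Sym2 S // ¬ e.IsDiag},
      DirectSum.lof k _ (fun p => O.biased.M p) (O.next c, n)
        (O.map ((complCongr φ rfl).trans (complFin (e.1.map φ)
          ((Sym2.isDiag_map φ.injective).not.2 e.2))) (O.glue e.1 e.2 a)) := by
  simp only [deltaBiasedAux, LinearMap.sum_apply, LinearMap.comp_apply]
  symm
  refine Fintype.sum_bijective
    (fun e => ⟨e.1.map φ, (Sym2.isDiag_map φ.injective).not.2 e.2⟩) ⟨fun e e' h => ?_, fun e => ?_⟩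
    _ _ fun e => ?_
  · exact Subtype.ext (Sym2.map.injective φ.injective (congrArg Subtype.val h))
  · refine ⟨⟨e.1.map φ.symm, (Sym2.isDiag_map φ.symm.injective).not.2 e.2⟩, Subtype.ext ?_⟩
    change (e.1.map φ.symm).map φ = e.1
    rw [Sym2.map_map]
    simp
  · rw [O.map_trans, hO.glue_map φ rfl e.2]

/-- Matches the convention that the biased operator vanishes for `n = 0` and `n = 1`: there are no
pairs to glue. -/
theorem two_le_of_not_isDiag {S : Type} {e : Sym2 S} (he : ¬ e.IsDiag) {n : ℕ} (φ : S ≃ Fin n) : 2 ≤ n := by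
  induction e with | _ x y => ?_
  have h : φ x ≠ φ y := φ.injective.ne (by simpa using he)
  have h1 := (φ x).2
  have h2 := (φ y).2
  have h3 : (φ x).1 ≠ (φ y).1 := fun h' => h (Fin.ext h')
  omega

open Classical in
-- There is only one increasing numbering. The lengths `m` and `n` are separate variables because
-- one of them will be a cardinality.
theorem lof_map_of_strictMono {c : O.Idx} {S : Type} [Finite S] [LinearOrder S] {m n : ℕ}
    {φ : S ≃ Fin m} {ψ : S ≃ Fin n} (hφ : StrictMono φ) (hψ : StrictMono ψ) (a : O.obj c S) :
    DirectSum.lof k _ (fun p => O.biased.M p) (c, m) (O.map φ a) =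
      DirectSum.lof k _ (fun p => O.biased.M p) (c, n) (O.map ψ a) := by
  obtain rfl : m = n := by simpa using Fintype.card_congr (φ.symm.trans ψ)
  rw [Equiv.eq_of_strictMono hφ hψ]

open Classical in
theorem proj_lof_map (H : ∀ p, Subgroup (O.biased.G p)) {c : O.Idx} {S : Type} [Finite S] {n : ℕ}
    {φ ψ : S ≃ Fin n} (h : ∃ j ∈ H (c, n), ψ = φ.trans j) (a : O.obj c S) :
    O.biased.proj H (DirectSum.lof k _ (fun p => O.biased.M p) (c, n) (O.map ψ a)) =
      O.biased.proj H (DirectSum.lof k _ (fun p => O.biased.M p) (c, n) (O.map φ a)) := by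
  obtain ⟨j, hj, rfl⟩ := h
  rw [O.map_trans]
  exact O.biased.proj_lof_ρ H (c, n) j hj (O.map φ a)

open Classical in
-- Two numberings of `S` differ by a permutation, which is invisible in the coinvariants of the full
-- symmetric group.
theorem proj_top_lof_map {c : O.Idx} {S : Type} [Finite S] {m n : ℕ} (φ : S ≃ Fin m)
    (ψ : S ≃ Fin n) (a : O.obj c S) :
    O.biased.proj (fun _ => ⊤) (DirectSum.lof k _ (fun p => O.biased.M p) (c, m) (O.map φ a)) =
      O.biased.proj (fun _ => ⊤) (DirectSum.lof k _ (fun p => O.biased.M p) (c, n) (O.map ψ a)) := by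
  obtain rfl : m = n := by simpa using Fintype.card_congr (φ.symm.trans ψ)
  refine proj_lof_map (fun _ => ⊤) ⟨ψ.symm.trans φ, Subgroup.mem_top _, ?_⟩ a
  ext; simp

variable (O) in
open Classical in
/-- The order-preserving renumbering of finite subsets of a totally ordered set. -/
def compress (U : Type) [LinearOrder U] : O.TotIn U →ₗ[k] O.biased.Tot :=
  DirectSum.toModule k _ _ fun p =>
    DirectSum.lof k _ (fun p => O.biased.M p) (p.1, p.2.card) ∘ₗ
      O.map (p.2.orderIsoOfFin rfl).symm.toEquiv

open Classical in
theorem compress_lof {U : Type} [LinearOrder U] [DecidableEq (O.Idx × Finset U)] (c : O.Idx) (A : Finset U) (a : O.obj c A) :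
    O.compress U (DirectSum.lof k _ (fun p : O.Idx × Finset U => O.obj p.1 p.2) (c, A) a) =
      DirectSum.lof k _ (fun p => O.biased.M p) (c, A.card)
        (O.map (A.orderIsoOfFin rfl).symm.toEquiv a) := by
  unfold compress
  rw [DirectSum.toModule_lof_of_decidableEq]
  rfl

open Classical in
-- Numbering `A` increasingly, removing a pair and closing the gaps gives an increasing numbering of
-- the complement, and so does numbering the complement directly. Uniqueness of such numberings
-- identifies the summands one by one.
theorem IsOdd.deltaBiasedAux_orderIso (hO : O.IsOdd) {c : O.Idx} {U : Type} [LinearOrder U]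
    {A : Finset U} {n : ℕ} (h : A.card = n) {E : Finset (Sym2 U)} {B : E → Finset U}
    (hE : ∀ e : Sym2 A, ¬ e.IsDiag → e.map Subtype.val ∈ E)
    (hB : ∀ e : E, PairOff A e.1 (B e)) (a : O.obj c A) :
    O.deltaBiasedAux c n (O.map (A.orderIsoOfFin h).symm.toEquiv a) =
      ∑ e ∈ E.attach, DirectSum.lof k _ (fun p => O.biased.M p) (O.next c, (B e).card)
        (O.map ((B e).orderIsoOfFin rfl).symm.toEquiv (O.bullet (hB e) a)) := by
  have small : n < 2 → E.attach = ∅ := fun hn => by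
    rw [Finset.attach_eq_empty_iff, Finset.eq_empty_iff_forall_notMem]
    exact fun e he => absurd (two_le_of_not_isDiag (hB ⟨e, he⟩).pair_ne
      (A.orderIsoOfFin h).symm.toEquiv) (by omega)
  rcases n with _ | _ | n
  · rw [small (by omega)]; rfl
  · rw [small (by omega)]; rfl
  have : Fintype {e : Sym2 A // ¬ e.IsDiag} := Fintype.ofFinite _
  rw [hO.deltaBiasedAux_map]
  symm
  refine Finset.sum_bij (fun e _ => ⟨(hB e).pair, (hB e).pair_ne⟩)
    (fun _ _ => Finset.mem_univ _) (fun e _ e' _ he => ?_) (fun e _ => ?_) (fun e _ => ?_)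
  · have := congrArg (fun e => e.1.map Subtype.val) he
    exact Subtype.ext (by simpa only [PairOff.pair_map] using this)
  · refine ⟨⟨_, hE e.1 e.2⟩, Finset.mem_attach _ _, Subtype.ext ?_⟩
    exact Sym2.map.injective Subtype.val_injective (hB _).pair_map
  · simp only [bullet, LinearMap.comp_apply]
    rw [← O.map_trans]
    refine lof_map_of_strictMono ?_ ?_ _
    · exact fun x y hxy => (OrderIso.strictMono _) hxy
    · exact fun x y hxy => complFin_strictMono _
        ((Sym2.isDiag_map (Equiv.injective _)).not.2 (hB e).pair_ne) ((A.orderIsoOfFin h).symm.strictMono hxy)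

open Classical in
theorem map_val_mem_filter {U : Type} {A : Finset U} {e : Sym2 A} (he : ¬ e.IsDiag) :
    e.map Subtype.val ∈ A.sym2.filter fun e => ¬ e.IsDiag := by
  refine Finset.mem_filter.2 ⟨Finset.mem_sym2_iff.2 fun x hx => ?_,
    (Sym2.isDiag_map Subtype.val_injective).not.2 he⟩
  rw [Sym2.mem_map] at hx
  obtain ⟨y, _, rfl⟩ := hx
  exact y.2

/-- This intertwining carries both the vanishing of the square and the compatibility with
coinvariants from finite subsets to the biased setting. -/
theorem IsOdd.deltaBiased_comp_compress (hO : O.IsOdd) (U : Type) [LinearOrder U] :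
    O.deltaBiased ∘ₗ O.compress U = O.compress U ∘ₗ O.delta U := by
  classical
  refine DirectSum.linearMap_ext _ fun p => LinearMap.ext fun a => ?_
  obtain ⟨c, A⟩ := p
  simp only [LinearMap.comp_apply]
  rw [compress_lof, deltaBiased_lof, delta_lof, map_sum,
    Finset.sum_congr rfl fun e _ => compress_lof _ _ _]
  refine hO.deltaBiasedAux_orderIso rfl (fun e he => map_val_mem_filter he) (fun e => pairOff_filter e.2) a

open Classical in
-- An infinite ordered set has subsets of every finite cardinality, so every `Fin n` is reached.
theorem compress_surjective (U : Type) [LinearOrder U] [Infinite U] :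
    Function.Surjective (O.compress U) := by
  rw [← LinearMap.range_eq_top, eq_top_iff]
  rintro x -
  induction x using DirectSum.induction_on with
  | zero => exact zero_mem _
  | add x y hx hy => exact add_mem hx hy
  | of p x =>
    obtain ⟨c, n⟩ := p
    obtain ⟨A, rfl⟩ := Infinite.exists_subset_card_eq U n
    refine ⟨DirectSum.lof k _ (fun p : O.Idx × Finset U => O.obj p.1 p.2) (c, A)
      (O.map (A.orderIsoOfFin rfl).toEquiv x), ?_⟩
    rw [compress_lof, ← O.map_trans]
    have : (A.orderIsoOfFin rfl).toEquiv.trans (A.orderIsoOfFin rfl).symm.toEquiv =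
      Equiv.refl _ := by ext; simp
    rw [this, O.map_refl]
    rfl

theorem IsOdd.deltaBiased_sq (hO : O.IsOdd) : O.deltaBiased ∘ₗ O.deltaBiased = 0 := by
  rw [← LinearMap.cancel_right (compress_surjective (O := O) ℕ), LinearMap.comp_assoc,
    hO.deltaBiased_comp_compress, ← LinearMap.comp_assoc, hO.deltaBiased_comp_compress,
    LinearMap.comp_assoc, hO.delta_sq, LinearMap.comp_zero, LinearMap.zero_comp]

open Classical in
-- The increasing numbering is one admissible choice of bijection, and the class in the coinvariants
-- does not depend on that choice.
theorem proj_comp_compress (U : Type) [LinearOrder U] :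
    O.biased.proj (fun _ => ⊤) ∘ₗ O.compress U = O.toCoinv U := by
  refine DirectSum.linearMap_ext _ fun p => LinearMap.ext fun a => ?_
  obtain ⟨c, A⟩ := p
  simp only [LinearMap.comp_apply]
  rw [compress_lof, toCoinv_lof]
  exact proj_top_lof_map _ _ a

open Classical in
/-- To compare `Δ(σ(a))` and `Δ(a)` modulo the action it is enough to compare the renumberings of the
complements of all pairs. -/
theorem IsOdd.proj_deltaBiasedAux_map (hO : O.IsOdd) (H : ∀ p, Subgroup (O.biased.G p)) {c : O.Idx}
    {n : ℕ} (σ : Equiv.Perm (Fin n))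
    (hσ : ∀ m (_ : n = m + 2) (e : Sym2 (Fin n)) (φ φ' : {x // x ∉ e} ≃ Fin m), StrictMono φ →
      (∀ x y, σ x.1 < σ y.1 → φ' x < φ' y) → ∃ j ∈ H (O.next c, m), φ' = φ.trans j)
    (a : O.obj c (Fin n)) :
    O.biased.proj H (O.deltaBiasedAux c n (O.map σ a)) = O.biased.proj H (O.deltaBiasedAux c n a) := by
  rcases n with _ | _ | n
  · rfl
  · rfl
  conv_rhs => rw [← O.map_refl a]
  rw [hO.deltaBiasedAux_map, hO.deltaBiasedAux_map, map_sum, map_sum]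
  refine Finset.sum_congr rfl fun e _ => ?_
  refine proj_lof_map H (hσ n rfl e.1 _ _ ?_ ?_) _
  · exact fun x y hxy => complFin_strictMono _ ((Sym2.isDiag_map (Equiv.refl _).injective).not.2 e.2) hxy
  · exact fun x y hxy => complFin_strictMono _ ((Sym2.isDiag_map σ.injective).not.2 e.2) hxy

instance (p : O.biased.P) : Finite (O.cyc p) :=
  inferInstanceAs (Finite (_ : Subgroup (Equiv.Perm (Fin p.2))))

open Classical in
theorem IsOdd.hasDifferential (hO : O.IsOdd) : O.HasDifferential where
  anticomm h₁ h₂ h₃ h₄ _ a := hO.bullet_anticomm h₁ h₂ h₃ h₄ a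
  delta_sq := hO.delta_sq
  biased_sq := hO.deltaBiased_sq
  coinv := by
    have hΔ : ∀ (p : O.biased.P) (a : O.biased.M p),
        O.deltaBiased (DirectSum.lof k O.biased.P (fun p => O.biased.M p) p a) =
          O.deltaBiasedAux p.1 p.2 a := fun p a => deltaBiased_lof p.1 p.2 a
    obtain ⟨D, hD⟩ := O.biased.exists_inducesDifferential O.deltaBiased hO.deltaBiased_sq O.cyc
      (fun p σ a => by
        rw [hΔ, hΔ]
        refine hO.proj_deltaBiasedAux_map (fun _ => ⊤) σ (fun m _ e φ φ' _ _ => ⟨φ.symm.trans φ', Subgroup.mem_top _, ?_⟩) a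
        ext; simp)
      (fun p σ hσ a => by
        -- The permutations that do not change the class of Δ form a subgroup, so only the generator
        -- `finRotate` has to be tested.
        have hle : O.cyc p ≤ (O.biased.ρ p).invariance (O.biased.proj O.cyc ∘ₗ O.deltaBiased ∘ₗ
            DirectSum.lof k O.biased.P (fun p => O.biased.M p) p) := by
          refine Subgroup.zpowers_le.2 fun a => ?_
          simp only [LinearMap.comp_apply]
          rw [hΔ, hΔ]
          exact hO.proj_deltaBiasedAux_map _ _ (fun m _ e φ φ' h h' => exists_rotation h h') a
        exact hle hσ a)
    refine ⟨D, hD, fun U => ?_⟩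
    obtain ⟨_⟩ : Nonempty (LinearOrder U) := nonempty_linearOrder _
    rw [← proj_comp_compress, ← LinearMap.comp_assoc, hD.2.1, LinearMap.comp_assoc,
      hO.deltaBiased_comp_compress, LinearMap.comp_assoc]

end SelfGluing

/-! ## Singular chains of extended modular operads -/

/-- Barycentric coordinates of the image are sums over the fibres of `f`. This computes the circle
coordinate of a degenerate simplex. -/
theorem stdSimplex.sum_map {X Y : Type} [Fintype X] [Fintype Y] (f : X → Y) (t : stdSimplex ℝ X)
    (p : Y → Prop) [DecidablePred p] [DecidablePred fun x => p (f x)] :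
    ∑ y with p y, stdSimplex.map f t y = ∑ x with p (f x), t x := by
  classical
  have h : ∀ y, stdSimplex.map f t y = ∑ x with f x = y, t x := fun y => by
    rw [stdSimplex.map_coe, FunOnFinite.linearMap_apply_apply]
  simp only [h, Finset.sum_filter]
  rw [← Finset.sum_filter, Finset.sum_comm' (t' := Finset.univ) (s' := fun x =>
    Finset.univ.filter fun y => p y)]
  · refine Finset.sum_congr rfl fun x _ => ?_
    rw [Finset.sum_ite_eq]
    simp
  · simp

/-! ### Simplicial identities and signs for the double prism -/

namespace Fin

theorem val_predAbove_eq {q : ℕ} (i : Fin q) (m : Fin (q + 1)) :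
    (i.predAbove m : ℕ) = if (i : ℕ) < m then (m : ℕ) - 1 else m := by
  simp only [Fin.predAbove, Fin.lt_def, Fin.val_castSucc]
  split_ifs <;> rfl

theorem val_succAbove_eq {q : ℕ} (i : Fin (q + 1)) (j : Fin q) :
    (i.succAbove j : ℕ) = if (j : ℕ) < i then (j : ℕ) else j + 1 := by
  simp only [Fin.succAbove, Fin.lt_def, Fin.val_castSucc]
  split_ifs <;> rfl

/-- The vertices beyond position `j` after the `i`-th degeneracy are the images of those beyond
position `i.succAbove j` before it. -/
theorem castSucc_lt_predAbove_iff {q : ℕ} (i : Fin (q + 2)) (j : Fin (q + 1)) (m : Fin (q + 3)) :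
    j.castSucc < i.predAbove m ↔ (i.succAbove j).castSucc < m := by
  simp only [Fin.lt_def, Fin.val_castSucc, val_predAbove_eq, val_succAbove_eq]
  split_ifs <;> omega

theorem predAbove_comp_predAbove {q : ℕ} (i : Fin (q + 2)) (j : Fin (q + 1)) :
    j.predAbove ∘ i.predAbove = (j.predAbove i).predAbove ∘ (i.succAbove j).predAbove := by
  funext m
  ext
  simp only [Function.comp_apply, val_predAbove_eq, val_succAbove_eq]
  split_ifs <;> omega

/-- The sum of the two new indices is `i + j - 1` or `i + j + 1`, according to whether `j < i`, so
its parity always changes. This is the source of the minus sign for chains. -/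
theorem neg_one_pow_succAbove {k : Type*} [Ring k] {q : ℕ} (i : Fin (q + 2)) (j : Fin (q + 1)) :
    (-1 : k) ^ (j.predAbove i : ℕ) * (-1) ^ (i.succAbove j : ℕ) =
      - ((-1) ^ (j : ℕ) * (-1) ^ (i : ℕ)) := by
  rw [← pow_add, ← pow_add, val_predAbove_eq, val_succAbove_eq,
    ← neg_one_mul ((-1 : k) ^ ((j : ℕ) + i)), ← pow_succ']
  split_ifs with h
  · obtain ⟨n, hn⟩ : ∃ n, (i : ℕ) = n + 1 := ⟨i - 1, by omega⟩
    rw [hn, show (j : ℕ) + (n + 1) + 1 = (n + 1 - 1 + j) + 2 by omega, pow_add _ _ 2]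
    simp
  · congr 1
    omega

end Fin

/-! ### Antisymmetry of the cross product with two circles -/

namespace SingChain

variable {k : Type u} [Field k] {q : ℕ} {X Y Z : Type w} [TopologicalSpace X] [TopologicalSpace Y]
  [TopologicalSpace Z]

theorem push_push (f : C(X, Y)) (g : C(Y, Z)) (a : SingChain k q X) :
    push k g (push k f a) = push k (g.comp f) a := by
  simp only [push, Finsupp.lmapDomain_apply]
  rw [← Finsupp.mapDomain_comp]
  rfl

theorem push_single (f : C(X, Y)) (σ : C(stdSimplex ℝ (Fin (q + 1)), X)) (r : k) :
    push k f (Finsupp.single σ r) = Finsupp.single (f.comp σ) r := Finsupp.mapDomain_single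

theorem crossCircle_single (σ : C(stdSimplex ℝ (Fin (q + 1)), Y)) :
    crossCircle k (Finsupp.single σ 1) =
      ∑ i : Fin (q + 1), (-1 : k) ^ (i : ℕ) • Finsupp.single (prism i σ) 1 := by
  rw [crossCircle, Finsupp.linearCombination_single, one_smul]

theorem crossCircle_push (f : C(Y, Z)) (a : SingChain k q Y) :
    crossCircle k (push k f a) = push k ((ContinuousMap.id UnitAddCircle).prodMap f)
      (crossCircle k a) := by
  suffices h : crossCircle k ∘ₗ push k f =
      push k ((ContinuousMap.id UnitAddCircle).prodMap f) ∘ₗ crossCircle k (q := q) from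
    LinearMap.congr_fun h a
  refine Finsupp.lhom_ext' fun σ => LinearMap.ext_ring ?_
  simp only [LinearMap.comp_apply, Finsupp.lsingle_apply]
  rw [push_single, crossCircle_single, crossCircle_single, map_sum]
  refine Finset.sum_congr rfl fun i _ => ?_
  rw [map_smul, push_single]
  rfl

/-- The exchange of the two circles. -/
def swapCircles (Y : Type w) [TopologicalSpace Y] :
    C(UnitAddCircle × UnitAddCircle × Y, UnitAddCircle × UnitAddCircle × Y) where
  toFun p := (p.2.1, p.1, p.2.2)
  continuous_toFun := by fun_prop

/-- In the simplex with indices `(i, j)` the first interval coordinate jumps at position `i` and the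
second at the different position `i.succAbove j`. Exchanging the circles exchanges these two
positions; `j.predAbove i` is the index that makes `i` the second one. -/
theorem swapCircles_prism_prism (i : Fin (q + 2)) (j : Fin (q + 1))
    (σ : C(stdSimplex ℝ (Fin (q + 1)), Y)) :
    (swapCircles Y).comp (prism i (prism j σ)) =
      prism (i.succAbove j) (prism (j.predAbove i) σ) := by
  have key : ∀ (i : Fin (q + 2)) (j : Fin (q + 1)) (t : stdSimplex ℝ (Fin (q + 3))),
      ∑ l with j.castSucc < l, stdSimplex.map i.predAbove t l =
        ∑ m with (i.succAbove j).castSucc < m, t m := fun i j t => by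
    classical
    rw [stdSimplex.sum_map i.predAbove t (fun l => j.castSucc < l)]
    refine Finset.sum_congr (Finset.filter_congr fun m _ => ?_) fun _ _ => rfl
    exact Fin.castSucc_lt_predAbove_iff i j m
  refine ContinuousMap.ext fun t => ?_
  refine Prod.ext ?_ (Prod.ext ?_ ?_)
  · exact congrArg ((↑) : ℝ → UnitAddCircle) (key i j t)
  · refine congrArg ((↑) : ℝ → UnitAddCircle) (Eq.trans ?_ (key (i.succAbove j) (j.predAbove i) t).symm)
    rw [Fin.succAbove_succAbove_predAbove]
  · change σ _ = σ _
    rw [stdSimplex.map_comp_apply, stdSimplex.map_comp_apply, Fin.predAbove_comp_predAbove]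

/-- The cross product with two circles is antisymmetric. -/
theorem push_swapCircles (a : SingChain k q Y) :
    push k (swapCircles Y) (crossCircle k (crossCircle k a)) = - crossCircle k (crossCircle k a) := by
  suffices h : push k (swapCircles Y) ∘ₗ crossCircle k ∘ₗ crossCircle k =
      - crossCircle k ∘ₗ crossCircle k (q := q) from LinearMap.congr_fun h a
  refine Finsupp.lhom_ext' fun σ => LinearMap.ext_ring ?_
  simp only [LinearMap.comp_apply, Finsupp.lsingle_apply, LinearMap.neg_apply]
  simp only [crossCircle_single, map_sum, map_smul, push_single, Finset.smul_sum,
    swapCircles_prism_prism]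
  rw [← Finset.sum_neg_distrib]
  simp only [← Finset.sum_neg_distrib]
  rw [← Fintype.sum_prod_type', ← Fintype.sum_prod_type']
  -- Exchanging two distinct positions is an involution, so the simplices can be reindexed by it;
  -- each coefficient then changes sign.
  have inv : Function.Involutive
      fun p : Fin (q + 1) × Fin (q + 2) => (p.1.predAbove p.2, p.2.succAbove p.1) := fun p =>
    Prod.ext (Fin.predAbove_predAbove_succAbove _ _) (Fin.succAbove_succAbove_predAbove _ _)
  refine Fintype.sum_bijective _ inv.bijective _ _ fun p => ?_
  rw [smul_smul, smul_smul, Fin.neg_one_pow_succAbove, neg_smul, neg_neg]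

end SingChain

/-! ### Twisted gluings of spaces and of chains -/

namespace EMO

variable (E : EMO.{w})

theorem twist_apply {S : Type} [Finite S] [DecidableEq S] (e : Sym2 S) (he : ¬ e.IsDiag) (s : S)
    (θ : UnitAddCircle) (x : E.X S) :
    E.twist e he s (θ, x) = E.glue e he (E.act (Pi.single s θ) x) := by
  change E.glue e he (E.act _ x) = _
  congr!

theorem twist_map {S T : Type} [Finite S] [Finite T] (φ : S ≃ T) (e : Sym2 S) (he : ¬ e.IsDiag)
    (he' : ¬ (e.map φ).IsDiag) (χ : {x : S // x ∉ e} ≃ {y : T // y ∉ e.map φ})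
    (hχ : ∀ y, (χ y).1 = φ y.1) (s : S) :
    (E.twist (e.map φ) he' (φ s)).comp ((ContinuousMap.id UnitAddCircle).prodMap (E.map φ)) =
      (E.map χ).comp (E.twist e he s) := by
  classical
  refine ContinuousMap.ext fun ⟨θ, x⟩ => ?_
  change E.twist _ he' (φ s) (θ, E.map φ x) = E.map χ (E.twist e he s (θ, x))
  rw [twist_apply, twist_apply, ← E.map_glue φ e he he' χ hχ, E.map_act]
  congr 2
  funext y
  simp only [Function.comp_apply, Pi.single_apply, Equiv.symm_apply_eq]

/-- The flag `t` is not glued, so its rotation may be performed before the gluing; both rotations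
then form a single torus element. -/
theorem act_glue_act {S : Type} [Finite S] [DecidableEq S] {e : Sym2 S} (he : ¬ e.IsDiag) (s : S)
    (t : {x // x ∉ e}) (θ η : UnitAddCircle) (x : E.X S) :
    E.act (Pi.single t θ) (E.glue e he (E.act (Pi.single s η) x)) =
      E.glue e he (E.act (Pi.single t.1 θ + Pi.single s η) x) := by
  rw [E.act_add, E.glue_act e he (Pi.single t.1 θ) (fun x hx => ?_)]
  · congr 1
    funext y
    simp [Pi.single_apply, Subtype.ext_iff]
  · rw [Pi.single_eq_of_ne]
    rintro rfl
    exact t.2 hx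

/-- With both rotations moved to the front, commuting gluings and the commutative torus make the two
families equal. Only their parameters come in opposite order, whence the exchange of circles. -/
theorem twist_twist {S : Type} [Finite S] (e f : Sym2 S) (he : ¬ e.IsDiag) (hf : ¬ f.IsDiag)
    (f' : Sym2 {x : S // x ∉ e}) (e' : Sym2 {x : S // x ∉ f}) (hff : f'.map Subtype.val = f)
    (hee : e'.map Subtype.val = e) (hf' : ¬ f'.IsDiag) (he' : ¬ e'.IsDiag)
    (χ : {y : {x : S // x ∉ e} // y ∉ f'} ≃ {y : {x : S // x ∉ f} // y ∉ e'})
    (hχ : ∀ y, (χ y).1.1 = y.1.1) (s : {x // x ∉ f}) (t : {x // x ∉ e}) :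
    (E.map χ).comp ((E.twist f' hf' t).comp
        ((ContinuousMap.id UnitAddCircle).prodMap (E.twist e he s.1))) =
      ((E.twist e' he' s).comp ((ContinuousMap.id UnitAddCircle).prodMap (E.twist f hf t.1))).comp
        (SingChain.swapCircles (E.X S)) := by
  classical
  refine ContinuousMap.ext fun ⟨θ, η, x⟩ => ?_
  change E.map χ (E.twist f' hf' t (θ, E.twist e he s.1 (η, x))) =
    E.twist e' he' s (η, E.twist f hf t.1 (θ, x))
  rw [twist_apply, twist_apply, twist_apply, twist_apply, act_glue_act, act_glue_act,
    E.glue_glue e f he hf f' e' hff hee hf' he' χ hχ, add_comm]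

/-- The odd self-gluings of singular chains. -/
def chainGlue (k : Type u) [Field k] {q : ℕ} {S : Type} [Finite S] (e : Sym2 S)
    (he : ¬ e.IsDiag) : SingChain k q (E.X S) →ₗ[k] SingChain k (q + 1) (E.X {x : S // x ∉ e}) :=
  SingChain.push k (E.twist e he (Quot.out e).1) ∘ₗ SingChain.crossCircle k

/-- Balancedness removes the dependence on the flag chosen by `Quot.out`, so the flags can later be
chosen compatibly. -/
theorem chainGlue_apply (k : Type u) [Field k] {q : ℕ} {S : Type} [Finite S] {e : Sym2 S}
    (he : ¬ e.IsDiag) {s : S} (hs : s ∈ e) (a : SingChain k q (E.X S)) :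
    E.chainGlue k e he a = SingChain.push k (E.twist e he s) (SingChain.crossCircle k a) := by
  rw [E.twist_eq e he s (Quot.out e).1 hs (Sym2.out_fst_mem e)]
  rfl

theorem chainGlue_push (k : Type u) [Field k] {q : ℕ} {S T : Type} [Finite S] [Finite T]
    (φ : S ≃ T) (e : Sym2 S) (he : ¬ e.IsDiag) (he' : ¬ (e.map φ).IsDiag)
    (χ : {x : S // x ∉ e} ≃ {y : T // y ∉ e.map φ}) (hχ : ∀ y, (χ y).1 = φ y.1)
    (a : SingChain k q (E.X S)) :
    E.chainGlue k (e.map φ) he' (SingChain.push k (E.map φ) a) =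
      SingChain.push k (E.map χ) (E.chainGlue k e he a) := by
  have hs := Sym2.out_fst_mem e
  have hs' : φ (Quot.out e).1 ∈ e.map φ := Sym2.mem_map.2 ⟨_, hs, rfl⟩
  rw [E.chainGlue_apply k he hs, E.chainGlue_apply k he' hs', SingChain.crossCircle_push,
    SingChain.push_push, SingChain.push_push, E.twist_map φ e he he' χ hχ]

/-- By naturality of the cross product both sides are push-forwards of the same double cross
product, along maps that differ by `swapCircles`, which acts by -1. -/
theorem chainGlue_chainGlue (k : Type u) [Field k] {q : ℕ} {S : Type} [Finite S] (e f : Sym2 S)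
    (he : ¬ e.IsDiag) (hf : ¬ f.IsDiag) (f' : Sym2 {x : S // x ∉ e}) (e' : Sym2 {x : S // x ∉ f})
    (hff : f'.map Subtype.val = f) (hee : e'.map Subtype.val = e) (hf' : ¬ f'.IsDiag)
    (he' : ¬ e'.IsDiag) (χ : {y : {x : S // x ∉ e} // y ∉ f'} ≃ {y : {x : S // x ∉ f} // y ∉ e'})
    (hχ : ∀ y, (χ y).1.1 = y.1.1) (a : SingChain k q (E.X S)) :
    SingChain.push k (E.map χ) (E.chainGlue k f' hf' (E.chainGlue k e he a)) =
      - E.chainGlue k e' he' (E.chainGlue k f hf a) := by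
  have hs := Sym2.out_fst_mem e'
  have ht := Sym2.out_fst_mem f'
  -- The flag rotated for `e` must be the same in both orders; it is taken from `e'`, and likewise
  -- the one for `f` from `f'`.
  have hs' : (Quot.out e').1.1 ∈ e := by
    have : (Quot.out e').1.1 ∈ e'.map Subtype.val := Sym2.mem_map.2 ⟨_, hs, rfl⟩
    rwa [hee] at this
  have ht' : (Quot.out f').1.1 ∈ f := by
    have : (Quot.out f').1.1 ∈ f'.map Subtype.val := Sym2.mem_map.2 ⟨_, ht, rfl⟩
    rwa [hff] at this
  rw [E.chainGlue_apply k he hs', E.chainGlue_apply k hf ht', E.chainGlue_apply k hf' ht,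
    E.chainGlue_apply k he' hs, SingChain.crossCircle_push,
    SingChain.crossCircle_push, SingChain.push_push, SingChain.push_push, SingChain.push_push,
    ContinuousMap.comp_assoc, E.twist_twist e f he hf f' e' hff hee hf' he' χ hχ, ← SingChain.push_push,
    SingChain.push_swapCircles, map_neg]

theorem chains_isOdd (k : Type u) [Field k] : (E.chains k).IsOdd where
  map_glue φ e he he' χ hχ a := E.chainGlue_push k φ e he he' χ hχ a
  glue_glue e f he hf f' e' hff hee hf' he' χ hχ a :=
    E.chainGlue_chainGlue k e f he hf f' e' hff hee hf' he' χ hχ a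

end EMO

/-! ## Graphs with one vertex and two loops -/

namespace FGraph

/-- With one tensor factor nothing is permuted, so the whole sign comes from the determinant of the
edges. -/
theorem Iso.koszul_of_subsingleton {Γ Γ' : FGraph} (hΓ : Subsingleton Γ.V) (φ : Iso Γ Γ')
    (d : Γ.V → ℤ) : φ.koszul d = 0 :=
  Finset.sum_eq_zero fun v _ => Finset.sum_eq_zero fun w _ => if_neg fun h => by
    obtain rfl := hΓ.elim v w
    exact lt_irrefl _ h.1

section Subst

variable (Γ₀ : FGraph) (Γ : Γ₀.V → FGraph) (lab : ∀ v, (Γ v).Tail ≃ Γ₀.Fl v)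

theorem inv_eq_of_outerFlag_eq {f₀ : Γ₀.Flag} {v : Γ₀.V} {f : (Γ v).Flag}
    (h : outerFlag Γ₀ Γ lab f₀ = innerFlag Γ₀ Γ v f) : (Γ v).inv f = f := by
  obtain ⟨w, x⟩ := f₀
  obtain rfl : w = v := congrArg (fun x => x.1.1) h
  rw [← innerFlag_injective Γ₀ Γ w h]
  exact ((lab w).symm x).2

/-- Flags of `Γ₀` are glued to tails of the inserted graphs, whereas an inner edge consists of flags
that are not tails. -/
theorem outerEdge_ne_innerEdge (e₀ : Γ₀.Edge) (v : Γ₀.V) (e : (Γ v).Edge) :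
    outerEdge Γ₀ Γ lab e₀ ≠ innerEdge Γ₀ Γ lab v e := by
  obtain ⟨e, f, hf, rfl⟩ := e
  intro h
  have hm : innerFlag Γ₀ Γ v f ∈ (outerEdge Γ₀ Γ lab e₀).1 := by
    rw [h]
    exact Sym2.mem_map.2 ⟨f, Sym2.mem_mk_left _ _, rfl⟩
  obtain ⟨f₀, _, h₀⟩ := Sym2.mem_map.1 hm
  exact hf (inv_eq_of_outerFlag_eq Γ₀ Γ lab h₀)

theorem edge_cases (e : (subst Γ₀ Γ lab).Edge) :
    (∃ e₀, e = outerEdge Γ₀ Γ lab e₀) ∨ ∃ v e', e = innerEdge Γ₀ Γ lab v e' := by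
  obtain ⟨e, f, hf, rfl⟩ := e
  change substInv Γ₀ Γ lab f ≠ f at hf
  rcases flag_cases Γ₀ Γ lab f with ⟨f₀, rfl⟩ | ⟨v, f', h, rfl⟩
  · rw [substInv_outer] at hf
    refine Or.inl ⟨⟨s(f₀, Γ₀.inv f₀), f₀, fun h => hf (congrArg _ h), rfl⟩, Subtype.ext ?_⟩
    change s(_, substInv _ _ _ _) = Sym2.map _ s(_, _)
    rw [substInv_outer, Sym2.map_mk]
  · refine Or.inr ⟨v, ⟨s(f', (Γ v).inv f'), f', h, rfl⟩, Subtype.ext ?_⟩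
    change s(_, substInv _ _ _ _) = Sym2.map _ s(_, _)
    rw [substInv_inner _ _ _ _ _ h, Sym2.map_mk]

theorem substInv_outer_eq_iff (f : Γ₀.Flag) :
    substInv Γ₀ Γ lab (outerFlag Γ₀ Γ lab f) = outerFlag Γ₀ Γ lab f ↔ Γ₀.inv f = f := by
  rw [substInv_outer, (outerFlag_injective Γ₀ Γ lab).eq_iff]

theorem exists_outerFlag_of_substInv_eq {f : (subst Γ₀ Γ lab).Flag}
    (hf : substInv Γ₀ Γ lab f = f) : ∃ f₀, Γ₀.inv f₀ = f₀ ∧ f = outerFlag Γ₀ Γ lab f₀ := by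
  rcases flag_cases Γ₀ Γ lab f with ⟨f₀, rfl⟩ | ⟨v, f', h, rfl⟩
  · exact ⟨f₀, (substInv_outer_eq_iff Γ₀ Γ lab f₀).1 hf, rfl⟩
  · rw [substInv_inner _ _ _ _ _ h] at hf
    exact absurd (innerFlag_injective _ _ _ hf) h

/-- The tails of the big graph are those of `Γ₀`. -/
def substTail : (subst Γ₀ Γ lab).Tail ≃ Γ₀.Tail :=
  (Equiv.ofBijective
    (fun t : Γ₀.Tail => (⟨outerFlag Γ₀ Γ lab t.1, (substInv_outer_eq_iff Γ₀ Γ lab t.1).2 t.2⟩ :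
      (subst Γ₀ Γ lab).Tail))
    ⟨fun t t' h => Subtype.ext (outerFlag_injective Γ₀ Γ lab (congrArg Subtype.val h)), fun t => by
      obtain ⟨f₀, h, h'⟩ := exists_outerFlag_of_substInv_eq Γ₀ Γ lab t.2
      exact ⟨⟨f₀, h⟩, Subtype.ext h'.symm⟩⟩).symm

theorem outerFlag_substTail (t : (subst Γ₀ Γ lab).Tail) :
    outerFlag Γ₀ Γ lab (substTail Γ₀ Γ lab t).1 = t.1 :=
  congrArg Subtype.val (Equiv.apply_symm_apply (substTail Γ₀ Γ lab).symm t)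

theorem substTail_eq {t₀ : Γ₀.Tail} {t : (subst Γ₀ Γ lab).Tail}
    (h : t.1 = outerFlag Γ₀ Γ lab t₀.1) : substTail Γ₀ Γ lab t = t₀ := by
  refine Subtype.ext (outerFlag_injective Γ₀ Γ lab ?_)
  rw [outerFlag_substTail, h]

end Subst

theorem flip_map {R S : Type} {r : R → S} (hr : Function.Injective r) (e : Sym2 R) (x : R) :
    flip (e.map r) (r x) = r (flip e x) := by
  by_cases hx : x ∈ e
  · obtain ⟨y, rfl⟩ := hx
    rw [flip_mk, Sym2.map_mk, flip_mk]
  · rw [flip_of_not_mem hx, flip_of_not_mem]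
    rw [Sym2.mem_map]
    rintro ⟨y, hy, hyx⟩
    exact hx (hr hyx ▸ hy)

theorem flip_mem {S : Type} {e : Sym2 S} {x : S} (hx : x ∈ e) : flip e x ∈ e := by
  obtain ⟨y, rfl⟩ := hx
  rw [flip_mk]
  exact Sym2.mem_mk_right _ _

/-- Each involution is supported on its own pair, and the pairs are disjoint. -/
theorem flip_comm {S : Type} {e f : Sym2 S} (h : ∀ x ∈ e, x ∉ f) (x : S) :
    flip e (flip f x) = flip f (flip e x) := by
  by_cases hx : x ∈ e
  · rw [flip_of_not_mem (h x hx), flip_of_not_mem (h _ (flip_mem hx))]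
  · rw [flip_of_not_mem hx]
    by_cases hf : x ∈ f
    · exact flip_of_not_mem fun h' => h _ h' (flip_mem hf)
    · rw [flip_of_not_mem hf, flip_of_not_mem hx]

section TwoLoops

variable {S R : Type} [Finite S] [Finite R]

/-- The graph with one vertex and two loops obtained by inserting a loop graph into another one. -/
abbrev twoLoops (e : Sym2 S) (f : Sym2 R) (lab : (loop e).Tail ≃ R) : FGraph :=
  subst (loop f) (fun _ => loop e) fun _ => lab

instance subsingleton_sigma_unit : Subsingleton (Σ _ : Unit, Unit) := ⟨fun ⟨_, _⟩ ⟨_, _⟩ => rfl⟩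

variable {e : Sym2 S} {f : Sym2 R}

theorem card_edge_twoLoops (he : ¬ e.IsDiag) (hf : ¬ f.IsDiag)
    (lab : (loop e).Tail ≃ R) : Nat.card (twoLoops e f lab).Edge = 2 := by
  rw [Nat.card_eq_two_iff]
  refine ⟨outerEdge _ _ _ (loopEdge f hf), innerEdge _ _ _ () (loopEdge e he),
    outerEdge_ne_innerEdge _ _ _ _ _ _, Set.eq_univ_of_forall fun x => ?_⟩
  rcases edge_cases _ _ _ x with ⟨e₀, rfl⟩ | ⟨v, e', rfl⟩
  · rw [loop_edge_unique f hf e₀]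
    exact Or.inl rfl
  · rw [loop_edge_unique e he e']
    exact Or.inr rfl

theorem twoLoops_connected (lab : (loop e).Tail ≃ R) : (twoLoops e f lab).Connected :=
  ⟨⟨⟨(), ()⟩⟩, fun v w => by
    rw [show v = w from Subsingleton.elim (α := Σ _ : Unit, Unit) v w]
    exact .refl _⟩

theorem twoLoops_hasGenus (he : ¬ e.IsDiag) (hf : ¬ f.IsDiag)
    (lab : (loop e).Tail ≃ R) (g : ℕ) : (twoLoops e f lab).HasGenus (fun _ => g) (g + 1 + 1) := by
  have h1 : ∑ _v : (twoLoops e f lab).V, g = g := by change ∑ _v : (Σ _ : Unit, Unit), g = g; simp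
  have h2 : Fintype.card (twoLoops e f lab).V = 1 := rfl
  rw [HasGenus, card_edge_twoLoops he hf, h1, h2]

theorem twoLoops_degree (he : ¬ e.IsDiag) (hf : ¬ f.IsDiag)
    (lab : (loop e).Tail ≃ R) (i : ℤ) (ε : ℤˣ) :
    ∑ _v : (twoLoops e f lab).V, i + (ε : ℤ) * Nat.card (twoLoops e f lab).Edge = i + ε + ε := by
  have h1 : ∑ _v : (twoLoops e f lab).V, i = i := by change ∑ _v : (Σ _ : Unit, Unit), i = i; simp
  rw [card_edge_twoLoops he hf, h1]
  push_cast
  ring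

/-- The generator `f ∧ e` of `Det(Edge)` of the graph with two loops. -/
def twoLoopsDet (he : ¬ e.IsDiag) (hf : ¬ f.IsDiag)
    (lab : (loop e).Tail ≃ R) (k : Type*) [Field k] : Det k (twoLoops e f lab) :=
  ⟨ExteriorAlgebra.ι k (Finsupp.single (outerEdge _ _ _ (loopEdge f hf)) 1) *
      ExteriorAlgebra.ι k (Finsupp.single (innerEdge _ _ _ () (loopEdge e he)) 1), by
    rw [Det, card_edge_twoLoops he hf, ExteriorAlgebra.exteriorPower, pow_two]
    exact Submodule.mul_mem_mul (LinearMap.mem_range_self _ _) (LinearMap.mem_range_self _ _)⟩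

theorem twoLoopsDet_eq_wedge (he : ¬ e.IsDiag) (hf : ¬ f.IsDiag)
    (lab : (loop e).Tail ≃ R) (k : Type*) [Field k] :
    (twoLoopsDet he hf lab k).1 = wedge (loop f) (fun _ => loop e) (fun _ => lab) k
      (loopDet f hf k) fun _ => loopDet e he k := by
  have : (Finset.univ : Finset (loop f).V).sort (· ≤ ·) = [()] := Finset.sort_singleton _ _
  rw [wedge, this]
  simp [twoLoopsDet, loopDet]

theorem substKoszul_twoLoops (lab : (loop e).Tail ≃ R) (d : (twoLoops e f lab).V → ℤ) :
    substKoszul (loop f) (fun _ => loop e) (fun _ => lab) d = 0 :=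
  Finset.sum_eq_zero fun _ _ => Finset.sum_eq_zero fun _ _ => if_neg (lt_irrefl _)

variable {lab : (loop e).Tail ≃ R} {r : R → S}

/-- Here `r` reads a label in `R` as the flag in `S` that it labels. Keeping it abstract lets the
same lemmas serve undirected graphs, with a subtype inclusion, and directed ones, with a sum of two
inclusions. -/
theorem outerFlag_twoLoops (hr : ∀ t, r (lab t) = t.1.2) (x : R) :
    outerFlag (loop f) (fun _ => loop e) (fun _ => lab) ⟨(), x⟩ = ⟨⟨(), ()⟩, r x⟩ := by
  obtain ⟨t, rfl⟩ := lab.surjective x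
  rw [hr]
  simp only [outerFlag, Equiv.symm_apply_apply]
  rfl

omit [Finite R] in
theorem label_injective (hr : ∀ t, r (lab t) = t.1.2) : Function.Injective r := fun x y h => by
  obtain ⟨t, rfl⟩ := lab.surjective x
  obtain ⟨t', rfl⟩ := lab.surjective y
  rw [hr, hr] at h
  congr 1
  exact Subtype.ext (Sigma.ext (Subsingleton.elim _ _) (heq_of_eq h))

omit [Finite R] in
theorem label_notMem (he : ¬ e.IsDiag) (hr : ∀ t, r (lab t) = t.1.2) (x : R) : r x ∉ e := by
  obtain ⟨t, rfl⟩ := lab.surjective x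
  rw [hr]
  exact (loopTail e he t).2

/-- The two loops occupy disjoint pairs of flags in `S`, so the involution is a product of two
commuting flips. This form is symmetric in the loops and shows that the order of insertion is
irrelevant. -/
theorem substInv_twoLoops (he : ¬ e.IsDiag) (hr : ∀ t, r (lab t) = t.1.2) (x : S) :
    (twoLoops e f lab).inv ⟨⟨(), ()⟩, x⟩ = ⟨⟨(), ()⟩, flip e (flip (f.map r) x)⟩ := by
  change substInv (loop f) (fun _ => loop e) (fun _ => lab) _ = _
  by_cases hx : x ∈ e
  · have hxf : x ∉ f.map r := fun h => by
      obtain ⟨y, _, rfl⟩ := Sym2.mem_map.1 h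
      exact label_notMem he hr y hx
    rw [flip_of_not_mem hxf]
    refine substInv_inner (loop f) (fun _ => loop e) (fun _ => lab) () ⟨(), x⟩ fun h => ?_
    refine (flip_eq_iff he x).1 ?_ hx
    simpa [Sigma.ext_iff] using h
  · obtain ⟨y, rfl⟩ : ∃ y, r y = x :=
      ⟨lab ⟨⟨(), x⟩, by simp [flip_of_not_mem hx]⟩, hr _⟩
    rw [flip_map (label_injective hr), flip_of_not_mem (label_notMem he hr _),
      ← outerFlag_twoLoops hr, substInv_outer, ← outerFlag_twoLoops hr]

variable {R' : Type} [Finite R'] {f₁ : Sym2 S} {e' : Sym2 R'} {lab' : (loop f₁).Tail ≃ R'}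
  {r' : R' → S}

omit [Finite R] in
theorem disjoint_of_map_eq (he : ¬ e.IsDiag) (hr : ∀ t, r (lab t) = t.1.2) (hfr : f.map r = f₁) : ∀ x ∈ e, x ∉ f₁ := fun x hx h => by
  rw [← hfr] at h
  obtain ⟨y, _, rfl⟩ := Sym2.mem_map.1 h
  exact label_notMem he hr y hx

theorem twoLoops_inv_eq (he : ¬ e.IsDiag) (hr : ∀ t, r (lab t) = t.1.2)
    (hr' : ∀ t, r' (lab' t) = t.1.2) (hf₁ : ¬ f₁.IsDiag) (hfr : f.map r = f₁) (her : e'.map r' = e)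
    (x : S) : (twoLoops e f lab).inv ⟨⟨(), ()⟩, x⟩ = (twoLoops f₁ e' lab').inv ⟨⟨(), ()⟩, x⟩ := by
  rw [substInv_twoLoops he hr, substInv_twoLoops hf₁ hr', hfr, her,
    flip_comm (disjoint_of_map_eq he hr hfr)]

/-- The graph with two loops does not depend on the order of the insertion. -/
def twoLoopsIso (he : ¬ e.IsDiag) (hr : ∀ t, r (lab t) = t.1.2)
    (hr' : ∀ t, r' (lab' t) = t.1.2) (hf₁ : ¬ f₁.IsDiag) (hfr : f.map r = f₁) (her : e'.map r' = e) :
    Iso (twoLoops e f lab) (twoLoops f₁ e' lab') where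
  v := Equiv.refl (Σ _ : Unit, Unit)
  fl _ := Equiv.refl S
  comm x := twoLoops_inv_eq he hr hr' hf₁ hfr her x.2

theorem outerEdge_twoLoops (hr : ∀ t, r (lab t) = t.1.2) (hf : ¬ f.IsDiag) :
    (outerEdge (loop f) (fun _ => loop e) (fun _ => lab) (loopEdge f hf)).1 =
      (f.map r).map fun x => ⟨⟨(), ()⟩, x⟩ := by
  change (f.map fun x => (⟨(), x⟩ : (loop f).Flag)).map _ = _
  rw [Sym2.map_map, Sym2.map_map]
  congr 1
  funext x
  exact outerFlag_twoLoops hr x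

theorem innerEdge_twoLoops (he : ¬ e.IsDiag) :
    (innerEdge (loop f) (fun _ => loop e) (fun _ => lab) () (loopEdge e he)).1 =
      e.map fun x => ⟨⟨(), ()⟩, x⟩ := by
  change (e.map fun x => (⟨(), x⟩ : (loop e).Flag)).map _ = _
  rw [Sym2.map_map]
  rfl

/-- The exchange of the two loops changes the sign of the generator. -/
theorem map_twoLoopsDet (k : Type*) [Field k] (he : ¬ e.IsDiag) (hf : ¬ f.IsDiag) (hr : ∀ t, r (lab t) = t.1.2)
    (hr' : ∀ t, r' (lab' t) = t.1.2) (hf₁ : ¬ f₁.IsDiag) (he' : ¬ e'.IsDiag)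
    (hfr : f.map r = f₁) (her : e'.map r' = e)
    {φ : Iso (twoLoops e f lab) (twoLoops f₁ e' lab')} (hφ : ∀ x : S, φ.flag ⟨⟨(), ()⟩, x⟩ = ⟨⟨(), ()⟩, x⟩) :
    (- twoLoopsDet hf₁ he' lab' k).1 =
      ExteriorAlgebra.map (Finsupp.lmapDomain k k φ.edge) (twoLoopsDet he hf lab k).1 := by
  -- The loop inserted last on one side is the one inserted first on the other: inner and outer
  -- edges trade places, and so do the factors of the exterior product.
  have h1 : φ.edge (outerEdge _ _ _ (loopEdge f hf)) = innerEdge _ _ _ () (loopEdge f₁ hf₁) := by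
    refine Subtype.ext ?_
    rw [innerEdge_twoLoops]
    change Sym2.map _ (outerEdge _ _ _ (loopEdge f hf)).1 = _
    rw [outerEdge_twoLoops hr, hfr, Sym2.map_map]
    congr 1
    funext x
    exact hφ x
  have h2 : φ.edge (innerEdge _ _ _ () (loopEdge e he)) = outerEdge _ _ _ (loopEdge e' he') := by
    refine Subtype.ext ?_
    rw [outerEdge_twoLoops hr', her]
    change Sym2.map _ (innerEdge (loop f) (fun _ => loop e) (fun _ => lab) () (loopEdge e he)).1 = _
    rw [innerEdge_twoLoops, Sym2.map_map]
    congr 1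
    funext x
    exact hφ x
  simp only [twoLoopsDet, map_mul, ExteriorAlgebra.map_apply_ι, Finsupp.lmapDomain_apply,
    Finsupp.mapDomain_single, h1, h2]
  exact neg_eq_of_add_eq_zero_right (ExteriorAlgebra.ι_add_mul_swap _ _)

end TwoLoops

end FGraph

/-! ## Self-gluings of `𝔎`-modular operads -/

namespace FGraph

/-- A bijection of the flags as an isomorphism of loop graphs. -/
def loopIso {S T : Type} [Finite S] [Finite T] (φ : S ≃ T) (e : Sym2 S) :
    Iso (loop e) (loop (e.map φ)) where
  v := Equiv.refl Unit
  fl _ := φ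
  comm f := by
    change (⟨(), φ (flip e f.2)⟩ : (loop (e.map φ)).Flag) = ⟨(), flip (e.map φ) (φ f.2)⟩
    rw [flip_map φ.injective]

/-- A loop graph has only one edge, and the determinant does not see the direction of an edge, so no
sign can arise. -/
theorem map_loopDet (k : Type*) [Field k] {S T : Type} [Finite S] [Finite T] {e : Sym2 S}
    {e' : Sym2 T} (he : ¬ e.IsDiag) (he' : ¬ e'.IsDiag) (φ : Iso (loop e) (loop e')) :
    (loopDet e' he' k).1 =
      ExteriorAlgebra.map (Finsupp.lmapDomain k k φ.edge) (loopDet e he k).1 := by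
  simp only [loopDet, ExteriorAlgebra.map_apply_ι, Finsupp.lmapDomain_apply,
    Finsupp.mapDomain_single, loop_edge_unique _ he' (φ.edge _)]

end FGraph

namespace KModularOperad

open FGraph

variable {k : Type u} [Field k] {ε : ℤˣ} (O : KModularOperad.{u, w} k ε)

/-- The odd self-gluings of a `𝔎`-modular operad. -/
def loopGlue {g : ℕ} {i : ℤ} {S : Type} [Finite S] (e : Sym2 S) (he : ¬ e.IsDiag)
    (a : O.obj g i S) : O.obj (g + 1) (i + ε) {x : S // x ∉ e} :=
  O.comp (loop e) (loop_connected e) (fun _ => g) (fun _ => i) (loopTail e he)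
    (loop_hasGenus e he g) (loop_degree e he i ε) (loopDet e he k) fun _ => a

theorem loopGlue_map {g : ℕ} {i : ℤ} {S T : Type} [Finite S] [Finite T] (φ : S ≃ T) (e : Sym2 S)
    (he : ¬ e.IsDiag) (he' : ¬ (e.map φ).IsDiag) (χ : {x : S // x ∉ e} ≃ {y : T // y ∉ e.map φ})
    (hχ : ∀ y, (χ y).1 = φ y.1) (a : O.obj g i S) :
    O.loopGlue (e.map φ) he' (O.map φ a) = O.map χ (O.loopGlue e he a) := by
  have h := O.comp_iso (loopIso φ e) (loop_connected e) (loop_connected _) (fun _ => g) (fun _ => i)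
    ((loopTail e he).trans χ) (loopTail (e.map φ) he') (fun t t' ht => ?_) (loop_hasGenus e he g)
    (loop_hasGenus _ he' g) (loop_degree e he i ε) (loop_degree _ he' i ε) (loopDet e he k)
    (loopDet _ he' k) (map_loopDet k he he' _) (fun _ => a) (fun _ => O.map φ a) (fun _ => rfl)
  · rw [Iso.koszul_of_subsingleton (inferInstanceAs (Subsingleton Unit)), Int.negOnePow_zero, one_smul, O.comp_map] at h
    exact h
  · refine Subtype.ext ?_
    rw [Equiv.trans_apply, hχ]
    change t'.1.2 = φ t.1.2
    rw [ht]
    rfl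

/-- Compatibility with insertion, applied to one loop graph inside another. The later gluing is the
outer graph, so its edge comes first in the exterior product. -/
theorem loopGlue_loopGlue {g : ℕ} {i : ℤ} {S : Type} [Finite S] {e : Sym2 S} (he : ¬ e.IsDiag)
    {f : Sym2 {x // x ∉ e}} (hf : ¬ f.IsDiag) (a : O.obj g i S) :
    O.loopGlue f hf (O.loopGlue e he a) =
      O.comp (twoLoops e f (loopTail e he)) (twoLoops_connected _) (fun _ => g) (fun _ => i)
        ((substTail _ _ _).trans (loopTail f hf)) (twoLoops_hasGenus he hf _ g)
        (twoLoops_degree he hf _ i ε) (twoLoopsDet he hf _ k) fun _ => a := by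
  have h := O.comp_subst (loop f) (fun _ => loop e) (fun _ => loopTail e he) (loop_connected f)
    (fun _ => loop_connected e) (twoLoops_connected _) (fun _ => g) (fun _ => i) (fun _ => g + 1)
    (fun _ => i + ε) (fun _ => loop_hasGenus e he g) (fun _ => loop_degree e he i ε)
    (loopTail f hf) ((substTail _ _ _).trans (loopTail f hf)) (fun t₀ t₁ ht => ?_)
    (loop_hasGenus f hf (g + 1)) (twoLoops_hasGenus he hf _ g) (loop_degree f hf (i + ε) ε)
    (twoLoops_degree he hf _ i ε) (loopDet f hf k) (fun _ => loopDet e he k)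
    (twoLoopsDet he hf _ k) (twoLoopsDet_eq_wedge he hf _ k) (fun _ => a)
  · rw [substKoszul_twoLoops, Int.negOnePow_zero, one_smul] at h
    exact h
  · rw [Equiv.trans_apply, substTail_eq _ _ _ ht]

/-- Both orders are compositions along isomorphic two-loop graphs with opposite generators, so
equivariance under isomorphisms gives the sign. -/
theorem loopGlue_anticomm {g : ℕ} {i : ℤ} {S : Type} [Finite S] (e f : Sym2 S) (he : ¬ e.IsDiag)
    (hf : ¬ f.IsDiag) (f' : Sym2 {x : S // x ∉ e}) (e' : Sym2 {x : S // x ∉ f})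
    (hff : f'.map Subtype.val = f) (hee : e'.map Subtype.val = e) (hf' : ¬ f'.IsDiag)
    (he' : ¬ e'.IsDiag) (χ : {y : {x : S // x ∉ e} // y ∉ f'} ≃ {y : {x : S // x ∉ f} // y ∉ e'})
    (hχ : ∀ y, (χ y).1.1 = y.1.1) (a : O.obj g i S) :
    O.map χ (O.loopGlue f' hf' (O.loopGlue e he a)) =
      - O.loopGlue e' he' (O.loopGlue f hf a) := by
  have hr : ∀ t, ((loopTail e he) t).1 = t.1.2 := fun _ => rfl
  have hr' : ∀ t, ((loopTail f hf) t).1 = t.1.2 := fun _ => rfl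
  -- The label of a tail is the flag itself, so both labellings agree under the isomorphism, which
  -- is the identity on flags.
  have val : ∀ {e : Sym2 S} (he : ¬ e.IsDiag) {f : Sym2 {x // x ∉ e}} (hf : ¬ f.IsDiag)
      (t : (twoLoops e f (loopTail e he)).Tail),
      (loopTail f hf (substTail _ _ _ t)).1.1 = t.1.2 := fun he f hf t => by
    conv_rhs => rw [← outerFlag_substTail _ _ _ t]
    rfl
  rw [loopGlue_loopGlue, loopGlue_loopGlue, ← O.comp_map]
  have h := O.comp_iso (twoLoopsIso he hr hr' hf hff hee) (twoLoops_connected _)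
    (twoLoops_connected _) (fun _ => g) (fun _ => i)
    (((substTail _ _ _).trans (loopTail f' hf')).trans χ)
    ((substTail _ _ _).trans (loopTail e' he')) (fun t t' ht => ?_) (twoLoops_hasGenus he hf' _ g)
    (twoLoops_hasGenus hf he' _ g) (twoLoops_degree he hf' _ i ε) (twoLoops_degree hf he' _ i ε)
    (twoLoopsDet he hf' _ k) (- twoLoopsDet hf he' _ k)
    (map_twoLoopsDet k he hf' hr hr' hf he' hff hee fun _ => rfl) (fun _ => a) (fun _ => a)
    (fun _ => (O.map_refl a).symm)
  · rw [Iso.koszul_of_subsingleton subsingleton_sigma_unit, Int.negOnePow_zero, one_smul, map_neg] at h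
    exact h.symm
  · refine Subtype.ext (Subtype.ext ?_)
    simp only [Equiv.trans_apply]
    rw [hχ, val, val, ht]
    rfl

theorem selfGluing_isOdd : O.selfGluing.IsOdd where
  map_glue φ e he he' χ hχ a := O.loopGlue_map φ e he he' χ hχ a
  glue_glue e f he hf f' e' hff hee hf' he' χ hχ a :=
    O.loopGlue_anticomm e f he hf f' e' hff hee hf' he' χ hχ a

end KModularOperad

/-! ## Self-gluings of `𝔎`-twisted wheeled properads and PROPs -/

/-- The bijection between the complements of corresponding points. -/
def neCongr {S T : Type} (φ : S ≃ T) {s : S} {t : T} (h : φ s = t) : {x // x ≠ s} ≃ {y // y ≠ t} :=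
  φ.subtypeEquiv fun x => by rw [← h, φ.injective.ne_iff]

theorem Sigma.inl_injective {V : Type} {A B : V → Type} :
    Function.Injective fun p : Σ v, A v => (⟨p.1, Sum.inl p.2⟩ : Σ v, A v ⊕ B v) := by
  rintro ⟨v, x⟩ ⟨v', x'⟩ h
  obtain rfl : v = v' := congrArg Sigma.fst h
  simpa using h

theorem Sigma.inr_injective {V : Type} {A B : V → Type} :
    Function.Injective fun p : Σ v, B v => (⟨p.1, Sum.inr p.2⟩ : Σ v, A v ⊕ B v) := by
  rintro ⟨v, x⟩ ⟨v', x'⟩ h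
  obtain rfl : v = v' := congrArg Sigma.fst h
  simpa using h

/-! ### Directed graphs with one vertex and two loops -/

namespace DGraph

section Subst

variable (Γ₀ : DGraph) (Γ : Γ₀.V → DGraph) (labIn : ∀ v, (Γ v).TailIn ≃ Γ₀.In v)
  (labOut : ∀ v, (Γ v).TailOut ≃ Γ₀.Out v)

/-- The incoming tails of the big graph are those of `Γ₀`. -/
def substTailIn : (subst Γ₀ Γ labIn labOut).TailIn ≃ Γ₀.TailIn :=
  (Equiv.ofBijective
    (fun t : Γ₀.TailIn => (⟨⟨⟨t.1.1, ((labIn t.1.1).symm t.1.2).1.1⟩,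
        ((labIn t.1.1).symm t.1.2).1.2⟩, (FGraph.substInv_outer_eq_iff Γ₀.toFGraph
          (fun v => (Γ v).toFGraph) (substLab Γ₀ Γ labIn labOut) ⟨t.1.1, Sum.inl t.1.2⟩).2 t.2⟩ :
      (subst Γ₀ Γ labIn labOut).TailIn))
    ⟨fun t t' h => by
      have h' := congrArg (fun t : (subst Γ₀ Γ labIn labOut).TailIn =>
        (⟨t.1.1, Sum.inl t.1.2⟩ : (subst Γ₀ Γ labIn labOut).toFGraph.Flag)) h
      exact Subtype.ext (Sigma.inl_injective (FGraph.outerFlag_injective Γ₀.toFGraph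
        (fun v => (Γ v).toFGraph) (substLab Γ₀ Γ labIn labOut) (a₁ := ⟨t.1.1, Sum.inl t.1.2⟩)
        (a₂ := ⟨t'.1.1, Sum.inl t'.1.2⟩) h')), fun t => by
      obtain ⟨⟨v, x | x⟩, hx, hf⟩ := FGraph.exists_outerFlag_of_substInv_eq Γ₀.toFGraph
        (fun v => (Γ v).toFGraph) (substLab Γ₀ Γ labIn labOut) t.2
      · refine ⟨⟨⟨v, x⟩, hx⟩, Subtype.ext ?_⟩
        obtain ⟨⟨p, y⟩, hy⟩ := t
        obtain rfl : p = _ := congrArg Sigma.fst hf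
        have h2 := eq_of_heq (Sigma.mk.inj hf).2
        exact congrArg (Sigma.mk _) (Sum.inl_injective h2).symm
      -- Insertion preserves directions, so an incoming tail cannot come from an outgoing flag.
      · exact absurd (congrArg (fun f => f.2.isLeft) hf) (by simp [isLeft_outerFlag])⟩).symm

theorem outerFlag_substTailIn (t : (subst Γ₀ Γ labIn labOut).TailIn) :
    FGraph.outerFlag Γ₀.toFGraph (fun v => (Γ v).toFGraph) (substLab Γ₀ Γ labIn labOut)
      ⟨(substTailIn Γ₀ Γ labIn labOut t).1.1, Sum.inl (substTailIn Γ₀ Γ labIn labOut t).1.2⟩ =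
      ⟨t.1.1, Sum.inl t.1.2⟩ :=
  congrArg (fun t : (subst Γ₀ Γ labIn labOut).TailIn =>
    (⟨t.1.1, Sum.inl t.1.2⟩ : (subst Γ₀ Γ labIn labOut).toFGraph.Flag))
    (Equiv.apply_symm_apply (substTailIn Γ₀ Γ labIn labOut).symm t)

theorem substTailIn_eq {t₀ : Γ₀.TailIn} {t : (subst Γ₀ Γ labIn labOut).TailIn}
    (h : (⟨t.1.1, Sum.inl t.1.2⟩ : (subst Γ₀ Γ labIn labOut).toFGraph.Flag) =
      FGraph.outerFlag Γ₀.toFGraph (fun v => (Γ v).toFGraph) (substLab Γ₀ Γ labIn labOut)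
        ⟨t₀.1.1, Sum.inl t₀.1.2⟩) : substTailIn Γ₀ Γ labIn labOut t = t₀ := by
  rw [← outerFlag_substTailIn] at h
  exact Subtype.ext (Sigma.inl_injective (FGraph.outerFlag_injective _ _ _ h))

/-- The outgoing tails of the big graph are those of `Γ₀`. -/
def substTailOut : (subst Γ₀ Γ labIn labOut).TailOut ≃ Γ₀.TailOut :=
  (Equiv.ofBijective
    (fun t : Γ₀.TailOut => (⟨⟨⟨t.1.1, ((labOut t.1.1).symm t.1.2).1.1⟩,
        ((labOut t.1.1).symm t.1.2).1.2⟩, (FGraph.substInv_outer_eq_iff Γ₀.toFGraph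
          (fun v => (Γ v).toFGraph) (substLab Γ₀ Γ labIn labOut) ⟨t.1.1, Sum.inr t.1.2⟩).2 t.2⟩ :
      (subst Γ₀ Γ labIn labOut).TailOut))
    ⟨fun t t' h => by
      have h' := congrArg (fun t : (subst Γ₀ Γ labIn labOut).TailOut =>
        (⟨t.1.1, Sum.inr t.1.2⟩ : (subst Γ₀ Γ labIn labOut).toFGraph.Flag)) h
      exact Subtype.ext (Sigma.inr_injective (FGraph.outerFlag_injective Γ₀.toFGraph
        (fun v => (Γ v).toFGraph) (substLab Γ₀ Γ labIn labOut) (a₁ := ⟨t.1.1, Sum.inr t.1.2⟩)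
        (a₂ := ⟨t'.1.1, Sum.inr t'.1.2⟩) h')), fun t => by
      obtain ⟨⟨v, x | x⟩, hx, hf⟩ := FGraph.exists_outerFlag_of_substInv_eq Γ₀.toFGraph
        (fun v => (Γ v).toFGraph) (substLab Γ₀ Γ labIn labOut) t.2
      · exact absurd (congrArg (fun f => f.2.isLeft) hf) (by simp [isLeft_outerFlag])
      · refine ⟨⟨⟨v, x⟩, hx⟩, Subtype.ext ?_⟩
        obtain ⟨⟨p, y⟩, hy⟩ := t
        obtain rfl : p = _ := congrArg Sigma.fst hf
        have h2 := eq_of_heq (Sigma.mk.inj hf).2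
        exact congrArg (Sigma.mk _) (Sum.inr_injective h2).symm⟩).symm

theorem outerFlag_substTailOut (t : (subst Γ₀ Γ labIn labOut).TailOut) :
    FGraph.outerFlag Γ₀.toFGraph (fun v => (Γ v).toFGraph) (substLab Γ₀ Γ labIn labOut)
      ⟨(substTailOut Γ₀ Γ labIn labOut t).1.1, Sum.inr (substTailOut Γ₀ Γ labIn labOut t).1.2⟩ =
      ⟨t.1.1, Sum.inr t.1.2⟩ :=
  congrArg (fun t : (subst Γ₀ Γ labIn labOut).TailOut =>
    (⟨t.1.1, Sum.inr t.1.2⟩ : (subst Γ₀ Γ labIn labOut).toFGraph.Flag))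
    (Equiv.apply_symm_apply (substTailOut Γ₀ Γ labIn labOut).symm t)

theorem substTailOut_eq {t₀ : Γ₀.TailOut} {t : (subst Γ₀ Γ labIn labOut).TailOut}
    (h : (⟨t.1.1, Sum.inr t.1.2⟩ : (subst Γ₀ Γ labIn labOut).toFGraph.Flag) =
      FGraph.outerFlag Γ₀.toFGraph (fun v => (Γ v).toFGraph) (substLab Γ₀ Γ labIn labOut)
        ⟨t₀.1.1, Sum.inr t₀.1.2⟩) : substTailOut Γ₀ Γ labIn labOut t = t₀ := by
  rw [← outerFlag_substTailOut] at h
  exact Subtype.ext (Sigma.inr_injective (FGraph.outerFlag_injective _ _ _ h))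

end Subst

section Loop

variable {S T : Type} [Finite S] [Finite T]

/-- Bijections of the flags as an isomorphism of loop graphs. -/
def loopIso {S' T' : Type} [Finite S'] [Finite T'] (φ : S ≃ S') (ψ : T ≃ T') {s : S} {t : T}
    {s' : S'} {t' : T'} (hs : φ s = s') (ht : ψ t = t') : Iso (loop s t) (loop s' t') where
  v := Equiv.refl Unit
  flIn _ := φ
  flOut _ := ψ
  comm f := by
    subst hs ht
    exact (FGraph.loopIso (φ.sumCongr ψ) s(Sum.inl s, Sum.inr t)).comm f

/-- The directed graph with one vertex and two loops obtained by inserting a loop graph into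
another one. -/
abbrev twoLoops (s : S) (t : T) (s' : {x // x ≠ s}) (t' : {y // y ≠ t}) : DGraph :=
  subst (loop s' t') (fun _ => loop s t) (fun _ => loopTailIn s t) fun _ => loopTailOut s t

/-- The labelling of the tails of a loop graph by inputs and outputs. -/
abbrev loopLab (s : S) (t : T) :
    (FGraph.loop (s(Sum.inl s, Sum.inr t) : Sym2 (S ⊕ T))).Tail ≃ {x // x ≠ s} ⊕ {y // y ≠ t} :=
  (loop s t).tailSplit.trans ((loopTailIn s t).sumCongr (loopTailOut s t))

/-- This is the hypothesis `hr` of the undirected lemmas, with flags `S ⊕ T`; it reduces the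
directed two-loop graphs to the undirected ones. -/
theorem map_loopLab (s : S) (t : T) (x : (FGraph.loop (s(Sum.inl s, Sum.inr t) : Sym2 (S ⊕ T))).Tail) :
    Sum.map Subtype.val Subtype.val (loopLab s t x) = x.1.2 := by
  obtain ⟨⟨_, x | x⟩, hx⟩ := x <;> rfl

/-- The graph with two loops does not depend on the order of the insertion. -/
def twoLoopsIso {s : S} {t : T} {s' : {x // x ≠ s}} {t' : {y // y ≠ t}} {s₁ : S} {t₁ : T}
    {s₁' : {x // x ≠ s₁}} {t₁' : {y // y ≠ t₁}} (hs : s'.1 = s₁) (ht : t'.1 = t₁)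
    (hs' : s₁'.1 = s) (ht' : t₁'.1 = t) : Iso (twoLoops s t s' t') (twoLoops s₁ t₁ s₁' t₁') where
  v := Equiv.refl (Σ _ : Unit, Unit)
  flIn _ := Equiv.refl S
  flOut _ := Equiv.refl T
  comm f := by
    obtain ⟨⟨⟨⟩, ⟨⟩⟩, x⟩ := f
    have h := FGraph.twoLoops_inv_eq (loop_pair_ne s t) (map_loopLab s t) (map_loopLab s₁ t₁)
      (loop_pair_ne s₁ t₁) (f := s(Sum.inl s', Sum.inr t')) (e' := s(Sum.inl s₁', Sum.inr t₁'))
      (by simp [hs, ht]) (by simp [hs', ht']) x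
    simp only [Equiv.sumCongr_refl]
    exact h

theorem twoLoops_degree (s : S) (t : T) (s' : {x // x ≠ s}) (t' : {y // y ≠ t}) (i : ℤ)
    (ε : ℤˣ) : ∑ _v : (twoLoops s t s' t').V, i +
      (ε : ℤ) * Nat.card (twoLoops s t s' t').toFGraph.Edge = i + ε + ε :=
  FGraph.twoLoops_degree (loop_pair_ne s t) (loop_pair_ne s' t') (loopLab s t) i ε

/-- The generator of `Det(Edge)` of the directed graph with two loops. -/
def twoLoopsDet (s : S) (t : T) (s' : {x // x ≠ s}) (t' : {y // y ≠ t}) (k : Type*) [Field k] :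
    (twoLoops s t s' t').toFGraph.Det k :=
  FGraph.twoLoopsDet (loop_pair_ne s t) (loop_pair_ne s' t') (loopLab s t) k

theorem substKoszul_twoLoops (s : S) (t : T) (s' : {x // x ≠ s}) (t' : {y // y ≠ t})
    (d : (twoLoops s t s' t').V → ℤ) :
    FGraph.substKoszul (loop s' t').toFGraph (fun _ => (loop s t).toFGraph)
      (substLab (loop s' t') (fun _ => loop s t) (fun _ => loopTailIn s t)
        fun _ => loopTailOut s t) d = 0 :=
  FGraph.substKoszul_twoLoops (f := s(Sum.inl s', Sum.inr t')) (loopLab s t) d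

end Loop

end DGraph

/-! ### Equivariance and anticommutation of the wheeled self-gluings -/

namespace KWheeled

open DGraph

variable {k : Type u} [Field k] {ε : ℤˣ} {κ : WheeledKind} (O : KWheeled.{u, w} k ε κ)

theorem loop_allows {S T : Type} [Finite S] [Finite T] (s : S) (t : T) : κ.Allows (loop s t) :=
  κ.allows_of_connected (FGraph.loop_connected (s(Sum.inl s, Sum.inr t) : Sym2 (S ⊕ T)))

theorem twoLoops_allows {S T : Type} [Finite S] [Finite T] (s : S) (t : T) (s' : {x // x ≠ s})
    (t' : {y // y ≠ t}) : κ.Allows (twoLoops s t s' t') :=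
  κ.allows_of_connected (FGraph.twoLoops_connected (loopLab s t))

theorem glue_map {i : ℤ} {S T S' T' : Type} [Finite S] [Finite T] [Finite S'] [Finite T']
    (φ : S ≃ S') (ψ : T ≃ T') {s : S} {t : T} {s' : S'} {t' : T'} (hs : φ s = s') (ht : ψ t = t')
    (a : O.obj i S T) :
    O.glue s' t' (O.map φ ψ a) = O.map (neCongr φ hs) (neCongr ψ ht) (O.glue s t a) := by
  have h := O.comp_iso (loopIso φ ψ hs ht) (loop_allows s t) (loop_allows s' t') (fun _ => i)
    ((loopTailIn s t).trans (neCongr φ hs)) ((loopTailOut s t).trans (neCongr ψ ht))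
    (loopTailIn s' t') (loopTailOut s' t') (fun x x' hx => ?_) (fun x x' hx => ?_)
    (loop_degree s t i ε) (loop_degree s' t' i ε) (FGraph.loopDet _ (loop_pair_ne s t) k)
    (FGraph.loopDet _ (loop_pair_ne s' t') k)
    (FGraph.map_loopDet k (loop_pair_ne s t) (loop_pair_ne s' t') _) (fun _ => a)
    (fun _ => O.map φ ψ a) (fun _ => rfl)
  · rw [FGraph.Iso.koszul_of_subsingleton (inferInstanceAs (Subsingleton Unit)),
      Int.negOnePow_zero, one_smul, O.comp_map] at h
    exact h
  · refine Subtype.ext ?_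
    change x'.1.2 = φ x.1.2
    rw [hx]
    rfl
  · refine Subtype.ext ?_
    change x'.1.2 = ψ x.1.2
    rw [hx]
    rfl

/-- Compatibility with insertion again. The two-loop graph is connected, so it is admissible for
properads as well as for PROPs. -/
theorem glue_glue_apply {i : ℤ} {S T : Type} [Finite S] [Finite T] (s : S) (t : T)
    (s' : {x // x ≠ s}) (t' : {y // y ≠ t}) (a : O.obj i S T) :
    O.glue s' t' (O.glue s t a) =
      O.comp (twoLoops s t s' t') (twoLoops_allows s t s' t') (fun _ => i)
        ((substTailIn _ _ _ _).trans (loopTailIn s' t'))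
        ((substTailOut _ _ _ _).trans (loopTailOut s' t'))
        (twoLoops_degree s t s' t' i ε)
        (twoLoopsDet s t s' t' k) fun _ => a := by
  have h := O.comp_subst (loop s' t') (fun _ => loop s t) (fun _ => loopTailIn s t)
    (fun _ => loopTailOut s t) (loop_allows s' t') (fun _ => loop_allows s t)
    (twoLoops_allows s t s' t') (fun _ => i) (fun _ => i + ε) (fun _ => loop_degree s t i ε)
    (loopTailIn s' t') (loopTailOut s' t') ((substTailIn _ _ _ _).trans (loopTailIn s' t'))
    ((substTailOut _ _ _ _).trans (loopTailOut s' t')) (fun t₀ t₁ ht => ?_) (fun t₀ t₁ ht => ?_)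
    (loop_degree s' t' (i + ε) ε)
    (twoLoops_degree s t s' t' i ε)
    (FGraph.loopDet _ (loop_pair_ne s' t') k) (fun _ => FGraph.loopDet _ (loop_pair_ne s t) k)
    (twoLoopsDet s t s' t' k)
    (FGraph.twoLoopsDet_eq_wedge (loop_pair_ne s t) (loop_pair_ne s' t') (loopLab s t) k)
    (fun _ => a)
  · rw [substKoszul_twoLoops, Int.negOnePow_zero, one_smul] at h
    exact h
  · rw [Equiv.trans_apply, substTailIn_eq _ _ _ _ ht]
  · rw [Equiv.trans_apply, substTailOut_eq _ _ _ _ ht]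

theorem val_substTailIn {S T : Type} [Finite S] [Finite T] {s : S} {t : T} {s' : {x // x ≠ s}}
    {t' : {y // y ≠ t}} (x : (twoLoops s t s' t').TailIn) :
    (loopTailIn s' t' (substTailIn _ _ _ _ x)).1.1 = x.1.2 := by
  have h := congrArg (fun f : (Σ _ : (Σ _ : Unit, Unit), S ⊕ T) => f.2)
    (outerFlag_substTailIn _ _ _ _ x)
  exact Sum.inl_injective h

theorem val_substTailOut {S T : Type} [Finite S] [Finite T] {s : S} {t : T} {s' : {x // x ≠ s}}
    {t' : {y // y ≠ t}} (x : (twoLoops s t s' t').TailOut) :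
    (loopTailOut s' t' (substTailOut _ _ _ _ x)).1.1 = x.1.2 := by
  have h := congrArg (fun f : (Σ _ : (Σ _ : Unit, Unit), S ⊕ T) => f.2)
    (outerFlag_substTailOut _ _ _ _ x)
  exact Sum.inr_injective h

/-- The odd self-gluings anticommute. -/
theorem map_glue_glue {i : ℤ} {S T S' T' : Type} [Finite S] [Finite T] [Finite S'] [Finite T']
    {s : S} {t : T} {s' : {x // x ≠ s}} {t' : {y // y ≠ t}} {s₁ : S} {t₁ : T}
    {s₁' : {x // x ≠ s₁}} {t₁' : {y // y ≠ t₁}} (hs : s'.1 = s₁) (ht : t'.1 = t₁)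
    (hs' : s₁'.1 = s) (ht' : t₁'.1 = t) (φ : {x // x ≠ s'} ≃ S') (ψ : {y // y ≠ t'} ≃ T')
    (φ₁ : {x // x ≠ s₁'} ≃ S') (ψ₁ : {y // y ≠ t₁'} ≃ T')
    (hφ : ∀ x y, x.1.1 = y.1.1 → φ x = φ₁ y) (hψ : ∀ x y, x.1.1 = y.1.1 → ψ x = ψ₁ y)
    (a : O.obj i S T) :
    O.map φ ψ (O.glue s' t' (O.glue s t a)) = - O.map φ₁ ψ₁ (O.glue s₁' t₁' (O.glue s₁ t₁ a)) := by
  rw [glue_glue_apply, glue_glue_apply, ← O.comp_map, ← O.comp_map]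
  -- The sign is that of the underlying undirected graphs.
  have hd := FGraph.map_twoLoopsDet k (loop_pair_ne s t) (loop_pair_ne s' t') (map_loopLab s t)
    (map_loopLab s₁ t₁) (loop_pair_ne s₁ t₁) (loop_pair_ne s₁' t₁') (by simp [hs, ht])
    (by simp [hs', ht']) (φ := (twoLoopsIso hs ht hs' ht').toFGraph) (by rintro (x | x) <;> rfl)
  have h := O.comp_iso (twoLoopsIso hs ht hs' ht') (twoLoops_allows s t s' t')
    (twoLoops_allows s₁ t₁ s₁' t₁') (fun _ => i)
    (((substTailIn _ _ _ _).trans (loopTailIn s' t')).trans φ)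
    (((substTailOut _ _ _ _).trans (loopTailOut s' t')).trans ψ)
    (((substTailIn _ _ _ _).trans (loopTailIn s₁' t₁')).trans φ₁)
    (((substTailOut _ _ _ _).trans (loopTailOut s₁' t₁')).trans ψ₁)
    (fun x x' hx => ?_) (fun x x' hx => ?_)
    (twoLoops_degree s t s' t' i ε)
    (twoLoops_degree s₁ t₁ s₁' t₁' i ε)
    (twoLoopsDet s t s' t' k)
    (- twoLoopsDet s₁ t₁ s₁' t₁' k)
    hd (fun _ => a) (fun _ => a) (fun _ => (O.map_refl a).symm)
  · rw [FGraph.Iso.koszul_of_subsingleton FGraph.subsingleton_sigma_unit, Int.negOnePow_zero,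
      one_smul, map_neg] at h
    exact h.symm
  · simp only [Equiv.trans_apply]
    refine (hφ _ _ ?_).symm
    rw [val_substTailIn, val_substTailIn, hx]
    rfl
  · simp only [Equiv.trans_apply]
    refine (hψ _ _ ?_).symm
    rw [val_substTailOut, val_substTailOut, hx]
    rfl

end KWheeled

theorem finSuccAboveEquiv_symm_strictMono {n : ℕ} (s : Fin (n + 1)) :
    StrictMono (finSuccAboveEquiv s).symm :=
  (finSuccAboveOrderIso s).symm.strictMono

/-! ### The operator Δ for wheeled properads and PROPs -/

namespace KWheeled

variable {k : Type u} [Field k] {ε : ℤˣ} {κ : WheeledKind} {O : KWheeled.{u, w} k ε κ}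

theorem bullet_bullet {i : ℤ} {U W : Type} {A A₁ A₃ : Finset U} {B B₁ B₃ : Finset W} {s s' : U}
    {t t' : W} (h₁ : PointOff A s' A₁) (k₁ : PointOff B t' B₁) (h₂ : PointOff A₁ s A₃)
    (k₂ : PointOff B₁ t B₃) (a : O.obj i A B) :
    O.bullet h₂ k₂ (O.bullet h₁ k₁ a) =
      O.map ((neCongr h₁.complEquiv (h₁.complEquiv.apply_symm_apply ⟨s, h₂.mem⟩)).trans
          h₂.complEquiv)
        ((neCongr k₁.complEquiv (k₁.complEquiv.apply_symm_apply ⟨t, k₂.mem⟩)).trans k₂.complEquiv)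
        (O.glue (h₁.complEquiv.symm ⟨s, h₂.mem⟩) (k₁.complEquiv.symm ⟨t, k₂.mem⟩)
          (O.glue ⟨s', h₁.mem⟩ ⟨t', k₁.mem⟩ a)) := by
  simp only [bullet, LinearMap.comp_apply]
  rw [O.glue_map h₁.complEquiv k₁.complEquiv (h₁.complEquiv.apply_symm_apply ⟨s, h₂.mem⟩)
    (k₁.complEquiv.apply_symm_apply ⟨t, k₂.mem⟩), O.map_trans]

theorem bullet_anticomm {i : ℤ} {U W : Type} {A A₁ A₂ A₃ : Finset U} {B B₁ B₂ B₃ : Finset W}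
    {s s' : U} {t t' : W} (h₁ : PointOff A s' A₁) (k₁ : PointOff B t' B₁) (h₂ : PointOff A₁ s A₃)
    (k₂ : PointOff B₁ t B₃) (h₃ : PointOff A s A₂) (k₃ : PointOff B t B₂) (h₄ : PointOff A₂ s' A₃)
    (k₄ : PointOff B₂ t' B₃) (a : O.obj i A B) :
    O.bullet h₂ k₂ (O.bullet h₁ k₁ a) = - O.bullet h₄ k₄ (O.bullet h₃ k₃ a) := by
  rw [bullet_bullet, bullet_bullet]
  exact O.map_glue_glue rfl rfl rfl rfl _ _ _ _
    (fun x y h => Subtype.ext (show x.1.1.1 = y.1.1.1 from congrArg (fun z => z.1) h))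
    (fun x y h => Subtype.ext (show x.1.1.1 = y.1.1.1 from congrArg (fun z => z.1) h)) a

open Classical in
theorem delta_lof {U W : Type} [DecidableEq (ℤ × Finset U × Finset W)] (i : ℤ) (A : Finset U)
    (B : Finset W) (a : O.obj i A B) :
    O.delta U W (DirectSum.lof k _ (fun p : ℤ × Finset U × Finset W => O.obj p.1 p.2.1 p.2.2)
        (i, A, B) a) =
      ∑ s ∈ A.attach, ∑ t ∈ B.attach,
        DirectSum.lof k _ (fun p : ℤ × Finset U × Finset W => O.obj p.1 p.2.1 p.2.2)
          (i + ε, A.erase s.1, B.erase t.1)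
          (O.bullet (pointOff_erase s.2) (pointOff_erase t.2) a) := by
  unfold delta
  rw [DirectSum.toModule_lof_of_decidableEq, LinearMap.sum_apply]
  refine Finset.sum_congr rfl fun s _ => ?_
  rw [LinearMap.sum_apply]
  refine Finset.sum_congr rfl fun t _ => ?_
  rw [LinearMap.comp_apply]
  congr!

theorem deltaBiased_lof (i : ℤ) (n m : ℕ) (a : O.obj i (Fin n) (Fin m)) :
    O.deltaBiased (DirectSum.lof k (ℤ × ℕ × ℕ) (fun p => O.biased.M p) (i, n, m) a) =
      O.deltaBiasedAux i n m a :=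
  DirectSum.toModule_lof _ _ _

open Classical in
theorem toCoinv_lof {U W : Type} [DecidableEq (ℤ × Finset U × Finset W)] (i : ℤ) (A : Finset U)
    (B : Finset W) (a : O.obj i A B) :
    O.toCoinv U W (DirectSum.lof k _ (fun p : ℤ × Finset U × Finset W => O.obj p.1 p.2.1 p.2.2)
        (i, A, B) a) =
      O.biased.proj (fun _ => ⊤) (DirectSum.lof k (ℤ × ℕ × ℕ) (fun p => O.biased.M p)
        (i, A.card, B.card) (O.map A.equivFin B.equivFin a)) := by
  unfold toCoinv
  rw [DirectSum.toModule_lof_of_decidableEq]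
  rfl

open Classical in
-- The involution exchanges the first chosen input and output with the second ones; it has no fixed
-- points because the second input differs from the first.
theorem delta_sq (U W : Type) : O.delta U W ∘ₗ O.delta U W = 0 := by
  refine DirectSum.linearMap_ext _ fun p => LinearMap.ext fun a => ?_
  obtain ⟨i, A, B⟩ := p
  simp only [LinearMap.comp_apply, LinearMap.zero_apply]
  rw [delta_lof, ← Finset.sum_product', map_sum,
    Finset.sum_congr rfl fun e _ => (delta_lof _ _ _ _).trans (Finset.sum_product' _ _ _).symm,
    Finset.sum_sigma']
  refine Finset.sum_involution
    (fun q _ => ⟨(⟨q.2.1.1, Finset.mem_of_mem_erase q.2.1.2⟩, ⟨q.2.2.1, Finset.mem_of_mem_erase q.2.2.2⟩),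
      (⟨q.1.1.1, Finset.mem_erase.2 ⟨(Finset.ne_of_mem_erase q.2.1.2).symm, q.1.1.2⟩⟩,
        ⟨q.1.2.1, Finset.mem_erase.2 ⟨(Finset.ne_of_mem_erase q.2.2.2).symm, q.1.2.2⟩⟩)⟩)
    (fun q _ => ?_) (fun q _ _ h => ?_) (fun q _ => by simp) (fun q _ => rfl)
  · obtain ⟨⟨⟨s, hs⟩, ⟨t, ht⟩⟩, ⟨⟨s', hs'⟩, ⟨t', ht'⟩⟩⟩ := q
    have key : ∀ {C C' : Finset U} {D D' : Finset W} (_ : C = C') (_ : D = D')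
        (h₂ : PointOff (A.erase s) s' C) (k₂ : PointOff (B.erase t) t' D)
        (h₄ : PointOff (A.erase s') s C') (k₄ : PointOff (B.erase t') t D'),
        DirectSum.lof k _ (fun p : ℤ × Finset U × Finset W => O.obj p.1 p.2.1 p.2.2)
            (i + ε + ε, C, D)
            (O.bullet h₂ k₂ (O.bullet (pointOff_erase hs) (pointOff_erase ht) a)) +
          DirectSum.lof k _ (fun p : ℤ × Finset U × Finset W => O.obj p.1 p.2.1 p.2.2)
            (i + ε + ε, C', D')
            (O.bullet h₄ k₄ (O.bullet (pointOff_erase (Finset.mem_of_mem_erase hs'))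
              (pointOff_erase (Finset.mem_of_mem_erase ht')) a)) = 0 := by
      intro C C' D D' hC hD h₂ k₂ h₄ k₄
      subst hC hD
      rw [bullet_anticomm _ _ h₂ k₂ (pointOff_erase (Finset.mem_of_mem_erase hs'))
        (pointOff_erase (Finset.mem_of_mem_erase ht')) h₄ k₄, map_neg, neg_add_cancel]
    convert key Finset.erase_right_comm Finset.erase_right_comm (pointOff_erase hs')
      (pointOff_erase ht')
      (pointOff_erase (Finset.mem_erase.2 ⟨(Finset.ne_of_mem_erase hs').symm, hs⟩))
      (pointOff_erase (Finset.mem_erase.2 ⟨(Finset.ne_of_mem_erase ht').symm, ht⟩))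
  · exact Finset.ne_of_mem_erase q.2.1.2 (congrArg (fun q => q.1.1.1) h)

/-- The sum `Δ(φ(a))` over the pairs of `Fin (n + 1)` and `Fin (m + 1)`, as a sum over the pairs of
`S` and `T`. -/
theorem deltaBiasedAux_map {i : ℤ} {S T : Type} [Fintype S] [Fintype T] {n m : ℕ}
    (φ : S ≃ Fin (n + 1)) (ψ : T ≃ Fin (m + 1)) (a : O.obj i S T) :
    O.deltaBiasedAux i (n + 1) (m + 1) (O.map φ ψ a) = ∑ s : S, ∑ t : T,
      DirectSum.lof k (ℤ × ℕ × ℕ) (fun p => O.biased.M p) (i + ε, n, m)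
        (O.map ((neCongr φ rfl).trans (finSuccAboveEquiv (φ s)).symm)
          ((neCongr ψ rfl).trans (finSuccAboveEquiv (ψ t)).symm) (O.glue s t a)) := by
  simp only [deltaBiasedAux, LinearMap.sum_apply, LinearMap.comp_apply]
  refine (Fintype.sum_equiv φ _ _ fun s => Fintype.sum_equiv ψ _ _ fun t => ?_).symm
  rw [O.map_trans, O.glue_map φ ψ rfl rfl]

theorem lof_map_of_strictMono {i : ℤ} {S T : Type} [Finite S] [Finite T] [LinearOrder S]
    [LinearOrder T] {n n' m m' : ℕ} {φ : S ≃ Fin n} {φ' : S ≃ Fin n'} {ψ : T ≃ Fin m}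
    {ψ' : T ≃ Fin m'} (hφ : StrictMono φ) (hφ' : StrictMono φ') (hψ : StrictMono ψ)
    (hψ' : StrictMono ψ') (a : O.obj i S T) :
    DirectSum.lof k (ℤ × ℕ × ℕ) (fun p => O.biased.M p) (i, n, m) (O.map φ ψ a) =
      DirectSum.lof k (ℤ × ℕ × ℕ) (fun p => O.biased.M p) (i, n', m') (O.map φ' ψ' a) := by
  obtain rfl : n = n' := by simpa using Fintype.card_congr (φ.symm.trans φ')
  obtain rfl : m = m' := by simpa using Fintype.card_congr (ψ.symm.trans ψ')
  rw [Equiv.eq_of_strictMono hφ hφ', Equiv.eq_of_strictMono hψ hψ']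

theorem proj_lof_map (H : ∀ p, Subgroup (O.biased.G p)) {i : ℤ} {S T : Type} [Finite S] [Finite T]
    {n m : ℕ} {φ φ' : S ≃ Fin n} {ψ ψ' : T ≃ Fin m}
    (h : ∃ j ∈ H (i, n, m), φ' = φ.trans j.1 ∧ ψ' = ψ.trans j.2) (a : O.obj i S T) :
    O.biased.proj H (DirectSum.lof k (ℤ × ℕ × ℕ) (fun p => O.biased.M p) (i, n, m)
        (O.map φ' ψ' a)) =
      O.biased.proj H (DirectSum.lof k (ℤ × ℕ × ℕ) (fun p => O.biased.M p) (i, n, m)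
        (O.map φ ψ a)) := by
  obtain ⟨j, hj, rfl, rfl⟩ := h
  rw [O.map_trans]
  exact O.biased.proj_lof_ρ H (i, n, m) j hj (O.map φ ψ a)

theorem proj_top_lof_map {i : ℤ} {S T : Type} [Finite S] [Finite T] {n n' m m' : ℕ} (φ : S ≃ Fin n)
    (φ' : S ≃ Fin n') (ψ : T ≃ Fin m) (ψ' : T ≃ Fin m') (a : O.obj i S T) :
    O.biased.proj (fun _ => ⊤) (DirectSum.lof k (ℤ × ℕ × ℕ) (fun p => O.biased.M p) (i, n, m)
        (O.map φ ψ a)) =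
      O.biased.proj (fun _ => ⊤) (DirectSum.lof k (ℤ × ℕ × ℕ) (fun p => O.biased.M p) (i, n', m')
        (O.map φ' ψ' a)) := by
  obtain rfl : n = n' := by simpa using Fintype.card_congr (φ.symm.trans φ')
  obtain rfl : m = m' := by simpa using Fintype.card_congr (ψ.symm.trans ψ')
  refine proj_lof_map (fun _ => ⊤)
    ⟨(φ'.symm.trans φ, ψ'.symm.trans ψ), Subgroup.mem_top _, ?_, ?_⟩ a <;> ext <;> simp

variable (O) in
open Classical in
/-- The order-preserving renumbering of finite subsets of totally ordered sets. -/
def compress (U W : Type) [LinearOrder U] [LinearOrder W] : O.TotIn U W →ₗ[k] O.biased.Tot :=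
  DirectSum.toModule k _ _ fun p =>
    DirectSum.lof k (ℤ × ℕ × ℕ) (fun p => O.biased.M p) (p.1, p.2.1.card, p.2.2.card) ∘ₗ
      O.map (p.2.1.orderIsoOfFin rfl).symm.toEquiv (p.2.2.orderIsoOfFin rfl).symm.toEquiv

theorem compress_lof {U W : Type} [LinearOrder U] [LinearOrder W]
    [DecidableEq (ℤ × Finset U × Finset W)] (i : ℤ) (A : Finset U) (B : Finset W)
    (a : O.obj i A B) :
    O.compress U W (DirectSum.lof k _ (fun p : ℤ × Finset U × Finset W => O.obj p.1 p.2.1 p.2.2)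
        (i, A, B) a) =
      DirectSum.lof k (ℤ × ℕ × ℕ) (fun p => O.biased.M p) (i, A.card, B.card)
        (O.map (A.orderIsoOfFin rfl).symm.toEquiv (B.orderIsoOfFin rfl).symm.toEquiv a) := by
  unfold compress
  rw [DirectSum.toModule_lof_of_decidableEq]
  rfl

/-- Inputs and outputs are compared separately: on each side, closing the gap after an increasing
numbering is the increasing numbering of the complement. -/
theorem deltaBiasedAux_orderIso {i : ℤ} {U W : Type} [LinearOrder U] [LinearOrder W]
    {A : Finset U} {B : Finset W} {n m : ℕ} (h : A.card = n) (h' : B.card = m)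
    {A' : A → Finset U} {B' : B → Finset W} (hA : ∀ s : A, PointOff A s.1 (A' s))
    (hB : ∀ t : B, PointOff B t.1 (B' t)) (a : O.obj i A B) :
    O.deltaBiasedAux i n m
        (O.map (A.orderIsoOfFin h).symm.toEquiv (B.orderIsoOfFin h').symm.toEquiv a) =
      ∑ s ∈ A.attach, ∑ t ∈ B.attach,
        DirectSum.lof k (ℤ × ℕ × ℕ) (fun p => O.biased.M p) (i + ε, (A' s).card, (B' t).card)
          (O.map ((A' s).orderIsoOfFin rfl).symm.toEquiv ((B' t).orderIsoOfFin rfl).symm.toEquiv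
            (O.bullet (hA s) (hB t) a)) := by
  rcases n with _ | n
  · obtain rfl := Finset.card_eq_zero.1 h
    rfl
  rcases m with _ | m
  · obtain rfl := Finset.card_eq_zero.1 h'
    simp [deltaBiasedAux]
  rw [deltaBiasedAux_map, Finset.univ_eq_attach, Finset.univ_eq_attach]
  refine Finset.sum_congr rfl fun s _ => Finset.sum_congr rfl fun t _ => ?_
  simp only [bullet, LinearMap.comp_apply]
  rw [← O.map_trans]
  refine lof_map_of_strictMono ?_ ?_ ?_ ?_ _
  · exact fun x y hxy => finSuccAboveEquiv_symm_strictMono _ ((A.orderIsoOfFin h).symm.strictMono hxy)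
  · exact fun x y hxy => (OrderIso.strictMono _) hxy
  · exact fun x y hxy => finSuccAboveEquiv_symm_strictMono _ ((B.orderIsoOfFin h').symm.strictMono hxy)
  · exact fun x y hxy => (OrderIso.strictMono _) hxy

theorem deltaBiased_comp_compress (U W : Type) [LinearOrder U] [LinearOrder W] :
    O.deltaBiased ∘ₗ O.compress U W = O.compress U W ∘ₗ O.delta U W := by
  refine DirectSum.linearMap_ext _ fun p => LinearMap.ext fun a => ?_
  obtain ⟨i, A, B⟩ := p
  simp only [LinearMap.comp_apply]
  rw [compress_lof, deltaBiased_lof, delta_lof, map_sum, Finset.sum_congr rfl fun s _ =>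
    (map_sum _ _ _).trans (Finset.sum_congr rfl fun t _ => compress_lof _ _ _ _)]
  exact deltaBiasedAux_orderIso rfl rfl (fun s => pointOff_erase s.2)
    (fun t => pointOff_erase t.2) a

theorem compress_surjective (U W : Type) [LinearOrder U] [LinearOrder W] [Infinite U] [Infinite W] :
    Function.Surjective (O.compress U W) := by
  rw [← LinearMap.range_eq_top, eq_top_iff]
  rintro x -
  induction x using DirectSum.induction_on with
  | zero => exact zero_mem _
  | add x y hx hy => exact add_mem hx hy
  | of p x =>
    obtain ⟨i, n, m⟩ := p
    obtain ⟨A, rfl⟩ := Infinite.exists_subset_card_eq U n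
    obtain ⟨B, rfl⟩ := Infinite.exists_subset_card_eq W m
    refine ⟨DirectSum.lof k _ (fun p : ℤ × Finset U × Finset W => O.obj p.1 p.2.1 p.2.2) (i, A, B)
      (O.map (A.orderIsoOfFin rfl).toEquiv (B.orderIsoOfFin rfl).toEquiv x), ?_⟩
    rw [compress_lof, ← O.map_trans]
    have hA : (A.orderIsoOfFin rfl).toEquiv.trans (A.orderIsoOfFin rfl).symm.toEquiv =
      Equiv.refl _ := by ext; simp
    have hB : (B.orderIsoOfFin rfl).toEquiv.trans (B.orderIsoOfFin rfl).symm.toEquiv =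
      Equiv.refl _ := by ext; simp
    rw [hA, hB, O.map_refl]
    rfl

theorem deltaBiased_sq : O.deltaBiased ∘ₗ O.deltaBiased = 0 := by
  rw [← LinearMap.cancel_right (compress_surjective (O := O) ℕ ℕ), LinearMap.comp_assoc,
    deltaBiased_comp_compress, ← LinearMap.comp_assoc, deltaBiased_comp_compress,
    LinearMap.comp_assoc, delta_sq, LinearMap.comp_zero, LinearMap.zero_comp]

theorem proj_comp_compress (U W : Type) [LinearOrder U] [LinearOrder W] :
    O.biased.proj (fun _ => ⊤) ∘ₗ O.compress U W = O.toCoinv U W := by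
  refine DirectSum.linearMap_ext _ fun p => LinearMap.ext fun a => ?_
  obtain ⟨i, A, B⟩ := p
  simp only [LinearMap.comp_apply]
  rw [compress_lof, toCoinv_lof]
  exact proj_top_lof_map _ _ _ _ a

/-- To compare `Δ(σ(a))` and `Δ(a)` modulo the action it is enough to compare the renumberings of the
complements of all points. -/
theorem proj_deltaBiasedAux_map (H : ∀ p, Subgroup (O.biased.G p)) {i : ℤ} {n m : ℕ}
    (σ : Equiv.Perm (Fin n)) (τ : Equiv.Perm (Fin m))
    (hστ : ∀ n' m' (s : Fin n) (t : Fin m) (φ φ' : {x // x ≠ s} ≃ Fin n')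
      (ψ ψ' : {y // y ≠ t} ≃ Fin m'), StrictMono φ → (∀ x y, σ x.1 < σ y.1 → φ' x < φ' y) →
      StrictMono ψ → (∀ x y, τ x.1 < τ y.1 → ψ' x < ψ' y) →
      ∃ j ∈ H (i + ε, n', m'), φ' = φ.trans j.1 ∧ ψ' = ψ.trans j.2)
    (a : O.obj i (Fin n) (Fin m)) :
    O.biased.proj H (O.deltaBiasedAux i n m (O.map σ τ a)) =
      O.biased.proj H (O.deltaBiasedAux i n m a) := by
  rcases n with _ | n
  · rfl
  rcases m with _ | m
  · rfl
  conv_rhs => rw [← O.map_refl a]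
  rw [deltaBiasedAux_map, deltaBiasedAux_map, map_sum, map_sum]
  refine Finset.sum_congr rfl fun s _ => ?_
  rw [map_sum, map_sum]
  refine Finset.sum_congr rfl fun t _ => proj_lof_map H (hστ n m s t _ _ _ _ ?_ ?_ ?_ ?_) _
  · exact fun x y hxy => finSuccAboveEquiv_symm_strictMono s hxy
  · exact fun x y hxy => finSuccAboveEquiv_symm_strictMono (σ s) hxy
  · exact fun x y hxy => finSuccAboveEquiv_symm_strictMono t hxy
  · exact fun x y hxy => finSuccAboveEquiv_symm_strictMono (τ t) hxy

instance (p : O.biased.P) : Finite (O.cyc p) :=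
  inferInstanceAs (Finite (_ : Subgroup (Equiv.Perm (Fin p.2.1) × Equiv.Perm (Fin p.2.2))))

/-- A product of two cyclic groups is generated by the rotations of its factors, which are tested
one at a time. On the factor that is not rotated both renumberings are increasing, hence equal. -/
theorem cyc_le_invariance (p : O.biased.P) :
    O.cyc p ≤ (O.biased.ρ p).invariance (O.biased.proj O.cyc ∘ₗ O.deltaBiased ∘ₗ
      DirectSum.lof k (ℤ × ℕ × ℕ) (fun p => O.biased.M p) p) := by
  obtain ⟨i, n, m⟩ := p
  refine Subgroup.prod_le_iff.2 ⟨?_, ?_⟩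
  · rw [MonoidHom.map_zpowers, Subgroup.zpowers_le]
    intro a
    simp only [LinearMap.comp_apply]
    rw [deltaBiased_lof, deltaBiased_lof]
    refine proj_deltaBiasedAux_map _ (finRotate n) 1
      (fun n' m' s t φ φ' ψ ψ' h₁ h₂ h₃ h₄ => ?_) a
    obtain ⟨j, hj, hj'⟩ := exists_rotation h₁ h₂
    exact ⟨(j, 1), ⟨hj, one_mem _⟩, hj', Equiv.eq_of_strictMono (fun x y hxy => h₄ x y hxy) h₃⟩
  · rw [MonoidHom.map_zpowers, Subgroup.zpowers_le]
    intro a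
    simp only [LinearMap.comp_apply]
    rw [deltaBiased_lof, deltaBiased_lof]
    refine proj_deltaBiasedAux_map _ 1 (finRotate m)
      (fun n' m' s t φ φ' ψ ψ' h₁ h₂ h₃ h₄ => ?_) a
    obtain ⟨j, hj, hj'⟩ := exists_rotation h₃ h₄
    exact ⟨(1, j), ⟨one_mem _, hj⟩, Equiv.eq_of_strictMono (fun x y hxy => h₂ x y hxy) h₁, hj'⟩

theorem hasDifferential (O : KWheeled.{u, w} k ε κ) : O.HasDifferential where
  anticomm h₁ k₁ h₂ k₂ h₃ k₃ h₄ k₄ _ a := bullet_anticomm h₁ k₁ h₂ k₂ h₃ k₃ h₄ k₄ a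
  delta_sq := delta_sq
  biased_sq := deltaBiased_sq
  coinv := by
    obtain ⟨D, hD⟩ := O.biased.exists_inducesDifferential O.deltaBiased deltaBiased_sq O.cyc
      (fun p σ a => by
        obtain ⟨i, n, m⟩ := p
        refine (congrArg _ (deltaBiased_lof _ _ _ _)).trans
          (Eq.trans ?_ (congrArg _ (deltaBiased_lof _ _ _ _)).symm)
        refine proj_deltaBiasedAux_map (fun _ => ⊤) σ.1 σ.2 (fun n' m' s t φ φ' ψ ψ' _ _ _ _ =>
          ⟨(φ.symm.trans φ', ψ.symm.trans ψ'), Subgroup.mem_top _, ?_, ?_⟩) a <;> ext <;> simp)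
      (fun p σ hσ a => cyc_le_invariance p hσ a)
    refine ⟨D, hD, fun U W => ?_⟩
    obtain ⟨_⟩ : Nonempty (LinearOrder U) := nonempty_linearOrder _
    obtain ⟨_⟩ : Nonempty (LinearOrder W) := nonempty_linearOrder _
    rw [← proj_comp_compress, ← LinearMap.comp_assoc, hD.2.1, LinearMap.comp_assoc,
      deltaBiased_comp_compress, LinearMap.comp_assoc]

end KWheeled

end

theorem mainTheorem7 {k : Type u} [Field k] :
    (∀ (ε : ℤˣ) (O : KModularOperad.{u, w} k ε), O.selfGluing.HasDifferential) ∧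
    (∀ (ε : ℤˣ) (κ : WheeledKind) (O : KWheeled.{u, w} k ε κ), O.HasDifferential) ∧
    (∀ E : EMO.{w}, (E.chains k).HasDifferential) :=
  ⟨fun _ O => O.selfGluing_isOdd.hasDifferential, fun _ _ O => O.hasDifferential,
    fun E => (E.chains_isOdd k).hasDifferential⟩
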